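/- Let $d\ge 0$, let $a<b$ be real numbers and let $f=f(t,x,\lambda)=(f_1,\dots,f_d)\in C^2([0,\infty)\times\mathbb R^d\times\mathbb R;\mathbb R^d)$ satisfy $f(t,x,a)=f(t,x,b)=0$ for all $t\ge 0$, $x\in\mathbb R^d$. Write $f'_\lambda=\partial_\lambda f$ and $\operatorname{div}_x f(t,x,\lambda)=\sum_{j}\partial_{x_j}f_j(t,x,\lambda)$. For $t\ge 0$ and $(x,\lambda)\in\mathbb R^{d}\times\mathbb R$ let $(x_0(t,x,\lambda),\lambda_0(t,x,\lambda))$ be the value at time $0$ of the solution on $[0,t]$ of the characteristic system $$\dot X=f'_\lambda(s,X,\Lambda),\qquad \dot\Lambda=-\operatorname{div}_xf(s,X,\Lambda),\qquad (X,\Lambda)(t)=(x,\lambda)$$ (if there is no such solution on $[0,t]$, put $(x_0,\lambda_0)=(x,\lambda)$; this does not happen for $x$ in a compact set, $\lambda\in[a,b]$ and small $t$). Let $\chi(\lambda,u)=1$ if $0\le\lambda\le u$, $\chi(\lambda,u)=-1$ if $u\le\lambda\le0$ (and not $\lambda = u = 0$), and $\chi(\lambda,u)=0$ otherwise. The transport-collapse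 operator is $$T(t)u(x)=a+\int_{\mathbb R}\chi\bigl(\lambda_0(t,x,\lambda)-a,\;u(x_0(t,x,\lambda))-a\bigr)\,d\lambda ,$$ which for $a=0$ is $T(t)u(x)=\int\chi(\lambda_0(t,x,\lambda),u(x_0(t,x,\lambda)))\,d\lambda$. Let $V:\mathbb R\to\mathbb R$ be convex, Lipschitz and differentiable (hence $C^1$), let $V''$ be its second derivative, a non-negative measure on $\mathbb R$ (namely $V''(\lambda)\,d\lambda$ if $V\in C^2$), and put $$B_V(t,x,v)=\int_a^v f'_\lambda(t,x,\lambda)V'(\lambda)\,d\lambda .$$ Let $\varphi\in C_c^\infty(\mathbb R^d)$, $\varphi\ge0$. Then there are $\delta>0$ and a function $r$ with $r(t)=o(t)$ as $t\to0^+$, both independent of $u$ (so depending on $u$ only through the bounds $a,b$), such that for every $u\in L^1(\mathbb R^d)$ with $a\le u\le b$ a.e. and every $t\in(0,\delta)$ the function $(V(T(t)u)-V(u))\varphi$ is integrable and $$\int_{\mathbb R^d}\bigl(V(T(t)u)-V(u)\bigr)\varphi\,dx\;\le\;\int_0^t\!\!\int_{\mathbb R^d}B_V(t',x,u(x))\cdot\nabla\varphi(x)\,dx\,dt'\;-\;\int_0^t\!\!\int_{\mathbb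 R^d}\Bigl(\int_{(a,u(x)]}\operatorname{div}_xf(t',x,\lambda)\,V''(d\lambda)\Bigr)\varphi(x)\,dx\,dt'\;+\;r(t).$$ -/

import Mathlib

open Set Filter Topology MeasureTheory Asymptotics
open scoped ContDiff

namespace TransportCollapse

/-- The kinetic function: `1` for `0 ≤ lam ≤ u`, `-1` for `u ≤ lam ≤ 0`, and `0` otherwise. -/
noncomputable def chi (lam u : ℝ) : ℝ :=
  if 0 ≤ lam ∧ lam ≤ u then 1 else if u ≤ lam ∧ lam ≤ 0 then -1 else 0

variable {d : ℕ}

/-- The derivative `f'_lam (t, x, lam)` of the flux with respect to its last variable. -/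
noncomputable def fluxDeriv (f : ℝ → EuclideanSpace ℝ (Fin d) → ℝ → EuclideanSpace ℝ (Fin d))
    (t : ℝ) (x : EuclideanSpace ℝ (Fin d)) (lam : ℝ) : EuclideanSpace ℝ (Fin d) :=
  deriv (fun l : ℝ => f t x l) lam

/-- The spatial divergence `∑ j, ∂ f_j / ∂ x_j (t, x, lam)`, with `t` and `lam` frozen. -/
noncomputable def fluxDiv (f : ℝ → EuclideanSpace ℝ (Fin d) → ℝ → EuclideanSpace ℝ (Fin d))
    (t : ℝ) (x : EuclideanSpace ℝ (Fin d)) (lam : ℝ) : ℝ :=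
  ∑ j : Fin d, (fderiv ℝ (fun y : EuclideanSpace ℝ (Fin d) => f t y lam) x
    (EuclideanSpace.single j (1 : ℝ))) j

/-- `(X, L)` is a characteristic on the time interval `[0, t]` which is at `(x, lam)` at time `t`:
`X' = f'_lam (s, X, L)`, `L' = - div_x f (s, X, L)`, `X t = x`, `L t = lam`. -/
structure IsCharacteristic (f : ℝ → EuclideanSpace ℝ (Fin d) → ℝ → EuclideanSpace ℝ (Fin d))
    (t : ℝ) (x : EuclideanSpace ℝ (Fin d)) (lam : ℝ)
    (X : ℝ → EuclideanSpace ℝ (Fin d)) (L : ℝ → ℝ) : Prop where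
  space : ∀ s ∈ Icc 0 t, HasDerivWithinAt X (fluxDeriv f s (X s) (L s)) (Icc 0 t) s
  kinetic : ∀ s ∈ Icc 0 t, HasDerivWithinAt L (-fluxDiv f s (X s) (L s)) (Icc 0 t) s
  space_end : X t = x
  kinetic_end : L t = lam

open Classical in
/-- The foot `(x₀(t, x, lam), lam₀(t, x, lam))`, at time `0`, of the characteristic which is at
`(x, lam)` at time `t`. For a flux of class `C²` there is at most one such characteristic on
`[0, t]`; where there is none (blow-up), the value is `(x, lam)` by convention. -/
noncomputable def foot (f : ℝ → EuclideanSpace ℝ (Fin d) → ℝ → EuclideanSpace ℝ (Fin d))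
    (t : ℝ) (x : EuclideanSpace ℝ (Fin d)) (lam : ℝ) : EuclideanSpace ℝ (Fin d) × ℝ :=
  if h : ∃ p : (ℝ → EuclideanSpace ℝ (Fin d)) × (ℝ → ℝ), IsCharacteristic f t x lam p.1 p.2 then
    (h.choose.1 0, h.choose.2 0)
  else (x, lam)

/-- The transport-collapse operator `T(t)` on functions with values above the reference value `a`:
`T(t)u(x) = a + ∫ χ(lam₀(t,x,lam) - a, u(x₀(t,x,lam)) - a) d lam`. -/
noncomputable def transportCollapse
    (f : ℝ → EuclideanSpace ℝ (Fin d) → ℝ → EuclideanSpace ℝ (Fin d)) (a t : ℝ)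
    (u : EuclideanSpace ℝ (Fin d) → ℝ) (x : EuclideanSpace ℝ (Fin d)) : ℝ :=
  a + ∫ lam : ℝ, chi ((foot f t x lam).2 - a) (u (foot f t x lam).1 - a)

/-- For the reference value `0` the operator is `T(t)u(x) = ∫ χ(lam₀, u(x₀)) d lam`. -/
theorem transportCollapse_zero
    (f : ℝ → EuclideanSpace ℝ (Fin d) → ℝ → EuclideanSpace ℝ (Fin d)) (t : ℝ)
    (u : EuclideanSpace ℝ (Fin d) → ℝ) (x : EuclideanSpace ℝ (Fin d)) :
    transportCollapse f 0 t u x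
      = ∫ lam : ℝ, chi (foot f t x lam).2 (u (foot f t x lam).1) := by
  simp [transportCollapse]

/-- The entropy flux `B_V(t, x, v) = ∫_a^v f'_lam (t, x, lam) V'(lam) d lam`. -/
noncomputable def entropyFlux
    (f : ℝ → EuclideanSpace ℝ (Fin d) → ℝ → EuclideanSpace ℝ (Fin d)) (V : ℝ → ℝ)
    (a t : ℝ) (x : EuclideanSpace ℝ (Fin d)) (v : ℝ) : EuclideanSpace ℝ (Fin d) :=
  ∫ lam in a..v, deriv V lam • fluxDeriv f t x lam

theorem monotone_rightDeriv {V : ℝ → ℝ} (hV : ConvexOn ℝ univ V) :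
    Monotone (fun x : ℝ => derivWithin V (Ioi x) x) := by
  have h := hV.monotoneOn_rightDeriv
  rw [interior_univ] at h
  exact monotoneOn_univ.1 h

/-- The second derivative `V''` of a convex function `V`, as a measure on the real line:
the Lebesgue-Stieltjes measure of its right derivative. -/
noncomputable def secondDeriv (V : ℝ → ℝ) (hV : ConvexOn ℝ univ V) : Measure ℝ :=
  (monotone_rightDeriv hV).stieltjesFunction.measure

/-- For `V` of class `C²`, the measure `V''` has the density `V''(lam)`. -/
theorem setIntegral_secondDeriv {V : ℝ → ℝ} (hV : ConvexOn ℝ univ V) (hV2 : ContDiff ℝ 2 V)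
    (g : ℝ → ℝ) {a v : ℝ} (hav : a ≤ v) :
    ∫ lam in Ioc a v, g lam ∂(secondDeriv V hV) = ∫ lam in a..v, g lam * deriv (deriv V) lam := by
  have hd : Differentiable ℝ V := hV2.differentiable (by norm_num)
  have h1 : ContDiff ℝ 1 (deriv V) :=
    ((contDiff_succ_iff_deriv (n := 1)).1 (by rw [one_add_one_eq_two]; exact hV2)).2.2
  have hd1 : Differentiable ℝ (deriv V) := h1.differentiable (by norm_num)
  have hc2 : Continuous (deriv (deriv V)) := h1.continuous_deriv (by norm_num)
  have hr : (fun x : ℝ => derivWithin V (Ioi x) x) = deriv V := by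
    funext x
    exact (hd x).derivWithin (uniqueDiffWithinAt_Ioi x)
  have hmono : Monotone (deriv V) := hr ▸ monotone_rightDeriv hV
  have hpos : ∀ x, 0 ≤ deriv (deriv V) x := fun x => hmono.deriv_nonneg
  have hS : ∀ x, (monotone_rightDeriv hV).stieltjesFunction x = deriv V x := by
    intro x
    rw [Monotone.stieltjesFunction_eq, hr]
    exact (hd1.continuous.continuousAt.continuousWithinAt).rightLim_eq
  have hm : secondDeriv V hV
      = volume.withDensity (fun x => ENNReal.ofReal (deriv (deriv V) x)) := by
    have hfin : IsLocallyFiniteMeasure (secondDeriv V hV) := by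
      unfold secondDeriv; infer_instance
    refine Measure.ext_of_Ioc _ _ fun p q hpq => ?_
    rw [secondDeriv, StieltjesFunction.measure_Ioc, hS, hS, withDensity_apply _ measurableSet_Ioc,
      ← ofReal_integral_eq_lintegral_ofReal (hc2.integrableOn_Ioc) (ae_of_all _ hpos),
      ← intervalIntegral.integral_of_le hpq.le,
      intervalIntegral.integral_deriv_eq_sub (fun x _ => hd1 x) (hc2.intervalIntegrable _ _)]
  have hmeas : Measurable (fun x => ENNReal.ofReal (deriv (deriv V) x)) :=
    ENNReal.measurable_ofReal.comp hc2.measurable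
  rw [hm, intervalIntegral.integral_of_le hav,
    setIntegral_withDensity_eq_setIntegral_toReal_smul hmeas
      (ae_of_all _ fun x => ENNReal.ofReal_lt_top) g measurableSet_Ioc]
  refine setIntegral_congr_fun measurableSet_Ioc fun x _ => ?_
  simp only [ENNReal.toReal_ofReal (hpos x), smul_eq_mul]
  ring

end TransportCollapse

namespace TransportCollapse

/-! ### Integral curves of time-dependent `C¹` fields: stability, existence, expansion in time. -/

section Flow

variable {Z : Type*} [NormedAddCommGroup Z] [NormedSpace ℝ Z]

/-! The argument is kinetic. With `v` a representative of `u` taking values in `[a, b]`, one has `V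
(v x) - V a = ∫ V'(λ) 1_{λ ≤ v x} dλ` over `(a, b)`. The planes `λ = a` and `λ = b` are invariant
under the characteristics, so `T(t)u - a` is almost everywhere the integral over `(a, b)` of the
transported indicator `g(x, λ) = 1_{λ₀ ≤ v(x₀)}` (`transportCollapse_ae_eq`). The collapse step is
where convexity gives an inequality: since `0 ≤ g ≤ 1` and `V'` is nondecreasing, `V (a + ∫ g) ≤ V a
+ ∫ V' g` (`apply_add_integral_le`). Hence the left-hand side is at most the integral of `V'(λ) φ(x)
(g - 1_{λ ≤ v})` over phase space, and it remains to expand this linear quantity to first order in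
`t`.

The characteristic field is divergence free, by symmetry of second derivatives (`trace_phaseDeriv`),
so moving `g` back to time `0` costs only `o(t)` (`exists_integral_image_flow_sub_le`). Exact
conservation of volume and smoothness of the flow in its initial data are not needed: the flow is
Lipschitz, hence differentiable almost everywhere, and any derivative it has is `1 + t M + o(t)`
with `M` of trace zero.

What is left is the variation of `V'(λ) φ(x)` along characteristics, integrated over the subgraph of
`v`. The variation of `φ` produces the entropy flux. That of `V'` cannot be expanded pointwise,
because `V'` is merely continuous. On a vertical segment, `λ ↦ Λ(λ)` has slope about `1 - t ∂_λ
div_x f`, so comparing `∫ V'(Λ)` with `∫ V'(Λ) dΛ = V(Λ(v)) - V(a)` gives `∫_a^v (V'(Λ) - V') ≈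
V(Λ(v)) - V(v) + t ∫_a^v V' ∂_λ div_x f` (`abs_integral_comp_sub_le`). To first order this is `t
(-V'(v) div_x f + ∫_a^v V' ∂_λ div_x f)`, which is the source term by parts against `V''`
(`setIntegral_secondDeriv_eq`).

All these expansions are uniform over base points in a compact box and over `v ∈ [a, b]`
(`exists_abs_integral_flow_sub_le`), so the errors do not see `u`, and a supremum over `u` gives a
single remainder (`exists_isLittleO_of_forall_exists`). -/

theorem _root_.IsIntegralCurveOn.reverse {F : ℝ → Z → Z} {γ : ℝ → Z} {t : ℝ}
    (h : IsIntegralCurveOn γ F (Icc 0 t)) :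
    IsIntegralCurveOn (fun s => γ (t - s)) (fun s z => -F (t - s) z) (Icc 0 t) := by
  intro s hs
  have hm : MapsTo (fun s => t - s) (Icc 0 t) (Icc 0 t) := fun s hs =>
    ⟨by linarith [hs.2], by linarith [hs.1]⟩
  have h1 : HasDerivWithinAt (fun s => t - s) (-1) (Icc 0 t) s :=
    ((hasDerivAt_id s).const_sub t).hasDerivWithinAt
  have h2 := (h (t - s) (hm hs)).scomp s h1 hm
  have h3 : HasDerivWithinAt (γ ∘ fun s => t - s) (-F (t - s) (γ (t - s))) (Icc 0 t) s := by
    simpa using h2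
  exact h3

theorem _root_.IsIntegralCurveOn.hasDerivWithinAt_Ici {F : ℝ → Z → Z} {γ : ℝ → Z} {t s : ℝ}
    (h : IsIntegralCurveOn γ F (Icc 0 t)) (hs : s ∈ Ico 0 t) :
    HasDerivWithinAt γ (F s (γ s)) (Ici s) s :=
  (h s (Ico_subset_Icc_self hs)).mono_of_mem_nhdsWithin (Icc_mem_nhdsGE_of_mem hs)

theorem dist_le_of_integralCurves {F : ℝ → Z → Z} {γ η : ℝ → Z} {t : ℝ} {D : Set Z} {K : NNReal}
    (hK : ∀ s ∈ Icc 0 t, LipschitzOnWith K (F s) D)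
    (hγ : IsIntegralCurveOn γ F (Icc 0 t)) (hη : IsIntegralCurveOn η F (Icc 0 t))
    (hγD : ∀ s ∈ Icc 0 t, γ s ∈ D) (hηD : ∀ s ∈ Icc 0 t, η s ∈ D) {s : ℝ} (hs : s ∈ Icc 0 t) :
    dist (γ s) (η s) ≤ dist (γ 0) (η 0) * Real.exp (K * s) := by
  have := dist_le_of_trajectories_ODE_of_mem (v := F) (s := fun _ => D) (a := 0) (b := t)
    (fun s hs => hK s (Ico_subset_Icc_self hs)) hγ.continuousOn
    (fun s hs => hγ.hasDerivWithinAt_Ici hs) (fun s hs => hγD s (Ico_subset_Icc_self hs))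
    hη.continuousOn
    (fun s hs => hη.hasDerivWithinAt_Ici hs) (fun s hs => hηD s (Ico_subset_Icc_self hs))
    le_rfl s hs
  simpa using this

/-- Grönwall for the time-reversed curves; it controls feet of characteristics by their end points.
-/
theorem dist_le_of_integralCurves_backward {F : ℝ → Z → Z} {γ η : ℝ → Z} {t : ℝ} {D : Set Z}
    {K : NNReal} (hK : ∀ s ∈ Icc 0 t, LipschitzOnWith K (F s) D)
    (hγ : IsIntegralCurveOn γ F (Icc 0 t)) (hη : IsIntegralCurveOn η F (Icc 0 t))
    (hγD : ∀ s ∈ Icc 0 t, γ s ∈ D) (hηD : ∀ s ∈ Icc 0 t, η s ∈ D) {s : ℝ} (hs : s ∈ Icc 0 t) :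
    dist (γ s) (η s) ≤ dist (γ t) (η t) * Real.exp (K * (t - s)) := by
  have hm : ∀ s ∈ Icc 0 t, t - s ∈ Icc 0 t := fun s hs =>
    ⟨by linarith [hs.2], by linarith [hs.1]⟩
  have := dist_le_of_integralCurves (F := fun s z => -F (t - s) z) (D := D) (K := K)
    (fun s hs x hx y hy => by simpa using hK (t - s) (hm s hs) hx hy)
    hγ.reverse hη.reverse
    (fun s hs => hγD _ (hm s hs)) (fun s hs => hηD _ (hm s hs)) (hm s hs)
  simpa using this

/-- A time-dependent vector field which is of class `C¹` in space, jointly with its derivative. -/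
structure IsC1Field (F : ℝ → Z → Z) (F' : ℝ → Z → Z →L[ℝ] Z) : Prop where
  cont : Continuous fun p : ℝ × Z => F p.1 p.2
  hasFDerivAt : ∀ s z, HasFDerivAt (F s) (F' s z) z
  cont' : Continuous fun p : ℝ × Z => F' p.1 p.2

namespace IsC1Field

variable {F : ℝ → Z → Z} {F' : ℝ → Z → Z →L[ℝ] Z}

theorem exists_bound (hF : IsC1Field F F') {D : Set Z} (hD : IsCompact D) (T : ℝ) :
    ∃ M : ℝ, 0 < M ∧ ∀ s ∈ Icc 0 T, ∀ z ∈ D, ‖F s z‖ ≤ M := by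
  obtain ⟨M, hM⟩ := ((isCompact_Icc (a := (0 : ℝ)) (b := T)).prod hD).exists_bound_of_continuousOn
    hF.cont.continuousOn
  exact ⟨max M 1, by positivity, fun s hs z hz => (hM (s, z) ⟨hs, hz⟩).trans (le_max_left _ _)⟩

theorem exists_bound' (hF : IsC1Field F F') {D : Set Z} (hD : IsCompact D) (T : ℝ) :
    ∃ M : ℝ, 0 < M ∧ ∀ s ∈ Icc 0 T, ∀ z ∈ D, ‖F' s z‖ ≤ M := by
  obtain ⟨M, hM⟩ := ((isCompact_Icc (a := (0 : ℝ)) (b := T)).prod hD).exists_bound_of_continuousOn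
    hF.cont'.continuousOn
  exact ⟨max M 1, by positivity, fun s hs z hz => (hM (s, z) ⟨hs, hz⟩).trans (le_max_left _ _)⟩

theorem exists_lipschitzOnWith (hF : IsC1Field F F') {D : Set Z} (hD : IsCompact D)
    (hDc : Convex ℝ D) (T : ℝ) : ∃ K : NNReal, ∀ s ∈ Icc 0 T, LipschitzOnWith K (F s) D := by
  obtain ⟨M, hM0, hM⟩ := hF.exists_bound' hD T
  refine ⟨⟨M, hM0.le⟩, fun s hs => hDc.lipschitzOnWith_of_nnnorm_hasFDerivWithin_le
    (fun z _ => (hF.hasFDerivAt s z).hasFDerivWithinAt) fun z hz => ?_⟩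
  exact hM s hs z hz

/-- Both curves have compact range on `[0, t]`, so they share a ball on which the field is
Lipschitz, and Grönwall applies without any global Lipschitz bound. -/
theorem eqOn_of_eq_right [ProperSpace Z] (hF : IsC1Field F F') {γ η : ℝ → Z} {t : ℝ}
    (hγ : IsIntegralCurveOn γ F (Icc 0 t)) (hη : IsIntegralCurveOn η F (Icc 0 t))
    (h : γ t = η t) : EqOn γ η (Icc 0 t) := by
  obtain ⟨r, hr⟩ := (((isCompact_Icc.image_of_continuousOn hγ.continuousOn).union
    (isCompact_Icc.image_of_continuousOn hη.continuousOn)).isBounded).subset_closedBall 0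
  obtain ⟨K, hK⟩ := hF.exists_lipschitzOnWith (isCompact_closedBall (0 : Z) r)
    (convex_closedBall _ _) t
  intro s hs
  have := dist_le_of_integralCurves_backward hK hγ hη
    (fun s hs => hr (Or.inl (mem_image_of_mem _ hs)))
    (fun s hs => hr (Or.inr (mem_image_of_mem _ hs))) hs
  rw [h, dist_self, zero_mul] at this
  exact dist_le_zero.1 this

theorem eqOn_of_eq_left [ProperSpace Z] (hF : IsC1Field F F') {γ η : ℝ → Z} {t : ℝ}
    (hγ : IsIntegralCurveOn γ F (Icc 0 t)) (hη : IsIntegralCurveOn η F (Icc 0 t))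
    (h : γ 0 = η 0) : EqOn γ η (Icc 0 t) := by
  obtain ⟨r, hr⟩ := (((isCompact_Icc.image_of_continuousOn hγ.continuousOn).union
    (isCompact_Icc.image_of_continuousOn hη.continuousOn)).isBounded).subset_closedBall 0
  obtain ⟨K, hK⟩ := hF.exists_lipschitzOnWith (isCompact_closedBall (0 : Z) r)
    (convex_closedBall _ _) t
  intro s hs
  have := dist_le_of_integralCurves hK hγ hη
    (fun s hs => hr (Or.inl (mem_image_of_mem _ hs)))
    (fun s hs => hr (Or.inr (mem_image_of_mem _ hs))) hs
  rw [h, dist_self, zero_mul] at this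
  exact dist_le_zero.1 this

/-- Integral curves exist, and stay close to the base point, for a time which is uniform over
base points whose unit balls lie in a given compact set. -/
theorem exists_integralCurve [ProperSpace Z] (hF : IsC1Field F F') {D : Set Z}
    (hD : IsCompact D) : ∃ δ > 0, ∀ t ∈ Ioo 0 δ, ∀ z, Metric.closedBall z 1 ⊆ D →
      ∀ t₀ ∈ Icc 0 t, ∃ γ : ℝ → Z, γ t₀ = z ∧ IsIntegralCurveOn γ F (Icc 0 t) ∧
        ∀ s, γ s ∈ Metric.closedBall z 1 := by
  obtain ⟨M, hM0, hM⟩ := hF.exists_bound hD 1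
  lift M to NNReal using hM0.le
  -- A curve of speed at most `M` cannot leave the unit ball before time `1 / M`.
  refine ⟨min 1 (1 / M), by positivity, fun t ht z hz t₀ ht₀ => ?_⟩
  have ht1 : t < 1 := ht.2.trans_le (min_le_left _ _)
  have htM : M * t ≤ 1 := by
    have := ht.2.trans_le (min_le_right _ _)
    rw [lt_div_iff₀ hM0] at this
    linarith
  obtain ⟨K, hK⟩ := hF.exists_lipschitzOnWith (isCompact_closedBall z 1) (convex_closedBall _ _) t
  have hP : IsPicardLindelof F (⟨t₀, ht₀⟩ : Icc 0 t) z 1 0 M K :=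
    { lipschitzOnWith := hK
      continuousOn := fun x _ => (hF.cont.comp (by fun_prop : Continuous fun s : ℝ => (s, x)))
        |>.continuousOn
      norm_le := fun s hs x hx => hM s ⟨hs.1, hs.2.trans ht1.le⟩ x (hz hx)
      mul_max_le := by
        have : max (t - t₀) (t₀ - 0) ≤ t := max_le (by linarith [ht₀.1]) (by linarith [ht₀.2])
        rw [NNReal.coe_one, NNReal.coe_zero, sub_zero (1 : ℝ)]
        exact (mul_le_mul_of_nonneg_left this M.2).trans htM }
  have hx : z ∈ Metric.closedBall z ((0 : NNReal) : ℝ) := Metric.mem_closedBall_self le_rfl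
  -- The Picard fixed point itself is kept, because membership in its function space confines the
  -- curve to the unit ball at all times.
  obtain ⟨α, hα⟩ := ODE.FunSpace.exists_isFixedPt_next hP hx
  have hin : ∀ s, α.compProj s ∈ Metric.closedBall z 1 := fun s => by
    simpa using α.compProj_mem_closedBall hP.mul_max_le
  refine ⟨α.compProj, ?_, fun s hs => ?_, hin⟩
  · have := ODE.FunSpace.compProj_val (α := α) (t := ⟨t₀, ht₀⟩)
    rw [this, ← hα, ODE.FunSpace.next_apply₀]
  · refine (ODE.hasDerivWithinAt_picard_Icc ht₀ hP.continuousOn_uncurry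
      α.continuous_compProj.continuousOn (fun _ ht' ↦ α.compProj_mem_closedBall hP.mul_max_le)
      z hs).congr_of_mem (fun s' hs' => ?_) hs
    nth_rw 1 [← hα]
    rw [ODE.FunSpace.compProj_of_mem hs', ODE.FunSpace.next_apply]

theorem norm_sub_le_of_integralCurve {γ : ℝ → Z} {t M : ℝ} {D : Set Z}
    (hM : ∀ s ∈ Icc 0 t, ∀ z ∈ D, ‖F s z‖ ≤ M)
    (hγ : IsIntegralCurveOn γ F (Icc 0 t)) (hγD : ∀ s ∈ Icc 0 t, γ s ∈ D) {s : ℝ}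
    (hs : s ∈ Icc 0 t) : ‖γ s - γ 0‖ ≤ M * s := by
  have := norm_image_sub_le_of_norm_deriv_le_segment' (f := γ) (C := M) hγ
    (fun s hs => hM s (Ico_subset_Icc_self hs) _ (hγD s (Ico_subset_Icc_self hs))) s hs
  simpa using this

/-- First-order expansion of integral curves in time. -/
theorem expansion_zero (hF : IsC1Field F F') {D : Set Z} (hD : IsCompact D) {ε : ℝ}
    (hε : 0 < ε) : ∃ δ > 0, ∀ t ∈ Ioo 0 δ, ∀ γ : ℝ → Z, IsIntegralCurveOn γ F (Icc 0 t) →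
      (∀ s ∈ Icc 0 t, γ s ∈ D) → ‖γ t - γ 0 - t • F 0 (γ 0)‖ ≤ ε * t := by
  obtain ⟨M, hM0, hM⟩ := hF.exists_bound hD 1
  have huc := ((isCompact_Icc (a := (0 : ℝ)) (b := 1)).prod hD).uniformContinuousOn_of_continuous
    hF.cont.continuousOn
  obtain ⟨ρ, hρ, huc⟩ := Metric.uniformContinuousOn_iff.1 huc ε hε
  -- The curve moves by at most `M t`, so `t < ρ` and `M t < ρ` keep `(s, γ s)` within `ρ` of `(0, γ
  -- 0)`, where the field varies by less than `ε`.
  refine ⟨min 1 (min ρ (ρ / M)), by positivity, fun t ht γ hγ hγD => ?_⟩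
  have ht1 : t < 1 := ht.2.trans_le (min_le_left _ _)
  have htρ : t < ρ := ht.2.trans_le ((min_le_right _ _).trans (min_le_left _ _))
  have htM : M * t < ρ := by
    have := ht.2.trans_le ((min_le_right _ _).trans (min_le_right _ _))
    rw [lt_div_iff₀ hM0] at this
    linarith
  have h0 : (0 : ℝ) ∈ Icc 0 t := ⟨le_rfl, ht.1.le⟩
  have key := norm_image_sub_le_of_norm_deriv_le_segment' (f := fun s => γ s - s • F 0 (γ 0))
    (f' := fun s => F s (γ s) - F 0 (γ 0)) (C := ε) (a := 0) (b := t)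
    (fun s hs => by
      have := (hγ s hs).sub ((hasDerivWithinAt_id s _).smul_const (F 0 (γ 0)))
      rw [one_smul] at this
      exact this)
    (fun s hs => by
      have hs' := Ico_subset_Icc_self hs
      rw [← dist_eq_norm]
      refine (huc (s, γ s) ⟨⟨hs.1, by linarith [hs.2]⟩, hγD s hs'⟩ (0, γ 0)
        ⟨⟨le_rfl, zero_le_one⟩, hγD 0 h0⟩ ?_).le
      rw [Prod.dist_eq, max_lt_iff]
      constructor
      · rw [Real.dist_eq, sub_zero, abs_of_nonneg hs.1]; linarith [hs.2]
      · rw [dist_eq_norm]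
        refine (norm_sub_le_of_integralCurve (fun s hs => hM s ⟨hs.1, hs.2.trans ht1.le⟩) hγ hγD
          hs').trans_lt ?_
        nlinarith [hs.2]) t ⟨ht.1.le, le_rfl⟩
  convert key using 2
  · simp only [zero_smul, sub_zero]; abel
  · ring

/-- First-order expansion in time of the difference of two integral curves, relative to their
initial distance. -/
theorem expansion_one (hF : IsC1Field F F') {D : Set Z} (hD : IsCompact D) (hDc : Convex ℝ D)
    {ε : ℝ} (hε : 0 < ε) : ∃ δ > 0, ∃ ρ > 0, ∀ t ∈ Ioo 0 δ, ∀ γ η : ℝ → Z,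
      IsIntegralCurveOn γ F (Icc 0 t) → IsIntegralCurveOn η F (Icc 0 t) →
      (∀ s ∈ Icc 0 t, γ s ∈ D) → (∀ s ∈ Icc 0 t, η s ∈ D) → ‖η 0 - γ 0‖ < ρ →
      ‖η t - γ t - (η 0 - γ 0) - t • F' 0 (γ 0) (η 0 - γ 0)‖ ≤ ε * t * ‖η 0 - γ 0‖ := by
  obtain ⟨M, hM0, hM⟩ := hF.exists_bound hD 1
  obtain ⟨C, hC0, hC⟩ := hF.exists_bound' hD 1
  obtain ⟨K, hK⟩ := hF.exists_lipschitzOnWith hD hDc 1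
  set e := Real.exp K with he
  have he0 : 0 < e := Real.exp_pos _
  have huc := ((isCompact_Icc (a := (0 : ℝ)) (b := 1)).prod hD).uniformContinuousOn_of_continuous
    hF.cont'.continuousOn
  obtain ⟨ρ, hρ, huc⟩ := Metric.uniformContinuousOn_iff.1 huc (ε / (2 * e)) (by positivity)
  have hK0 : (0 : ℝ) ≤ K := K.2
  -- With `M t < ρ / 4` and initial distance below `ρ / 4`, both curves stay within `ρ / 2` of `γ
  -- 0`, where `F'` varies by less than `ε / (2 e)`; as distances grow by a factor at most `e`, this
  -- costs `ε / 2`. The last bound on `t` makes the drift of `η - γ` from its initial value,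
  -- multiplied by `‖F'‖ ≤ C`, cost another `ε / 2`.
  refine ⟨min 1 (min ρ (min (ρ / (4 * M)) (ε / (2 * (C * (K * e) + 1))))), by positivity,
    ρ / 4, by positivity, fun t ht γ η hγ hη hγD hηD h0 => ?_⟩
  have ht1 : t < 1 := ht.2.trans_le (min_le_left _ _)
  have htρ : t < ρ := ht.2.trans_le ((min_le_right _ _).trans (min_le_left _ _))
  have htM : M * t < ρ / 4 := by
    have := ht.2.trans_le ((min_le_right _ _).trans ((min_le_right _ _).trans (min_le_left _ _)))
    rw [lt_div_iff₀ (by positivity)] at this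
    linarith
  have htC : t * (2 * (C * (K * e) + 1)) < ε := by
    have := ht.2.trans_le ((min_le_right _ _).trans ((min_le_right _ _).trans (min_le_right _ _)))
    rwa [lt_div_iff₀ (by positivity)] at this
  have h00 : (0 : ℝ) ∈ Icc 0 t := ⟨le_rfl, ht.1.le⟩
  have hle1 : ∀ s ∈ Icc 0 t, s ∈ Icc (0 : ℝ) 1 := fun s hs => ⟨hs.1, hs.2.trans ht1.le⟩
  set N := ‖η 0 - γ 0‖ with hN
  have hN0 : 0 ≤ N := norm_nonneg _
  have hdist : ∀ s ∈ Icc 0 t, ‖η s - γ s‖ ≤ e * N := by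
    intro s hs
    have := dist_le_of_integralCurves (fun s hs => hK s (hle1 s hs)) hη hγ hηD hγD hs
    rw [dist_eq_norm, dist_eq_norm] at this
    refine this.trans ?_
    rw [mul_comm]
    refine mul_le_mul_of_nonneg_right (Real.exp_le_exp.2 ?_) hN0
    nlinarith [(hle1 s hs).2]
  have hdisp : ∀ s ∈ Icc 0 t, ‖η s - γ s - (η 0 - γ 0)‖ ≤ K * (e * N) * s := by
    intro s hs
    have := norm_image_sub_le_of_norm_deriv_le_segment' (f := fun s => η s - γ s)
      (f' := fun s => F s (η s) - F s (γ s)) (C := K * (e * N)) (a := 0) (b := t)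
      (fun s hs => (hη s hs).sub (hγ s hs)) (fun s hs => by
        have hs := Ico_subset_Icc_self hs
        have := (hK s (hle1 s hs)).norm_sub_le (hηD s hs) (hγD s hs)
        refine this.trans ?_
        gcongr
        exact hdist s hs) s hs
    simpa using this
  have hball : ∀ s ∈ Icc 0 t, γ s ∈ D ∩ Metric.closedBall (γ 0) (ρ / 2) := by
    intro s hs
    refine ⟨hγD s hs, ?_⟩
    rw [Metric.mem_closedBall, dist_eq_norm]
    refine (norm_sub_le_of_integralCurve (fun s hs => hM s (hle1 s hs)) hγ hγD hs).trans ?_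
    nlinarith [hs.2]
  have hball' : ∀ s ∈ Icc 0 t, η s ∈ D ∩ Metric.closedBall (γ 0) (ρ / 2) := by
    intro s hs
    refine ⟨hηD s hs, ?_⟩
    rw [Metric.mem_closedBall, dist_eq_norm]
    have h1 := norm_sub_le_of_integralCurve (fun s hs => hM s (hle1 s hs)) hη hηD hs
    have h2 : ‖η s - γ 0‖ ≤ ‖η s - η 0‖ + ‖η 0 - γ 0‖ := norm_sub_le_norm_sub_add_norm_sub _ _ _
    nlinarith [hs.2]
  have key := norm_image_sub_le_of_norm_deriv_le_segment'
    (f := fun s => η s - γ s - s • F' 0 (γ 0) (η 0 - γ 0))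
    (f' := fun s => F s (η s) - F s (γ s) - F' 0 (γ 0) (η 0 - γ 0)) (C := ε * N) (a := 0) (b := t)
    (fun s hs => by
      have := ((hη s hs).sub (hγ s hs)).sub
        ((hasDerivWithinAt_id s _).smul_const (F' 0 (γ 0) (η 0 - γ 0)))
      rw [one_smul] at this
      exact this)
    (fun s hs => by
      have hs' := Ico_subset_Icc_self hs
      have h1 := (hDc.inter (convex_closedBall (γ 0) (ρ / 2))).norm_image_sub_le_of_norm_hasFDerivWithin_le'
        (f := F s) (f' := F' s) (φ := F' 0 (γ 0)) (C := ε / (2 * e))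
        (fun z _ => (hF.hasFDerivAt s z).hasFDerivWithinAt) (fun z hz => by
          rw [← dist_eq_norm]
          refine (huc (s, z) ⟨hle1 s hs', hz.1⟩ (0, γ 0)
            ⟨⟨le_rfl, zero_le_one⟩, hγD 0 h00⟩ ?_).le
          rw [Prod.dist_eq, max_lt_iff]
          constructor
          · rw [Real.dist_eq, sub_zero, abs_of_nonneg hs.1]; linarith [hs.2]
          · have := hz.2
            rw [Metric.mem_closedBall] at this
            simp only
            linarith) (hball s hs') (hball' s hs')
      have h2 : F s (η s) - F s (γ s) - F' 0 (γ 0) (η 0 - γ 0)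
          = (F s (η s) - F s (γ s) - F' 0 (γ 0) (η s - γ s))
            + F' 0 (γ 0) (η s - γ s - (η 0 - γ 0)) := by
        rw [map_sub (F' 0 (γ 0)) (η s - γ s)]; abel
      rw [h2]
      refine (norm_add_le _ _).trans ?_
      have h3 : ‖F' 0 (γ 0) (η s - γ s - (η 0 - γ 0))‖ ≤ C * (K * (e * N) * s) :=
        (ContinuousLinearMap.le_opNorm _ _).trans (mul_le_mul
          (hC 0 ⟨le_rfl, zero_le_one⟩ _ (hγD 0 h00)) (hdisp s hs') (norm_nonneg _) hC0.le)
      have h4 : ε / (2 * e) * ‖η s - γ s‖ ≤ ε / 2 * N := by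
        calc ε / (2 * e) * ‖η s - γ s‖ ≤ ε / (2 * e) * (e * N) := by
              gcongr; exact hdist s hs'
          _ = ε / 2 * N := by field_simp
      have h5 : C * (K * (e * N) * s) ≤ ε / 2 * N := by
        have : C * (K * e) * s ≤ ε / 2 := by
          have : C * (K * e) * s ≤ C * (K * e) * t := by gcongr; exact hs.2.le
          nlinarith [ht.1]
        calc C * (K * (e * N) * s) = C * (K * e) * s * N := by ring
          _ ≤ ε / 2 * N := by gcongr
      linarith) t ⟨ht.1.le, le_rfl⟩
  rw [sub_zero, zero_smul, sub_zero] at key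
  refine (le_of_eq ?_).trans (key.trans_eq (by ring))
  congr 1
  abel

end IsC1Field

end Flow

/-! ### Determinants near the identity and almost volume-preserving Lipschitz maps. -/

section Volume

variable {Z : Type*} [NormedAddCommGroup Z] [NormedSpace ℝ Z] [FiniteDimensional ℝ Z]

theorem differentiable_det : Differentiable ℝ fun A : Z →L[ℝ] Z => A.det := by
  classical
  let b := Module.finBasis ℝ Z
  have h : (fun A : Z →L[ℝ] Z => A.det) = fun A : Z →L[ℝ] Z =>
      ∑ σ : Equiv.Perm (Fin (Module.finrank ℝ Z)), ((Equiv.Perm.sign σ : ℤ) : ℝ) *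
        ∏ i, b.repr (A (b i)) (σ i) := by
    funext A
    rw [ContinuousLinearMap.det, ← LinearMap.det_toMatrix b, Matrix.det_apply']
    simp [LinearMap.toMatrix_apply]
  rw [h]
  have h1 : ∀ i j, ContDiff ℝ 1 fun A : Z →L[ℝ] Z => b.repr (A (b i)) j := by
    intro i j
    have : (fun A : Z →L[ℝ] Z => b.repr (A (b i)) j)
        = (LinearMap.toContinuousLinearMap (b.coord j)) ∘ fun A : Z →L[ℝ] Z => A (b i) := rfl
    rw [this]
    exact (ContinuousLinearMap.contDiff _).comp
      (ContinuousLinearMap.contDiff (ContinuousLinearMap.apply ℝ Z (b i)))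
  refine ContDiff.differentiable (n := 1) ?_ one_ne_zero
  exact ContDiff.sum fun σ _ => contDiff_const.mul (contDiff_prod fun i _ => h1 _ _)

/-- On the line `1 + r M` the determinant is a polynomial `1 + r tr M + r² q(r)`, whose derivative
at `0` is the trace. -/
theorem fderiv_det_one (M : Z →L[ℝ] Z) :
    fderiv ℝ (fun A : Z →L[ℝ] Z => A.det) 1 M = LinearMap.trace ℝ Z M := by
  classical
  let b := Module.finBasis ℝ Z
  have h1 : HasDerivAt (fun r : ℝ => ((1 : Z →L[ℝ] Z) + r • M).det)
      (fderiv ℝ (fun A : Z →L[ℝ] Z => A.det) 1 M) 0 := by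
    have hl : HasDerivAt (fun r : ℝ => (1 : Z →L[ℝ] Z) + r • M) M 0 := by
      simpa using ((hasDerivAt_id (0 : ℝ)).smul_const M).const_add (1 : Z →L[ℝ] Z)
    have hd : HasFDerivAt (fun A : Z →L[ℝ] Z => A.det)
        (fderiv ℝ (fun A : Z →L[ℝ] Z => A.det) 1) ((1 : Z →L[ℝ] Z) + (0 : ℝ) • M) := by
      rw [zero_smul, add_zero]
      exact (differentiable_det _).hasFDerivAt
    exact hd.comp_hasDerivAt 0 hl
  set m := LinearMap.toMatrix b b (M : Z →ₗ[ℝ] Z) with hm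
  obtain ⟨q, hq⟩ : ∃ q : Polynomial ℝ, ∀ r : ℝ, ((1 : Z →L[ℝ] Z) + r • M).det
      = 1 + m.trace * r + q.eval r * r ^ 2 := by
    refine ⟨(Matrix.det (1 + (Polynomial.X : Polynomial ℝ) • m.map Polynomial.C)).divX.divX,
      fun r => ?_⟩
    rw [← Matrix.det_one_add_smul r m, ContinuousLinearMap.det, ← LinearMap.det_toMatrix b]
    congr 1
    simp [hm, LinearMap.toMatrix_one]
  have h2 : HasDerivAt (fun r : ℝ => ((1 : Z →L[ℝ] Z) + r • M).det) m.trace 0 := by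
    have := (((hasDerivAt_id (0 : ℝ)).const_mul m.trace).const_add 1).add
      ((q.hasDerivAt 0).mul ((hasDerivAt_id (0 : ℝ)).pow 2))
    have h3 : (fun r : ℝ => ((1 : Z →L[ℝ] Z) + r • M).det)
        = fun r => 1 + m.trace * r + q.eval r * r ^ 2 := funext hq
    rw [h3]
    refine this.congr_deriv ?_
    simp
  rw [h1.unique h2, hm, ← LinearMap.trace_eq_matrix_trace]

/-- Linear maps close to `1 + t • M` with `M` of trace zero have determinant `1 + o(t)`. -/
theorem exists_abs_det_sub_one_le {C : ℝ} {ε : ℝ} (hε : 0 < ε) :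
    ∃ δ > 0, ∀ A M : Z →L[ℝ] Z, LinearMap.trace ℝ Z M = 0 → ‖M‖ ≤ C → ∀ t ∈ Ioo 0 δ,
      ‖A - 1 - t • M‖ ≤ δ * t → |(|A.det|) - 1| ≤ ε * t := by
  set D := fderiv ℝ (fun A : Z →L[ℝ] Z => A.det) 1 with hD
  set C' := max C 0 + 1 with hC'
  have hC'0 : 0 < C' := by positivity
  have hlo := (hasFDerivAt_iff_isLittleO.1
    (differentiable_det (1 : Z →L[ℝ] Z)).hasFDerivAt).def
      (show 0 < ε / (2 * C') by positivity)
  obtain ⟨ρ, hρ, hball⟩ := Metric.eventually_nhds_iff.1 hlo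
  -- Since `δ ≤ 1`, `‖A - 1‖ ≤ C' t`, and `δ C' ≤ ρ` puts `A` in the ball where the Taylor remainder
  -- of the determinant is at most `ε t / 2`. The linear term sees only `A - 1 - t M`, because it
  -- kills `M`, and `δ ‖D‖ ≤ ε / 2` bounds it.
  refine ⟨min 1 (min (ρ / C') (ε / (2 * (‖D‖ + 1)))), by positivity,
    fun A M htr hM t ht hA => ?_⟩
  set δ := min 1 (min (ρ / C') (ε / (2 * (‖D‖ + 1)))) with hδ
  have h1 : δ ≤ 1 := min_le_left _ _
  have h2 : δ * C' ≤ ρ := by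
    rw [← le_div_iff₀ hC'0]; exact (min_le_right _ _).trans (min_le_left _ _)
  have h3 : δ * (2 * (‖D‖ + 1)) ≤ ε := by
    rw [← le_div_iff₀ (by positivity)]; exact (min_le_right _ _).trans (min_le_right _ _)
  have ht0 := ht.1
  have hA1 : ‖A - 1‖ ≤ C' * t := by
    have : A - 1 = (A - 1 - t • M) + t • M := by abel
    rw [this]
    refine (norm_add_le _ _).trans ?_
    rw [norm_smul, Real.norm_eq_abs, abs_of_pos ht0]
    have : ‖M‖ ≤ max C 0 := hM.trans (le_max_left _ _)
    nlinarith
  have hA2 : dist A 1 < ρ := by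
    rw [dist_eq_norm]
    refine hA1.trans_lt (lt_of_lt_of_le ?_ h2)
    rw [mul_comm]
    exact mul_lt_mul_of_pos_right ht.2 hC'0
  have h4 := hball hA2
  rw [show (1 : Z →L[ℝ] Z).det = 1 from by simp [ContinuousLinearMap.det]] at h4
  have h5 : D (A - 1) = D (A - 1 - t • M) := by
    rw [map_sub D (A - 1), map_smul, hD, fderiv_det_one M, htr, smul_zero, sub_zero]
  rw [← hD, h5] at h4
  have h6 : ‖D (A - 1 - t • M)‖ ≤ ε / 2 * t := by
    refine (D.le_opNorm _).trans ?_
    have : ‖D‖ * ‖A - 1 - t • M‖ ≤ ‖D‖ * (δ * t) := by gcongr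
    have h0 : 0 < δ := by positivity
    have : ‖D‖ * δ ≤ ε / 2 := by nlinarith
    nlinarith
  have h7 : ε / (2 * C') * ‖A - 1‖ ≤ ε / 2 * t := by
    calc ε / (2 * C') * ‖A - 1‖ ≤ ε / (2 * C') * (C' * t) := by gcongr
      _ = ε / 2 * t := by field_simp
  have h8 : |A.det - 1| ≤ ε * t := by
    have : A.det - 1 = (A.det - 1 - D (A - 1 - t • M)) + D (A - 1 - t • M) := by ring
    rw [this, ← Real.norm_eq_abs]
    refine (norm_add_le _ _).trans ?_
    linarith
  have h9 := abs_abs_sub_abs_le A.det 1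
  rw [abs_one] at h9
  exact h9.trans h8

variable [MeasurableSpace Z] [BorelSpace Z]


variable (μ : Measure Z) [μ.IsAddHaarMeasure]

/-- Haar measure and top-dimensional Hausdorff measure have the same null sets, and Lipschitz maps
multiply the latter by at most a constant. -/
theorem measure_image_eq_zero_of_lipschitzOnWith {Φ : Z → Z} {N : Set Z} {K : NNReal}
    (h : LipschitzOnWith K Φ N) (hN : μ N = 0) : μ (Φ '' N) = 0 := by
  have h1 : Measure.hausdorffMeasure (Module.finrank ℝ Z : ℝ) N = 0 :=
    (Measure.absolutelyContinuous_isAddHaarMeasure _ μ) hN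
  refine (Measure.absolutelyContinuous_isAddHaarMeasure μ
    (Measure.hausdorffMeasure (Module.finrank ℝ Z : ℝ))) ?_
  have h2 := h.hausdorffMeasure_image_le (d := Module.finrank ℝ Z) (by positivity)
  rw [h1, mul_zero] at h2
  exact le_antisymm h2 zero_le

/-- The hypothesis makes `A` injective on `S` with Lipschitz inverse, and the set is an image of
part of `N` under that inverse. Neither `A` nor `S` has to be measurable. -/
theorem measure_inter_preimage_eq_zero_of_dist_le {A : Z → Z} {S N : Set Z} {C : ℝ}
    (h : ∀ x ∈ S, ∀ y ∈ S, dist x y ≤ C * dist (A x) (A y)) (hN : μ N = 0) :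
    μ (S ∩ A ⁻¹' N) = 0 := by
  have hinj : InjOn A S := fun x hx y hy hxy => by
    have := h x hx y hy
    rw [hxy, dist_self, mul_zero] at this
    exact dist_le_zero.1 this
  rcases S.eq_empty_or_nonempty with rfl | ⟨z₀, hz₀⟩
  · simp
  have : Nonempty Z := ⟨z₀⟩
  have hB : LipschitzOnWith C.toNNReal (Function.invFunOn A S) (A '' S ∩ N) := by
    refine LipschitzOnWith.of_dist_le_mul ?_
    rintro _ ⟨⟨x, hx, rfl⟩, -⟩ _ ⟨⟨y, hy, rfl⟩, -⟩
    rw [hinj.leftInvOn_invFunOn hx, hinj.leftInvOn_invFunOn hy]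
    refine (h x hx y hy).trans ?_
    gcongr
    exact Real.le_coe_toNNReal C
  refine measure_mono_null ?_ (measure_image_eq_zero_of_lipschitzOnWith μ hB
    (measure_mono_null inter_subset_right hN))
  rintro x ⟨hx, hxN⟩
  exact ⟨A x, ⟨mem_image_of_mem _ hx, hxN⟩, hinj.leftInvOn_invFunOn hx⟩

/-- Change of variables, up to `o(t)`, for a Lipschitz map whose first-order expansion is
`1 + t • M + o(t)` with `M` of trace zero. -/
theorem exists_integral_image_sub_le {C ε : ℝ} (hε : 0 < ε) :
    ∃ δ > 0, ∀ t ∈ Ioo 0 δ, ∀ (W : Set Z) (Φ : Z → Z) (K : NNReal) (M : Z → Z →L[ℝ] Z),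
      IsOpen W → μ W ≠ ⊤ → LipschitzOnWith K Φ W → InjOn Φ W →
      (∀ z ∈ W, LinearMap.trace ℝ Z (M z) = 0 ∧ ‖M z‖ ≤ C ∧
        ∀ᶠ z' in 𝓝 z, ‖Φ z' - Φ z - (z' - z) - t • M z (z' - z)‖ ≤ δ * t * ‖z' - z‖) →
      ∀ (k : Z → ℝ) (B : ℝ), (∀ z ∈ W, |k (Φ z)| ≤ B) →
        AEStronglyMeasurable (fun z => k (Φ z)) (μ.restrict W) →
        |∫ z in Φ '' W, k z ∂μ - ∫ z in W, k (Φ z) ∂μ| ≤ ε * t * B * μ.real W := by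
  obtain ⟨δ, hδ, hdet⟩ := exists_abs_det_sub_one_le (Z := Z) (C := C) hε
  refine ⟨δ, hδ, fun t ht W Φ K M hW hWf hL hinj hM k B hB hk => ?_⟩
  -- Rademacher: outside a null set `N`, whose image under `Φ` is again null, the exact change of
  -- variables is available, and only the Jacobian has to be estimated.
  have hK := hL.ae_differentiableWithinAt_of_mem (μ := μ)
  obtain ⟨N, hNsub, hNm, hN0⟩ := exists_measurable_superset_of_null (ae_iff.1 hK)
  set W' := W \ N with hW'
  have hW'm : MeasurableSet W' := hW.measurableSet.diff hNm
  have hae : W' =ᵐ[μ] W := sdiff_null_ae_eq_self hN0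
  have hd : ∀ z ∈ W', HasFDerivAt Φ (fderiv ℝ Φ z) z := by
    rintro z ⟨hz, hzN⟩
    have : ¬ ¬ (z ∈ W → DifferentiableWithinAt ℝ Φ W z) := fun h => hzN (hNsub h)
    exact ((not_not.1 this hz).differentiableAt (hW.mem_nhds hz)).hasFDerivAt
  have himg : (Φ '' W' : Set Z) =ᵐ[μ] Φ '' W := by
    have h0 : μ (Φ '' (W ∩ N)) = 0 := measure_image_eq_zero_of_lipschitzOnWith μ
      (hL.mono inter_subset_left) (measure_mono_null inter_subset_right hN0)
    have : Φ '' W = Φ '' W' ∪ Φ '' (W ∩ N) := by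
      rw [← image_union, hW', sdiff_union_inter]
    rw [this]
    exact (union_ae_eq_left_of_ae_eq_empty (ae_eq_empty.2 h0)).symm
  have hdet' : ∀ z ∈ W', |(|(fderiv ℝ Φ z).det|) - 1| ≤ ε * t := by
    intro z hz
    obtain ⟨htr, hMC, hexp⟩ := hM z hz.1
    refine hdet _ (M z) htr hMC t ht ?_
    have h1 : HasFDerivAt (fun z' => Φ z' - z' - t • M z z') (fderiv ℝ Φ z - 1 - t • M z) z :=
      ((hd z hz).sub (hasFDerivAt_id z)).sub ((M z).hasFDerivAt.const_smul t)
    -- The assumed expansion is a Lipschitz bound at `z` for `Φ - id - t M z`, hence bounds its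
    -- derivative wherever that derivative exists.
    refine h1.le_of_lip' (by have := ht.1; positivity) (hexp.mono fun z' hz' => ?_)
    refine (le_of_eq ?_).trans hz'
    congr 1
    rw [map_sub, smul_sub]
    abel
  rw [← setIntegral_congr_set himg, ← setIntegral_congr_set hae,
    integral_image_eq_integral_abs_det_fderiv_smul μ hW'm
      (fun z hz => (hd z hz).hasFDerivWithinAt) (hinj.mono sdiff_subset)]
  have hW'f : μ W' < ⊤ := (measure_mono sdiff_subset).trans_lt hWf.lt_top
  have : IsFiniteMeasure (μ.restrict W') := ⟨by simpa using hW'f⟩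
  have hk' : AEStronglyMeasurable (fun z => k (Φ z)) (μ.restrict W') :=
    hk.mono_measure (Measure.restrict_mono sdiff_subset le_rfl)
  have hB0 : ∀ᵐ z ∂μ.restrict W', ‖k (Φ z)‖ ≤ B :=
    (ae_restrict_iff' hW'm).2 (ae_of_all _ fun z hz => hB z hz.1)
  have hint : Integrable (fun z => k (Φ z)) (μ.restrict W') := Integrable.of_bound hk' B hB0
  have hdm : AEStronglyMeasurable (fun z => |(fderiv ℝ Φ z).det|) (μ.restrict W') := by
    have := (aemeasurable_toNNReal_abs_det_fderivWithin μ hW'm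
      (fun z hz => (hd z hz).hasFDerivWithinAt)).coe_nnreal_real
    refine this.aestronglyMeasurable.congr (ae_of_all _ fun z => ?_)
    exact Real.coe_toNNReal _ (abs_nonneg _)
  have hdb : ∀ᵐ z ∂μ.restrict W', ‖|(fderiv ℝ Φ z).det|‖ ≤ 1 + ε * t := by
    refine (ae_restrict_iff' hW'm).2 (ae_of_all _ fun z hz => ?_)
    rw [Real.norm_eq_abs, abs_abs]
    linarith [(abs_le.1 (hdet' z hz)).2]
  have hint' : Integrable (fun z => |(fderiv ℝ Φ z).det| • k (Φ z)) (μ.restrict W') :=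
    hint.bdd_mul hdm hdb
  rw [← integral_sub hint' hint]
  have hle : ∀ z ∈ W', ‖|(fderiv ℝ Φ z).det| • k (Φ z) - k (Φ z)‖ ≤ ε * t * B := by
    intro z hz
    rw [smul_eq_mul, ← sub_one_mul, norm_mul]
    exact mul_le_mul (hdet' z hz) (hB z hz.1) (norm_nonneg _)
      (by have := ht.1; positivity)
  refine (norm_setIntegral_le_of_norm_le_const hW'f hle).trans ?_
  rcases W'.eq_empty_or_nonempty with he | ⟨z, hz⟩
  · have : μ.real W = 0 := by
      rw [measureReal_def, ← measure_congr hae, he]; simp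
    rw [he, this]; simp
  · have : 0 ≤ ε * t * B := (norm_nonneg _).trans (hle z hz)
    gcongr
    exact sdiff_subset

end Volume

/-! ### Convex functions of one variable: continuity of `V'`, the collapse inequality, the measure
`V''`. -/

section Convex

variable {V : ℝ → ℝ}

theorem rightDeriv_eq_deriv (hVd : Differentiable ℝ V) :
    (fun x : ℝ => derivWithin V (Ioi x) x) = deriv V :=
  funext fun x => (hVd x).derivWithin (uniqueDiffWithinAt_Ioi x)

theorem monotone_deriv (hV : ConvexOn ℝ univ V) (hVd : Differentiable ℝ V) :
    Monotone (deriv V) :=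
  rightDeriv_eq_deriv hVd ▸ monotone_rightDeriv hV

theorem continuous_deriv (hV : ConvexOn ℝ univ V) (hVd : Differentiable ℝ V) :
    Continuous (deriv V) := by
  have hm := monotone_deriv hV hVd
  -- The term given for `f` is just `V`. By Darboux the range of `V'` is an interval, whereas a
  -- monotone function with a jump omits all but at most one value inside the jump.
  have hc := (convex_univ (𝕜 := ℝ) (E := ℝ)).image_deriv (f := deriv V |> fun _ => V)
    (fun x _ => hVd x)
  refine continuous_iff_continuousAt.2 fun x => hm.continuousAt_iff_leftLim_eq_rightLim.2 ?_
  by_contra hne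
  have hlt := lt_of_le_of_ne ((hm.leftLim_le le_rfl).trans (hm.le_rightLim (le_refl x))) hne
  obtain ⟨y, ⟨hy1, hy2⟩, hy3⟩ : ∃ y ∈ Ioo (Function.leftLim (deriv V) x)
      (Function.rightLim (deriv V) x), y ≠ deriv V x :=
    ((Ioo_infinite hlt).sdiff (finite_singleton (deriv V x))).nonempty.imp fun y hy =>
      ⟨hy.1, hy.2⟩
  have h1 : deriv V (x - 1) ≤ y := (hm.le_leftLim (by linarith)).trans hy1.le
  have h2 : y ≤ deriv V (x + 1) := hy2.le.trans (hm.rightLim_le (by linarith))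
  obtain ⟨z, -, rfl⟩ := hc.ordConnected.out (mem_image_of_mem _ (mem_univ (x - 1)))
    (mem_image_of_mem _ (mem_univ (x + 1))) ⟨h1, h2⟩
  rcases lt_trichotomy z x with h | h | h
  · exact absurd (hm.le_leftLim h) (not_le.2 hy1)
  · exact hy3 (by rw [h])
  · exact absurd (hm.rightLim_le h) (not_le.2 hy2)

theorem integral_deriv_eq (hV : ConvexOn ℝ univ V) (hVd : Differentiable ℝ V) (a v : ℝ) :
    ∫ x in a..v, deriv V x = V v - V a :=
  intervalIntegral.integral_deriv_eq_sub (fun x _ => hVd x)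
    ((continuous_deriv hV hVd).intervalIntegrable _ _)

/-- Rearranging mass to the left decreases the integral against the monotone function `V'`. -/
theorem apply_add_integral_le (hV : ConvexOn ℝ univ V) (hVd : Differentiable ℝ V) {a b : ℝ}
    {g : ℝ → ℝ} (hab : a ≤ b) (hg : AEStronglyMeasurable g (volume.restrict (Ioo a b)))
    (hg0 : ∀ x ∈ Ioo a b, 0 ≤ g x) (hg1 : ∀ x ∈ Ioo a b, g x ≤ 1) :
    V (a + ∫ x in Ioo a b, g x) ≤ V a + ∫ x in Ioo a b, deriv V x * g x := by
  set p := deriv V with hp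
  have hpc : Continuous p := continuous_deriv hV hVd
  have hbd : ∀ᵐ x ∂(volume.restrict (Ioo a b)), ‖g x‖ ≤ 1 :=
    (ae_restrict_iff' measurableSet_Ioo).2 (ae_of_all _ fun x hx => by
      rw [Real.norm_eq_abs, abs_of_nonneg (hg0 x hx)]; exact hg1 x hx)
  have hgi : IntegrableOn g (Ioo a b) := Integrable.of_bound hg 1 hbd
  have hpi : IntegrableOn p (Ioo a b) := hpc.integrableOn_Icc.mono_set Ioo_subset_Icc_self
  have hpgi : IntegrableOn (fun x => p x * g x) (Ioo a b) := by
    have : IntegrableOn (fun x => g x * p x) (Ioo a b) := hpi.bdd_mul hg hbd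
    simpa only [mul_comm] using this
  set v := a + ∫ x in Ioo a b, g x with hv
  have hav : a ≤ v := by
    have : 0 ≤ ∫ x in Ioo a b, g x := setIntegral_nonneg measurableSet_Ioo hg0
    linarith
  have hvb : v ≤ b := by
    have : ∫ x in Ioo a b, g x ≤ ∫ x in Ioo a b, (1 : ℝ) :=
      setIntegral_mono_on hgi (integrable_const _) measurableSet_Ioo hg1
    simp [hab] at this
    linarith
  have hind : ∀ q : ℝ → ℝ, Continuous q →
      ∫ x in Ioo a b, (Iic v).indicator q x = ∫ x in a..v, q x := by
    intro q hq
    rw [setIntegral_indicator measurableSet_Iic, intervalIntegral.integral_of_le hav]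
    refine setIntegral_congr_set ?_
    have : (Ioo a b ∩ Iic v : Set ℝ) =ᵐ[volume] (Ioc a b ∩ Iic v : Set ℝ) :=
      (Ioo_ae_eq_Ioc).inter (ae_eq_refl _)
    refine this.trans (Eq.eventuallyEq ?_)
    ext x
    constructor
    · rintro ⟨h1, h2⟩; exact ⟨h1.1, h2⟩
    · rintro ⟨h1, h2⟩; exact ⟨⟨h1, h2.trans hvb⟩, h2⟩
  have hii : ∀ q : ℝ → ℝ, Continuous q → IntegrableOn ((Iic v).indicator q) (Ioo a b) :=
    fun q hq => (hq.integrableOn_Icc.mono_set Ioo_subset_Icc_self).indicator measurableSet_Iic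
  -- The integrand is `(V'(x) - V'(v)) (g(x) - 1_{x ≤ v})`, whose factors are both nonpositive for
  -- `x ≤ v` and both nonnegative beyond. The term in `V'(v)` integrates to zero because `v - a` is
  -- the mass of `g`.
  have h0 : 0 ≤ ∫ x in Ioo a b, (p x * g x - (Iic v).indicator p x
      - (p v * g x - (Iic v).indicator (fun _ => p v) x)) := by
    refine setIntegral_nonneg measurableSet_Ioo fun x hx => ?_
    have hm := monotone_deriv hV hVd
    by_cases hxv : x ≤ v
    · rw [indicator_of_mem (mem_Iic.2 hxv), indicator_of_mem (mem_Iic.2 hxv)]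
      nlinarith [hm hxv, hg1 x hx]
    · rw [indicator_of_notMem (show x ∉ Iic v from hxv),
        indicator_of_notMem (show x ∉ Iic v from hxv)]
      nlinarith [hm (not_le.1 hxv).le, hg0 x hx]
  have hc1 := hii p hpc
  have hc2 := hii (fun _ => p v) continuous_const
  have hgv : IntegrableOn (fun x => p v * g x) (Ioo a b) := hgi.const_mul _
  have hd1 : IntegrableOn (fun x => p x * g x - (Iic v).indicator p x) (Ioo a b) := hpgi.sub hc1
  have hd2 : IntegrableOn (fun x => p v * g x - (Iic v).indicator (fun _ => p v) x) (Ioo a b) :=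
    hgv.sub hc2
  rw [integral_sub hd1 hd2, integral_sub hpgi hc1, integral_sub hgv hc2, hind p hpc,
    hind _ continuous_const,
    integral_const_mul, integral_deriv_eq hV hVd] at h0
  simp only [intervalIntegral.integral_const, smul_eq_mul] at h0
  have : v - a = ∫ x in Ioo a b, g x := by rw [hv]; ring
  rw [this] at h0
  linarith

theorem secondDeriv_Ioc (hV : ConvexOn ℝ univ V) (hVd : Differentiable ℝ V) (x y : ℝ) :
    secondDeriv V hV (Ioc x y) = ENNReal.ofReal (deriv V y - deriv V x) := by
  have hS : ∀ x, (monotone_rightDeriv hV).stieltjesFunction x = deriv V x := by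
    intro x
    rw [Monotone.stieltjesFunction_eq, rightDeriv_eq_deriv hVd]
    exact ((continuous_deriv hV hVd).continuousAt.continuousWithinAt).rightLim_eq
  rw [secondDeriv, StieltjesFunction.measure_Ioc, hS, hS]

/-- Continuity of `V'` means that `V''` has no atoms, so the left end point contributes nothing. -/
theorem secondDeriv_Icc (hV : ConvexOn ℝ univ V) (hVd : Differentiable ℝ V) (x y : ℝ) :
    secondDeriv V hV (Icc x y) = ENNReal.ofReal (deriv V y - deriv V x) := by
  have hS : ∀ x, (monotone_rightDeriv hV).stieltjesFunction x = deriv V x := by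
    intro x
    rw [Monotone.stieltjesFunction_eq, rightDeriv_eq_deriv hVd]
    exact ((continuous_deriv hV hVd).continuousAt.continuousWithinAt).rightLim_eq
  have hS' : ((monotone_rightDeriv hV).stieltjesFunction : ℝ → ℝ) = deriv V := funext hS
  rw [secondDeriv, StieltjesFunction.measure_Icc, hS, hS',
    ((continuous_deriv hV hVd).continuousAt.continuousWithinAt).leftLim_eq]

/-- Integration by parts against the measure `V''`. -/
theorem setIntegral_secondDeriv_eq (hV : ConvexOn ℝ univ V) (hVd : Differentiable ℝ V)
    {g g' : ℝ → ℝ} {a v : ℝ} (hav : a ≤ v) (hg : ∀ x, HasDerivAt g (g' x) x)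
    (hg' : Continuous g') (hga : g a = 0) :
    ∫ x in Ioc a v, g x ∂(secondDeriv V hV)
      = deriv V v * g v - ∫ x in a..v, deriv V x * g' x := by
  have hpc := continuous_deriv hV hVd
  have hFTC : ∀ y, ∫ x in a..y, g' x = g y := fun y => by
    rw [intervalIntegral.integral_eq_sub_of_hasDerivAt (fun x _ => hg x)
      (hg'.intervalIntegrable _ _), hga, sub_zero]
  set ν := (secondDeriv V hV).restrict (Ioc a v) with hν
  have : IsFiniteMeasure ν := ⟨by
    rw [hν, Measure.restrict_apply_univ, secondDeriv_Ioc hV hVd]; exact ENNReal.ofReal_lt_top⟩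
  -- Writing `g(x) = ∫_a^x g'`, which uses `g a = 0`, turns the claim into Fubini on the triangle `y
  -- ≤ x`; the inner integral is the `V''`-mass of `[y, v]`, namely `V'(v) - V'(y)`.
  have h1 : ∀ x ∈ Ioc a v, g x = ∫ y in Ioc a v, (Ici y).indicator (fun _ => g' y) x := by
    intro x hx
    rw [← hFTC x, intervalIntegral.integral_of_le hx.1.le]
    have : (fun y => (Ici y).indicator (fun _ => g' y) x) = (Iic x).indicator g' := by
      funext y
      by_cases h : y ≤ x
      · rw [indicator_of_mem (mem_Ici.2 h), indicator_of_mem (mem_Iic.2 h)]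
      · rw [indicator_of_notMem (show x ∉ Ici y from h),
          indicator_of_notMem (show y ∉ Iic x from h)]
    rw [this, setIntegral_indicator measurableSet_Iic, Ioc_inter_Iic, min_eq_right hx.2]
  rw [setIntegral_congr_fun measurableSet_Ioc h1, ← hν]
  have hint : Integrable (Function.uncurry fun x y => (Ici y).indicator (fun _ => g' y) x)
      (ν.prod (volume.restrict (Ioc a v))) := by
    obtain ⟨C, hC⟩ := (isCompact_Icc (a := a) (b := v)).exists_bound_of_continuousOn
      hg'.continuousOn
    have hset : MeasurableSet {q : ℝ × ℝ | q.2 ≤ q.1} :=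
      measurableSet_le measurable_snd measurable_fst
    have heq : (Function.uncurry fun x y => (Ici y).indicator (fun _ => g' y) x)
        = {q : ℝ × ℝ | q.2 ≤ q.1}.indicator fun q => g' q.2 := by
      funext q
      by_cases h : q.2 ≤ q.1
      · rw [indicator_of_mem (show q ∈ {q : ℝ × ℝ | q.2 ≤ q.1} from h), Function.uncurry,
          indicator_of_mem (mem_Ici.2 h)]
      · rw [indicator_of_notMem (show q ∉ {q : ℝ × ℝ | q.2 ≤ q.1} from h), Function.uncurry,
          indicator_of_notMem (show q.1 ∉ Ici q.2 from h)]
    rw [heq]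
    refine Integrable.indicator (Integrable.of_bound
      (hg'.comp continuous_snd).aestronglyMeasurable C ?_) hset
    have : ∀ᵐ q ∂(ν.prod (volume.restrict (Ioc a v))), q.2 ∈ Ioc a v :=
      Measure.quasiMeasurePreserving_snd.ae (ae_restrict_mem measurableSet_Ioc)
    filter_upwards [this] with q hq using hC _ (Ioc_subset_Icc_self hq)
  rw [integral_integral_swap hint]
  have h2 : ∀ y ∈ Ioc a v, ∫ x, (Ici y).indicator (fun _ => g' y) x ∂ν
      = (deriv V v) * g' y - deriv V y * g' y := by
    intro y hy
    rw [hν, setIntegral_indicator measurableSet_Ici]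
    have : Ioc a v ∩ Ici y = Icc y v := by
      ext x
      constructor
      · rintro ⟨h1, h2⟩; exact ⟨h2, h1.2⟩
      · rintro ⟨h1, h2⟩; exact ⟨⟨hy.1.trans_le h1, h2⟩, h1⟩
    rw [this, setIntegral_const, measureReal_def, secondDeriv_Icc hV hVd,
      ENNReal.toReal_ofReal (sub_nonneg.2 (monotone_deriv hV hVd hy.2)), smul_eq_mul, sub_mul]
  have h3 : IntervalIntegrable (fun x => deriv V v * g' x) volume a v :=
    (continuous_const.mul hg').intervalIntegrable _ _
  have h4 : IntervalIntegrable (fun x => deriv V x * g' x) volume a v :=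
    (hpc.mul hg').intervalIntegrable _ _
  rw [setIntegral_congr_fun measurableSet_Ioc h2, ← intervalIntegral.integral_of_le hav,
    intervalIntegral.integral_sub h3 h4, intervalIntegral.integral_const_mul, hFTC]

end Convex

/-- Expansion of `∫ (V' ∘ Λ - V')` for a map `Λ` whose right slopes are `1 - t c + o(t)`. -/
theorem abs_integral_comp_sub_le {V p Λ c : ℝ → ℝ} {a b t ε₁ ε₂ C P : ℝ}
    (hV : ∀ x, HasDerivAt V (p x) x) (hp : Continuous p) (hΛ : ContinuousOn Λ (Icc a b))
    (hc : Continuous c) (ht : 0 < t) (hε₂ : 0 ≤ ε₂) (hΛa : Λ a = a)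
    (hclose : ∀ x ∈ Icc a b, |p (Λ x) - p x| ≤ ε₁) (hP : ∀ x ∈ Icc a b, |p (Λ x)| ≤ P)
    (hC : ∀ x ∈ Icc a b, |c x| ≤ C)
    (hexp : ∀ x ∈ Ico a b, ∀ᶠ z in 𝓝[>] x,
      |Λ z - Λ x - (z - x) + t * (c x * (z - x))| ≤ ε₂ * t * (z - x)) :
    ∀ v ∈ Icc a b, |(∫ x in a..v, (p (Λ x) - p x)) - (V (Λ v) - V v)
      - t * ∫ x in a..v, p x * c x| ≤ (C * ε₁ + P * ε₂) * t * (v - a) := by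
  set q : ℝ → ℝ := fun x => p (Λ x) - p x - t * (p x * c x) with hq
  have hpΛ : ContinuousOn (fun x => p (Λ x)) (Icc a b) := hp.comp_continuousOn hΛ
  have hqc : ContinuousOn q (Icc a b) :=
    (hpΛ.sub hp.continuousOn).sub (continuousOn_const.mul (hp.mul hc).continuousOn)
  have hVc : Continuous V := continuous_iff_continuousAt.2 fun x => (hV x).continuousAt
  set D : ℝ → ℝ := fun v => (∫ x in a..v, q x) - (V (Λ v) - V v) with hD
  have hDeq : ∀ v ∈ Icc a b, (∫ x in a..v, (p (Λ x) - p x)) - (V (Λ v) - V v)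
      - t * ∫ x in a..v, p x * c x = D v := by
    intro v hv
    have hsub : uIcc a v ⊆ Icc a b := by
      rw [uIcc_of_le hv.1]; exact Icc_subset_Icc_right hv.2
    simp only [hD, hq]
    have i1 : IntervalIntegrable (fun x => p (Λ x) - p x) volume a v :=
      ((hpΛ.sub hp.continuousOn).mono hsub).intervalIntegrable
    have i2 : IntervalIntegrable (fun x => t * (p x * c x)) volume a v :=
      (continuous_const.mul (hp.mul hc)).intervalIntegrable _ _
    rw [intervalIntegral.integral_sub i1 i2, intervalIntegral.integral_const_mul]
    ring
  intro v hv
  rw [hDeq v hv]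
  have hab : a ≤ b := hv.1.trans hv.2
  have hqi : IntervalIntegrable q volume a b := by
    apply ContinuousOn.intervalIntegrable
    rwa [uIcc_of_le hab]
  have hDc : ContinuousOn D (Icc a b) := by
    refine ContinuousOn.sub ?_ ((hVc.comp_continuousOn hΛ).sub hVc.continuousOn)
    have := intervalIntegral.continuousOn_primitive_interval (μ := volume) (f := q) (a := a)
      (b := b) (by rw [uIcc_of_le hab]; exact hqc.integrableOn_Icc)
    rwa [uIcc_of_le hab] at this
  set κ := (C * ε₁ + P * ε₂) * t with hκ
  -- `Λ` need not be differentiable, so a mean value inequality with right slopes is used. At `x`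
  -- the slope of `D` is about `q(x) - p(Λ x)(1 - t c(x)) + p(x) = t c(x) (p(Λ x) - p(x))`, with an
  -- error at most `P ε₂ t` from the slope of `Λ`; together at most `κ`.
  have hmain := image_le_of_liminf_slope_right_le_deriv_boundary (f := fun x => |D x|)
    (B := fun x => κ * (x - a)) (B' := fun _ => κ) (a := a) (b := b) hDc.abs
    (by simp [hD, hΛa]) (by fun_prop)
    (fun x _ => by
      simpa using (((hasDerivAt_id x).sub_const a).const_mul κ).hasDerivWithinAt)
    (fun x hx r hr => ?_) hv
  · exact hmain
  refine Eventually.frequently ?_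
  have hx' := Ico_subset_Icc_self hx
  have hC0 : 0 ≤ C := (abs_nonneg _).trans (hC x hx')
  have hεP : 0 ≤ ε₁ := (abs_nonneg _).trans (hclose x hx')
  set N := 3 + t * C + ε₂ * t with hN
  have hN0 : 0 < N := by positivity
  -- `N` totals the coefficients with which three little-o errors of relative size `η` enter, so the
  -- slope is at most `κ + η N = (κ + r) / 2 < r`.
  set η := (r - κ) / (2 * N) with hη
  have hη0 : 0 < η := div_pos (sub_pos.2 hr) (by positivity)
  have hnb : Icc a b ∈ 𝓝[>] x :=
    mem_of_superset (Ioo_mem_nhdsGT hx.2) fun z hz => ⟨hx.1.trans hz.1.le, hz.2.le⟩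
  have hI : HasDerivWithinAt (fun v => ∫ x in a..v, q x) (q x) (Ici x) x := by
    have hsub : uIcc a x ⊆ Icc a b := by
      rw [uIcc_of_le hx.1]; exact Icc_subset_Icc_right hx.2.le
    refine intervalIntegral.integral_hasDerivWithinAt_right
      ((hqc.mono hsub).intervalIntegrable) (t := Ioi x) ?_ ?_
    · exact ⟨Icc a b, hnb, hqc.aestronglyMeasurable measurableSet_Icc⟩
    · exact (hqc x hx').mono_of_mem_nhdsWithin hnb
  have e1 := (hasDerivWithinAt_iff_isLittleO.1 (hI.mono Ioi_subset_Ici_self)).def hη0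
  have e2 := (hasDerivAt_iff_isLittleO.1 (hV x)).def hη0
  have e3 := (hasDerivAt_iff_isLittleO.1 (hV (Λ x))).def hη0
  have hΛt : Tendsto Λ (𝓝[>] x) (𝓝 (Λ x)) := (hΛ x hx').mono_of_mem_nhdsWithin hnb
  filter_upwards [e1, e2.filter_mono nhdsWithin_le_nhds, hΛt.eventually e3, hexp x hx,
    self_mem_nhdsWithin] with z h1 h2 h3 h4 hz
  have hzx : 0 < z - x := sub_pos.2 hz
  simp only [smul_eq_mul, Real.norm_eq_abs] at h1 h2 h3
  rw [abs_of_pos hzx] at h1 h2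
  have hcx := abs_le.1 (hC x hx')
  have h5 : |Λ z - Λ x| ≤ (1 + t * C + ε₂ * t) * (z - x) := by
    have : Λ z - Λ x = (Λ z - Λ x - (z - x) + t * (c x * (z - x)))
      + ((z - x) - t * (c x * (z - x))) := by ring
    rw [this]
    refine (abs_add_le _ _).trans ?_
    have h6 : |(z - x) - t * (c x * (z - x))| ≤ (1 + t * C) * (z - x) := by
      have : (z - x) - t * (c x * (z - x)) = (1 - t * c x) * (z - x) := by ring
      rw [this, abs_mul, abs_of_pos hzx]
      refine mul_le_mul_of_nonneg_right (abs_le.2 ⟨?_, ?_⟩) hzx.le <;> nlinarith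
    nlinarith
  have h7 : |D z - D x| ≤ (κ + η * N) * (z - x) := by
    have hsplit : D z - D x
        = ((∫ x in a..z, q x) - (∫ x in a..x, q x) - (z - x) * q x)
          - (V (Λ z) - V (Λ x) - (Λ z - Λ x) * p (Λ x)) + (V z - V x - (z - x) * p x)
          - p (Λ x) * (Λ z - Λ x - (z - x) + t * (c x * (z - x)))
          + t * (c x * (p (Λ x) - p x)) * (z - x) := by
      simp only [hD, hq]; ring
    have h8 : |p (Λ x) * (Λ z - Λ x - (z - x) + t * (c x * (z - x)))|
        ≤ P * (ε₂ * t * (z - x)) := by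
      rw [abs_mul]
      exact mul_le_mul (hP x hx') h4 (abs_nonneg _) ((abs_nonneg _).trans (hP x hx'))
    have h9 : |t * (c x * (p (Λ x) - p x)) * (z - x)| ≤ t * (C * ε₁) * (z - x) := by
      rw [abs_mul, abs_mul, abs_mul, abs_of_pos ht, abs_of_pos hzx]
      have := mul_le_mul (hC x hx') (hclose x hx') (abs_nonneg _) hC0
      gcongr
    have h10 : η * |Λ z - Λ x| ≤ η * ((1 + t * C + ε₂ * t) * (z - x)) := by gcongr
    rw [hsplit, abs_le]
    rw [abs_le] at h1 h2 h3 h8 h9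
    have h11 : (κ + η * N) * (z - x) = η * (z - x) + η * (z - x)
        + η * ((1 + t * C + ε₂ * t) * (z - x)) + P * (ε₂ * t * (z - x))
        + t * (C * ε₁) * (z - x) := by rw [hκ, hN]; ring
    rw [h11]
    constructor <;> linarith [h1.1, h1.2, h2.1, h2.2, h3.1, h3.2, h8.1, h8.2, h9.1, h9.2]
  have h12 : κ + η * N < r := by
    have : η * N = (r - κ) / 2 := by rw [hη]; field_simp
    rw [this]; linarith
  rw [slope_def_field, div_lt_iff₀ hzx]
  have h13 : |D z| - |D x| ≤ |D z - D x| := abs_sub_abs_le_abs_sub _ _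
  nlinarith

/-! ### A two-sided Grönwall argument for zeros. -/

section Scalar

/-- A scalar function with `|m'| ≤ K |m|` which vanishes somewhere vanishes everywhere. -/
theorem eq_zero_of_abs_deriv_le {m m' : ℝ → ℝ} {K t s₀ : ℝ}
    (hm : ∀ s ∈ Icc 0 t, HasDerivWithinAt m (m' s) (Icc 0 t) s)
    (hK : ∀ s ∈ Icc 0 t, |m' s| ≤ K * |m s|) (hs₀ : s₀ ∈ Icc 0 t) (h0 : m s₀ = 0) :
    ∀ s ∈ Icc 0 t, m s = 0 := by
  have hd : ∀ c : ℝ, ∀ s ∈ Icc 0 t, HasDerivWithinAt (fun s => m s ^ 2 * Real.exp (c * s))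
      ((2 * (m s * m' s) + c * m s ^ 2) * Real.exp (c * s)) (Icc 0 t) s := by
    intro c s hs
    have h1 := ((hm s hs).pow 2).mul
      (((hasDerivAt_id s).const_mul c).exp.hasDerivWithinAt (s := Icc 0 t))
    refine (h1.congr_deriv ?_)
    simp
    ring
  have hcont : ∀ c : ℝ, ContinuousOn (fun s => m s ^ 2 * Real.exp (c * s)) (Icc 0 t) :=
    fun c s hs => (hd c s hs).continuousWithinAt
  have hd' : ∀ c : ℝ, ∀ s ∈ interior (Icc 0 t),
      HasDerivWithinAt (fun s => m s ^ 2 * Real.exp (c * s))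
      ((2 * (m s * m' s) + c * m s ^ 2) * Real.exp (c * s)) (interior (Icc 0 t)) s :=
    fun c s hs => (hd c s (interior_subset hs)).mono interior_subset
  have hb : ∀ s ∈ Icc 0 t, |m s * m' s| ≤ K * m s ^ 2 := by
    intro s hs
    rw [abs_mul, ← sq_abs]
    nlinarith [hK s hs, abs_nonneg (m s)]
  -- The increasing weight carries the zero at `s₀` to earlier times, the decreasing one to later
  -- times; squaring avoids differentiating `|m|`.
  have hmono : MonotoneOn (fun s => m s ^ 2 * Real.exp (2 * K * s)) (Icc 0 t) :=
    monotoneOn_of_hasDerivWithinAt_nonneg (convex_Icc _ _) (hcont _) (hd' _) fun s hs => by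
      have := (abs_le.1 (hb s (interior_subset hs))).1
      exact mul_nonneg (by linarith) (Real.exp_pos _).le
  have hanti : AntitoneOn (fun s => m s ^ 2 * Real.exp (-(2 * K) * s)) (Icc 0 t) :=
    antitoneOn_of_hasDerivWithinAt_nonpos (convex_Icc _ _) (hcont _) (hd' _) fun s hs => by
      have := (abs_le.1 (hb s (interior_subset hs))).2
      exact mul_nonpos_of_nonpos_of_nonneg (by linarith) (Real.exp_pos _).le
  have hfin : ∀ s c : ℝ, m s ^ 2 * Real.exp (c * s) ≤ m s₀ ^ 2 * Real.exp (c * s₀) → m s = 0 := by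
    intro s c h
    rw [h0, zero_pow two_ne_zero, zero_mul] at h
    have h1 := Real.exp_pos (c * s)
    have h2 : m s ^ 2 ≤ 0 := by
      by_contra h3
      push Not at h3
      nlinarith
    exact pow_eq_zero_iff two_ne_zero |>.1 (le_antisymm h2 (sq_nonneg _))
  intro s hs
  rcases le_total s s₀ with h | h
  · exact hfin s _ (hmono hs hs₀ h)
  · exact hfin s _ (hanti hs₀ hs h)

end Scalar

/-! ### The characteristic vector field: regularity, zero divergence, invariant planes. -/

section PhaseField

local notation "𝔼" n => EuclideanSpace ℝ (Fin n)

variable {d : ℕ}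



/-- The vector field of the characteristic system, frozen for negative times. -/
noncomputable def phaseField (f : ℝ → (𝔼 d) → ℝ → (𝔼 d)) (s : ℝ) (z : (𝔼 d) × ℝ) : (𝔼 d) × ℝ :=
  (fluxDeriv f (max s 0) z.1 z.2, -fluxDiv f (max s 0) z.1 z.2)

theorem IsCharacteristic.isIntegralCurveOn {f : ℝ → (𝔼 d) → ℝ → (𝔼 d)} {t : ℝ} {x : 𝔼 d} {lam : ℝ}
    {X : ℝ → 𝔼 d} {L : ℝ → ℝ} (h : IsCharacteristic f t x lam X L) :
    IsIntegralCurveOn (fun s => (X s, L s)) (phaseField f) (Icc 0 t) := by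
  intro s hs
  have := (h.space s hs).prodMk (h.kinetic s hs)
  simpa only [phaseField, max_eq_left hs.1] using this

theorem isCharacteristic_of_isIntegralCurveOn {f : ℝ → (𝔼 d) → ℝ → (𝔼 d)} {t : ℝ}
    {γ : ℝ → (𝔼 d) × ℝ} (h : IsIntegralCurveOn γ (phaseField f) (Icc 0 t)) :
    IsCharacteristic f t (γ t).1 (γ t).2 (fun s => (γ s).1) (fun s => (γ s).2) where
  space s hs := by
    have := (h s hs).hasFDerivWithinAt.fst.hasDerivWithinAt
    simpa [phaseField, max_eq_left hs.1] using this
  kinetic s hs := by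
    have := (h s hs).hasFDerivWithinAt.snd.hasDerivWithinAt
    simpa [phaseField, max_eq_left hs.1] using this
  space_end := rfl
  kinetic_end := rfl

/-- The half space of nonnegative times. -/
def halfSpace (Z : Type*) : Set (ℝ × Z) := {p | 0 ≤ p.1}

theorem uniqueDiffOn_halfSpace (Z : Type*) [NormedAddCommGroup Z] [NormedSpace ℝ Z] :
    UniqueDiffOn ℝ (halfSpace Z) := by
  have : halfSpace Z = Ici (0 : ℝ) ×ˢ univ := by ext p; simp [halfSpace]
  rw [this]
  exact (uniqueDiffOn_Ici 0).prod uniqueDiffOn_univ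

/-- For `s ≥ 0` the whole slice lies in the half space, so a derivative relative to the half space
restricts to an unrestricted derivative in `z`. -/
theorem hasFDerivAt_slice {Z Y : Type*} [NormedAddCommGroup Z] [NormedSpace ℝ Z]
    [NormedAddCommGroup Y] [NormedSpace ℝ Y] {h : ℝ × Z → Y}
    (hh : DifferentiableOn ℝ h (halfSpace Z)) {s : ℝ} (hs : 0 ≤ s) (z : Z) :
    HasFDerivAt (fun z => h (s, z))
      ((fderivWithin ℝ h (halfSpace Z) (s, z)).comp (ContinuousLinearMap.inr ℝ ℝ Z)) z := by
  have h1 : HasFDerivWithinAt h (fderivWithin ℝ h (halfSpace Z) (s, z)) (halfSpace Z) (s, z) :=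
    (hh (s, z) hs).hasFDerivWithinAt
  have h2 : HasFDerivWithinAt (fun z : Z => (s, z)) (ContinuousLinearMap.inr ℝ ℝ Z) univ z :=
    (hasFDerivAt_prodMk_right s z).hasFDerivWithinAt
  exact hasFDerivWithinAt_univ.1 (h1.comp z h2 fun _ _ => hs)

/-- The linear map sending the spatial derivative of the flux to the characteristic field. -/
noncomputable def phaseMap (d : ℕ) : ((𝔼 d) × ℝ →L[ℝ] (𝔼 d))
    →L[ℝ] (𝔼 d) × ℝ :=
  (ContinuousLinearMap.apply ℝ _ ((0, 1) : (𝔼 d) × ℝ)).prod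
    (-∑ j : Fin d, (EuclideanSpace.proj j).comp
      (ContinuousLinearMap.apply ℝ _ ((EuclideanSpace.single j 1, 0) :
        (𝔼 d) × ℝ)))

theorem phaseMap_apply (A : (𝔼 d) × ℝ →L[ℝ] (𝔼 d)) :
    phaseMap d A = (A (0, 1), -∑ j : Fin d, A (EuclideanSpace.single j 1, 0) j) := by
  simp [phaseMap]

/-- The field is a fixed linear image of the spatial derivative of the flux; regularity and
divergence are both read off from this. -/
theorem phaseField_eq {f : ℝ → (𝔼 d) → ℝ → (𝔼 d)} {s : ℝ} (hs : 0 ≤ s)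
    {z : (𝔼 d) × ℝ} {A : (𝔼 d) × ℝ →L[ℝ] (𝔼 d)}
    (hA : HasFDerivAt (fun z : (𝔼 d) × ℝ => f s z.1 z.2) A z) :
    phaseField f s z = phaseMap d A := by
  have h1 : HasDerivAt (fun l : ℝ => f s z.1 l) (A (0, 1)) z.2 := by
    have : HasFDerivAt (fun l : ℝ => (z.1, l)) (ContinuousLinearMap.inr ℝ (𝔼 d) ℝ) z.2 :=
      hasFDerivAt_prodMk_right z.1 z.2
    have h2 : HasFDerivAt (fun z : (𝔼 d) × ℝ => f s z.1 z.2) A (z.1, z.2) := hA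
    have h3 := (h2.comp z.2 this).hasDerivAt
    simp only [ContinuousLinearMap.comp_apply, ContinuousLinearMap.inr_apply] at h3
    exact h3
  have h2 : HasFDerivAt (fun y : 𝔼 d => f s y z.2)
      (A.comp (ContinuousLinearMap.inl ℝ (𝔼 d) ℝ)) z.1 := by
    have : HasFDerivAt (fun y : 𝔼 d => (y, z.2)) (ContinuousLinearMap.inl ℝ (𝔼 d) ℝ) z.1 :=
      hasFDerivAt_prodMk_left z.1 z.2
    have h2 : HasFDerivAt (fun z : (𝔼 d) × ℝ => f s z.1 z.2) A (z.1, z.2) := hA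
    exact h2.comp z.1 this
  rw [phaseField, max_eq_left hs, fluxDeriv, fluxDiv, h1.deriv, h2.fderiv, phaseMap_apply]
  simp

/-- The spatial derivative of the characteristic field. -/
noncomputable def phaseDeriv (f : ℝ → (𝔼 d) → ℝ → (𝔼 d)) (s : ℝ) (z : (𝔼 d) × ℝ) :
    (𝔼 d) × ℝ →L[ℝ] (𝔼 d) × ℝ :=
  fderiv ℝ (phaseField f s) z

variable {f : ℝ → (𝔼 d) → ℝ → (𝔼 d)}

/-- One derivative of a `C²` flux is lost. The flux is smooth only up to the boundary `t = 0`, hence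
derivatives relative to the half space; composing with `max s 0` preserves joint continuity, which
is all that is required in time. -/
theorem isC1Field_phaseField
    (hf : ContDiffOn ℝ 2 (fun p : ℝ × (𝔼 d) × ℝ => f p.1 p.2.1 p.2.2) {p | 0 ≤ p.1}) :
    IsC1Field (phaseField f) (phaseDeriv f) := by
  have hU := uniqueDiffOn_halfSpace ((𝔼 d) × ℝ)
  change ContDiffOn ℝ 2 (fun p : ℝ × (𝔼 d) × ℝ => f p.1 p.2.1 p.2.2) (halfSpace ((𝔼 d) × ℝ)) at hf
  set g := fun p : ℝ × (𝔼 d) × ℝ => f p.1 p.2.1 p.2.2 with hg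
  set G := fderivWithin ℝ g (halfSpace ((𝔼 d) × ℝ)) with hG
  have hG1 : ContDiffOn ℝ 1 G (halfSpace ((𝔼 d) × ℝ)) :=
    hf.fderivWithin hU (by rw [one_add_one_eq_two])
  set H : ℝ × (𝔼 d) × ℝ → (𝔼 d) × ℝ := fun p =>
    phaseMap d ((G p).comp (ContinuousLinearMap.inr ℝ ℝ ((𝔼 d) × ℝ))) with hH
  have hH1 : ContDiffOn ℝ 1 H (halfSpace ((𝔼 d) × ℝ)) :=
    (phaseMap d).contDiff.comp_contDiffOn (hG1.clm_comp contDiffOn_const)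
  have hFH : ∀ s z, phaseField f s z = H (max s 0, z) := by
    intro s z
    have h0 : (0 : ℝ) ≤ max s 0 := le_max_right _ _
    have := phaseField_eq (f := f) h0
      (hasFDerivAt_slice (h := g) (hf.differentiableOn two_ne_zero) h0 z)
    refine Eq.trans ?_ this
    rw [phaseField, phaseField, max_eq_left h0]
  have hmax : Continuous fun p : ℝ × (𝔼 d) × ℝ => (max p.1 0, p.2) := by fun_prop
  have hmaps : ∀ p : ℝ × (𝔼 d) × ℝ, (max p.1 0, p.2) ∈ halfSpace ((𝔼 d) × ℝ) :=
    fun p => le_max_right p.1 0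
  have hd : ∀ s z, HasFDerivAt (phaseField f s)
      ((fderivWithin ℝ H (halfSpace ((𝔼 d) × ℝ)) (max s 0, z)).comp
        (ContinuousLinearMap.inr ℝ ℝ ((𝔼 d) × ℝ))) z := by
    intro s z
    have : phaseField f s = fun z => H (max s 0, z) := funext (hFH s)
    rw [this]
    exact hasFDerivAt_slice (hH1.differentiableOn one_ne_zero) (le_max_right _ _) z
  refine ⟨?_, fun s z => (hd s z).differentiableAt.hasFDerivAt, ?_⟩
  · simp only [hFH]
    exact hH1.continuousOn.comp_continuous hmax hmaps
  · have : (fun p : ℝ × (𝔼 d) × ℝ => phaseDeriv f p.1 p.2) = fun p =>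
        (fderivWithin ℝ H (halfSpace ((𝔼 d) × ℝ)) (max p.1 0, p.2)).comp
        (ContinuousLinearMap.inr ℝ ℝ ((𝔼 d) × ℝ)) := funext fun p => (hd p.1 p.2).fderiv
    rw [this]
    exact ((hH1.continuousOn_fderivWithin hU le_rfl).comp_continuous hmax hmaps).clm_comp
      continuous_const

theorem trace_prod (T : (𝔼 d) × ℝ →ₗ[ℝ] (𝔼 d) × ℝ) : LinearMap.trace ℝ ((𝔼 d) × ℝ) T
    = ∑ j : Fin d, (T (EuclideanSpace.single j 1, 0)).1 j + (T (0, 1)).2 := by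
  classical
  let b := ((EuclideanSpace.basisFun (Fin d) ℝ).toBasis).prod (Module.Basis.singleton Unit ℝ)
  rw [LinearMap.trace_eq_matrix_trace ℝ b, Matrix.trace, Fintype.sum_sum_type]
  simp [b, LinearMap.toMatrix_apply, Matrix.diag]

/-- The characteristic field is divergence free. -/
theorem trace_phaseDeriv
    (hf : ContDiffOn ℝ 2 (fun p : ℝ × (𝔼 d) × ℝ => f p.1 p.2.1 p.2.2) {p | 0 ≤ p.1}) {s : ℝ}
    (hs : 0 ≤ s) (z : (𝔼 d) × ℝ) : LinearMap.trace ℝ ((𝔼 d) × ℝ) (phaseDeriv f s z) = 0 := by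
  set g := fun z : (𝔼 d) × ℝ => f s z.1 z.2 with hg
  have hg2 : ContDiff ℝ 2 g := by
    have h1 : ContDiff ℝ 2 fun z : (𝔼 d) × ℝ => (s, z) := contDiff_prodMk_right s
    exact hf.comp_contDiff h1 fun _ => hs
  have hF : phaseField f s = fun z => phaseMap d (fderiv ℝ g z) := funext fun z =>
    phaseField_eq hs (hg2.differentiable two_ne_zero z).hasFDerivAt
  have hg1 : ContDiff ℝ 1 (fderiv ℝ g) := hg2.fderiv_right (by rw [one_add_one_eq_two])
  have hF' : phaseDeriv f s z = (phaseMap d).comp (fderiv ℝ (fderiv ℝ g) z) := by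
    rw [phaseDeriv, hF]
    exact ((phaseMap d).hasFDerivAt.comp z
      (hg1.differentiable one_ne_zero z).hasFDerivAt).fderiv
  -- The divergence is `∑ ∂_j ∂_λ f_j - ∂_λ ∑ ∂_j f_j`, which cancels by symmetry.
  have hsymm : ∀ v w, fderiv ℝ (fderiv ℝ g) z v w = fderiv ℝ (fderiv ℝ g) z w v :=
    (hg2.contDiffAt (x := z)).isSymmSndFDerivAt (by simp)
  rw [trace_prod, hF']
  simp only [ContinuousLinearMap.coe_coe, ContinuousLinearMap.comp_apply, phaseMap_apply]
  rw [← sub_eq_add_neg, sub_eq_zero]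
  exact Finset.sum_congr rfl fun j _ => by rw [hsymm]

theorem phaseField_snd_eq_zero {c : ℝ} (hc : ∀ t : ℝ, 0 ≤ t → ∀ x : 𝔼 d, f t x c = 0) (s : ℝ)
    (x : 𝔼 d) : (phaseField f s (x, c)).2 = 0 := by
  have : (fun y : 𝔼 d => f (max s 0) y c) = fun _ => 0 := funext fun y => hc _ (le_max_right _ _) y
  simp [phaseField, fluxDiv, this]

/-- Hyperplanes on which the flux vanishes are invariant under the characteristic flow. -/
theorem snd_eq_of_isIntegralCurveOn {F' : ℝ → (𝔼 d) × ℝ → (𝔼 d) × ℝ →L[ℝ] (𝔼 d) × ℝ}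
    (hF : IsC1Field (phaseField f) F') {c : ℝ} (hc : ∀ t : ℝ, 0 ≤ t → ∀ x : 𝔼 d, f t x c = 0)
    {t : ℝ} {γ : ℝ → (𝔼 d) × ℝ} (hγ : IsIntegralCurveOn γ (phaseField f) (Icc 0 t)) {s₀ : ℝ}
    (hs₀ : s₀ ∈ Icc 0 t) (h0 : (γ s₀).2 = c) : ∀ s ∈ Icc 0 t, (γ s).2 = c := by
  -- Comparing the field at `γ s` with its value at the projection onto the plane, where the
  -- vertical component vanishes, gives `|m'| ≤ K |m|` for `m = (γ s).2 - c`.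
  have hcont : ContinuousOn (fun s => ((γ s).1, c)) (Icc 0 t) :=
    (continuous_fst.comp_continuousOn hγ.continuousOn).prodMk continuousOn_const
  obtain ⟨r, hr⟩ := (((isCompact_Icc.image_of_continuousOn hγ.continuousOn).union
    (isCompact_Icc.image_of_continuousOn hcont)).isBounded).subset_closedBall 0
  obtain ⟨K, hK⟩ := hF.exists_lipschitzOnWith (isCompact_closedBall (0 : (𝔼 d) × ℝ) r)
    (convex_closedBall _ _) t
  have hm : ∀ s ∈ Icc 0 t, HasDerivWithinAt (fun s => (γ s).2 - c)
      (phaseField f s (γ s)).2 (Icc 0 t) s := fun s hs => by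
    have := (hγ s hs).hasFDerivWithinAt.snd.hasDerivWithinAt
    simpa using this.sub_const c
  have hz := eq_zero_of_abs_deriv_le (K := K) hm (fun s hs => ?_) hs₀ (by simp [h0])
  · exact fun s hs => sub_eq_zero.1 (hz s hs)
  · have h1 := (hK s hs).norm_sub_le (hr (Or.inl (mem_image_of_mem γ hs)))
      (hr (Or.inr (mem_image_of_mem (fun s => ((γ s).1, c)) hs)))
    have h2 := (norm_snd_le _).trans h1
    rw [Prod.snd_sub, phaseField_snd_eq_zero hc, sub_zero] at h2
    refine h2.trans (mul_le_mul_of_nonneg_left ?_ K.2)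
    rw [Prod.norm_def]
    simp

/-- A curve getting to the other side would meet the invariant plane and so lie in it at all times.
-/
theorem lt_snd_of_isIntegralCurveOn {F' : ℝ → (𝔼 d) × ℝ → (𝔼 d) × ℝ →L[ℝ] (𝔼 d) × ℝ}
    (hF : IsC1Field (phaseField f) F') {c : ℝ} (hc : ∀ t : ℝ, 0 ≤ t → ∀ x : 𝔼 d, f t x c = 0)
    {t : ℝ} {γ : ℝ → (𝔼 d) × ℝ} (hγ : IsIntegralCurveOn γ (phaseField f) (Icc 0 t)) {s₀ : ℝ}
    (hs₀ : s₀ ∈ Icc 0 t) (h0 : c < (γ s₀).2) : ∀ s ∈ Icc 0 t, c < (γ s).2 := by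
  intro s hs
  by_contra hlt
  have hcont : ContinuousOn (fun s => (γ s).2) (Icc 0 t) :=
    continuous_snd.comp_continuousOn hγ.continuousOn
  obtain ⟨s₁, hs₁, h1⟩ := isPreconnected_Icc.intermediate_value hs hs₀ hcont
    ⟨not_lt.1 hlt, h0.le⟩
  exact h0.ne' (snd_eq_of_isIntegralCurveOn hF hc hγ hs₁ h1 s₀ hs₀)

theorem snd_lt_of_isIntegralCurveOn {F' : ℝ → (𝔼 d) × ℝ → (𝔼 d) × ℝ →L[ℝ] (𝔼 d) × ℝ}
    (hF : IsC1Field (phaseField f) F') {c : ℝ} (hc : ∀ t : ℝ, 0 ≤ t → ∀ x : 𝔼 d, f t x c = 0)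
    {t : ℝ} {γ : ℝ → (𝔼 d) × ℝ} (hγ : IsIntegralCurveOn γ (phaseField f) (Icc 0 t)) {s₀ : ℝ}
    (hs₀ : s₀ ∈ Icc 0 t) (h0 : (γ s₀).2 < c) : ∀ s ∈ Icc 0 t, (γ s).2 < c := by
  intro s hs
  by_contra hlt
  have hcont : ContinuousOn (fun s => (γ s).2) (Icc 0 t) :=
    continuous_snd.comp_continuousOn hγ.continuousOn
  obtain ⟨s₁, hs₁, h1⟩ := isPreconnected_Icc.intermediate_value hs₀ hs hcont
    ⟨h0.le, not_lt.1 hlt⟩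
  exact h0.ne (snd_eq_of_isIntegralCurveOn hF hc hγ hs₁ h1 s₀ hs₀)

end PhaseField

/-! ### The foot map: independence of choices and null sets. -/

section Foot

local notation "𝔼" n => EuclideanSpace ℝ (Fin n)

variable {d : ℕ}



variable {f : ℝ → (𝔼 d) → ℝ → (𝔼 d)} {F' : ℝ → (𝔼 d) × ℝ → (𝔼 d) × ℝ →L[ℝ] (𝔼 d) × ℝ} {t : ℝ}

/-- Backward uniqueness makes the choice in `foot` irrelevant. -/
theorem foot_eq_of_isIntegralCurveOn (hF : IsC1Field (phaseField f) F') (ht : 0 ≤ t)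
    {γ : ℝ → (𝔼 d) × ℝ} (hγ : IsIntegralCurveOn γ (phaseField f) (Icc 0 t)) :
    foot f t (γ t).1 (γ t).2 = γ 0 := by
  have h : ∃ p : (ℝ → 𝔼 d) × (ℝ → ℝ), IsCharacteristic f t (γ t).1 (γ t).2 p.1 p.2 :=
    ⟨(_, _), isCharacteristic_of_isIntegralCurveOn hγ⟩
  rw [foot, dif_pos h]
  exact hF.eqOn_of_eq_right h.choose_spec.isIntegralCurveOn hγ
    (Prod.ext h.choose_spec.space_end h.choose_spec.kinetic_end) ⟨le_rfl, ht⟩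

/-- Points without a characteristic have themselves as foot. This convention also respects the
planes `λ = a`, `λ = b` and null sets, so blow-up outside compact sets does no harm. -/
theorem foot_cases (hF : IsC1Field (phaseField f) F') (ht : 0 ≤ t) (z : (𝔼 d) × ℝ) :
    foot f t z.1 z.2 = z ∨ ∃ γ : ℝ → (𝔼 d) × ℝ, IsIntegralCurveOn γ (phaseField f) (Icc 0 t) ∧
      γ t = z ∧ foot f t z.1 z.2 = γ 0 := by
  by_cases h : ∃ p : (ℝ → 𝔼 d) × (ℝ → ℝ), IsCharacteristic f t z.1 z.2 p.1 p.2
  · obtain ⟨⟨X, L⟩, hp⟩ := h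
    have hz : (X t, L t) = z := Prod.ext hp.space_end hp.kinetic_end
    refine Or.inr ⟨_, hp.isIntegralCurveOn, hz, ?_⟩
    have := foot_eq_of_isIntegralCurveOn hF ht hp.isIntegralCurveOn
    change foot f t (X t, L t).1 (X t, L t).2 = _ at this
    rwa [hz] at this
  · left
    rw [foot, dif_neg h]

theorem lt_foot_snd (hF : IsC1Field (phaseField f) F') (ht : 0 ≤ t) {c : ℝ}
    (hc : ∀ t : ℝ, 0 ≤ t → ∀ x : 𝔼 d, f t x c = 0) {x : 𝔼 d} {lam : ℝ} (h : c < lam) :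
    c < (foot f t x lam).2 := by
  rcases foot_cases hF ht (x, lam) with h1 | ⟨γ, hγ, h2, h1⟩ <;> dsimp only at h1 <;> rw [h1]
  · exact h
  · exact lt_snd_of_isIntegralCurveOn hF hc hγ ⟨ht, le_rfl⟩ (by rw [h2]; exact h) 0 ⟨le_rfl, ht⟩

theorem foot_snd_lt (hF : IsC1Field (phaseField f) F') (ht : 0 ≤ t) {c : ℝ}
    (hc : ∀ t : ℝ, 0 ≤ t → ∀ x : 𝔼 d, f t x c = 0) {x : 𝔼 d} {lam : ℝ} (h : lam < c) :
    (foot f t x lam).2 < c := by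
  rcases foot_cases hF ht (x, lam) with h1 | ⟨γ, hγ, h2, h1⟩ <;> dsimp only at h1 <;> rw [h1]
  · exact h
  · exact snd_lt_of_isIntegralCurveOn hF hc hγ ⟨ht, le_rfl⟩ (by rw [h2]; exact h) 0 ⟨le_rfl, ht⟩

instance isAddHaarMeasure_volume_prod : (volume : Measure ((𝔼 d) × ℝ)).IsAddHaarMeasure :=
  inferInstanceAs ((volume : Measure (𝔼 d)).prod (volume : Measure ℝ)).IsAddHaarMeasure

/-- Preimages of null sets under the foot map are null. -/
theorem measure_preimage_foot_eq_zero (hF : IsC1Field (phaseField f) F') (ht : 0 ≤ t)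
    {N : Set ((𝔼 d) × ℝ)} (hN : volume N = 0) :
    volume ((fun z : (𝔼 d) × ℝ => foot f t z.1 z.2) ⁻¹' N) = 0 := by
  set A := fun z : (𝔼 d) × ℝ => foot f t z.1 z.2 with hA
  -- The field is only locally Lipschitz, so characteristics are sorted by a ball containing them;
  -- on each `S n` the foot map has a Lipschitz inverse.
  let S : ℕ → Set ((𝔼 d) × ℝ) := fun n => {z | ∃ γ : ℝ → (𝔼 d) × ℝ,
    IsIntegralCurveOn γ (phaseField f) (Icc 0 t) ∧ γ t = z ∧
    ∀ s ∈ Icc 0 t, γ s ∈ Metric.closedBall (0 : (𝔼 d) × ℝ) n}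
  have hcov : A ⁻¹' N ⊆ N ∪ ⋃ n, S n ∩ A ⁻¹' N := by
    intro z hz
    rcases foot_cases hF ht z with h | ⟨γ, hγ, h1, -⟩
    · left
      have : A z ∈ N := hz
      rwa [hA, show (fun z : (𝔼 d) × ℝ => foot f t z.1 z.2) z = z from h] at this
    · right
      obtain ⟨r, hr⟩ := (isCompact_Icc.image_of_continuousOn
        hγ.continuousOn).isBounded.subset_closedBall 0
      obtain ⟨n, hn⟩ := exists_nat_ge r
      exact mem_iUnion.2 ⟨n, ⟨γ, hγ, h1, fun s hs =>
        Metric.closedBall_subset_closedBall hn (hr (mem_image_of_mem γ hs))⟩, hz⟩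
  refine measure_mono_null hcov (measure_union_null hN (measure_iUnion_null fun n => ?_))
  obtain ⟨K, hK⟩ := hF.exists_lipschitzOnWith (isCompact_closedBall (0 : (𝔼 d) × ℝ) n)
    (convex_closedBall _ _) t
  refine measure_inter_preimage_eq_zero_of_dist_le volume (C := Real.exp (K * t)) ?_ hN
  rintro x ⟨γ, hγ, rfl, hγD⟩ y ⟨η, hη, rfl, hηD⟩
  have := dist_le_of_integralCurves hK hγ hη hγD hηD ⟨ht, le_rfl⟩
  rw [hA]
  simp only [foot_eq_of_isIntegralCurveOn hF ht hγ, foot_eq_of_isIntegralCurveOn hF ht hη]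
  rwa [mul_comm]

end Foot

/-! ### Uniformity: a single remainder for a whole family, and uniform Taylor expansion. -/

section Uniform

/-- A family of functions which is uniformly at most `o(t)` is dominated by a single `o(t)`. -/
theorem exists_isLittleO_of_forall_exists {ι : Type*} {G : ι → ℝ → ℝ}
    (h : ∀ ε > 0, ∃ δ > 0, ∀ t ∈ Ioo 0 δ, ∀ i, G i t ≤ ε * t) :
    ∃ r : ℝ → ℝ, (r =o[𝓝[>] (0 : ℝ)] fun t : ℝ => t) ∧
      ∃ δ : ℝ, 0 < δ ∧ ∀ t ∈ Ioo 0 δ, ∀ i, G i t ≤ r t := by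
  -- For small `t` the supremum is bounded by `t`; for other `t` its value is irrelevant. The
  -- positive part makes it nonnegative, even for an empty family.
  refine ⟨fun t => ⨆ i, max (G i t) 0, ?_, ?_⟩
  · refine isLittleO_iff.2 fun ε hε => ?_
    obtain ⟨δ, hδ, h1⟩ := h ε hε
    filter_upwards [Ioo_mem_nhdsGT hδ] with t ht
    have h2 : 0 ≤ ε * t := mul_nonneg hε.le ht.1.le
    rw [Real.norm_eq_abs, Real.norm_eq_abs, abs_of_pos ht.1,
      abs_of_nonneg (Real.iSup_nonneg fun i => le_max_right _ _)]
    exact Real.iSup_le (fun i => max_le (h1 t ht i) h2) h2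
  · obtain ⟨δ, hδ, h1⟩ := h 1 one_pos
    refine ⟨δ, hδ, fun t ht i => (le_max_left _ 0).trans ?_⟩
    refine le_ciSup (f := fun i => max (G i t) 0) ⟨1 * t, ?_⟩ i
    rintro _ ⟨j, rfl⟩
    exact max_le (h1 t ht j) (by have := ht.1; positivity)

/-- Uniform first-order expansion of a `C¹` function on a compact convex set. -/
theorem exists_abs_sub_sub_le {Y : Type*} [NormedAddCommGroup Y] [NormedSpace ℝ Y] {g : Y → ℝ}
    {g' : Y → Y →L[ℝ] ℝ} (hg : ∀ y, HasFDerivAt g (g' y) y) (hg' : Continuous g') {C : Set Y}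
    (hC : IsCompact C) (hCc : Convex ℝ C) {ε : ℝ} (hε : 0 < ε) :
    ∃ ρ > 0, ∀ x ∈ C, ∀ y ∈ C, ‖y - x‖ < ρ → |g y - g x - g' x (y - x)| ≤ ε * ‖y - x‖ := by
  obtain ⟨ρ, hρ, h⟩ := Metric.uniformContinuousOn_iff.1
    (hC.uniformContinuousOn_of_continuous hg'.continuousOn) ε hε
  refine ⟨ρ, hρ, fun x hx y hy hxy => ?_⟩
  have hr : ‖y - x‖ < ρ := hxy
  refine (hCc.inter (convex_ball x ρ)).norm_image_sub_le_of_norm_hasFDerivWithin_le' (f := g)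
    (f' := g') (φ := g' x) (fun z _ => (hg z).hasFDerivWithinAt) (fun z hz => ?_)
    ⟨hx, Metric.mem_ball_self hρ⟩ ⟨hy, by rwa [Metric.mem_ball, dist_eq_norm]⟩
  rw [← dist_eq_norm]
  exact (h z hz.1 x hx hz.2).le

end Uniform

/-! ### Kinetic form of the operator and densities of the flux and source terms. -/

section Space

local notation "𝔼" n => EuclideanSpace ℝ (Fin n)

variable {d : ℕ} {a b : ℝ}

theorem integrableOn_comp_of_continuous {q : (𝔼 d) × ℝ → ℝ} (hq : Continuous q)
    {S K : Set (𝔼 d)} (hS : MeasurableSet S) (hK : IsCompact K) (hSK : S ⊆ K)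
    {v : (𝔼 d) → ℝ} (hv : Measurable v) (hvab : ∀ y, v y ∈ Icc a b) :
    IntegrableOn (fun y => q (y, v y)) S := by
  obtain ⟨C, hC⟩ := (hK.prod (isCompact_Icc (a := a) (b := b))).exists_bound_of_continuousOn
    hq.continuousOn
  have hfin : volume S < ⊤ := (measure_mono hSK).trans_lt hK.measure_lt_top
  have : IsFiniteMeasure (volume.restrict S) := ⟨by simpa using hfin⟩
  refine Integrable.of_bound
    (hq.measurable.comp (measurable_id.prodMk hv)).aestronglyMeasurable C ?_
  exact (ae_restrict_iff' hS).2 (ae_of_all _ fun y hy => hC (y, v y) ⟨hSK hy, hvab y⟩)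

/-- Expansion in time of time integrals, uniformly in the bounded function `v`. -/
theorem exists_abs_integral_sub_le {q : ℝ → (𝔼 d) × ℝ → ℝ}
    (hq : Continuous fun p : ℝ × (𝔼 d) × ℝ => q p.1 p.2) {S K : Set (𝔼 d)}
    (hS : MeasurableSet S) (hK : IsCompact K) (hSK : S ⊆ K) {ε : ℝ} (hε : 0 < ε) :
    ∃ δ > 0, ∀ t ∈ Ioo 0 δ, ∀ v : (𝔼 d) → ℝ, Measurable v → (∀ y, v y ∈ Icc a b) →
      |(∫ s in (0 : ℝ)..t, ∫ y in S, q s (y, v y)) - t * ∫ y in S, q 0 (y, v y)| ≤ ε * t := by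
  have hcomp : IsCompact (Icc (0 : ℝ) 1 ×ˢ (K ×ˢ Icc a b)) :=
    isCompact_Icc.prod (hK.prod isCompact_Icc)
  obtain ⟨C, hC⟩ := hcomp.exists_bound_of_continuousOn hq.continuousOn
  have hfin : volume S < ⊤ := (measure_mono hSK).trans_lt hK.measure_lt_top
  have : IsFiniteMeasure (volume.restrict S) := ⟨by simpa using hfin⟩
  set m := volume.real S with hm
  have hm0 : 0 ≤ m := measureReal_nonneg
  obtain ⟨ρ, hρ, h⟩ := Metric.uniformContinuousOn_iff.1
    (hcomp.uniformContinuousOn_of_continuous hq.continuousOn) (ε / (m + 1)) (by positivity)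
  refine ⟨min 1 ρ, by positivity, fun t ht v hv hvab => ?_⟩
  have ht1 : t < 1 := ht.2.trans_le (min_le_left _ _)
  have htρ : t < ρ := ht.2.trans_le (min_le_right _ _)
  have hqs : ∀ s, Continuous (q s) := fun s =>
    hq.comp (by fun_prop : Continuous fun z : (𝔼 d) × ℝ => (s, z))
  have hint : ∀ s, IntegrableOn (fun y => q s (y, v y)) S := fun s =>
    integrableOn_comp_of_continuous (hqs s) hS hK hSK hv hvab
  have hcont : ContinuousOn (fun s => ∫ y in S, q s (y, v y)) (Icc 0 1) := by
    refine continuousOn_of_dominated (bound := fun _ => C)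
      (fun s _ => (hint s).aestronglyMeasurable) (fun s hs => ?_) (integrable_const _) ?_
    · exact (ae_restrict_iff' hS).2
        (ae_of_all _ fun y hy => hC (s, y, v y) ⟨hs, hSK hy, hvab y⟩)
    · exact ae_of_all _ fun y =>
        (hq.comp (by fun_prop : Continuous fun s : ℝ => (s, y, v y))).continuousOn
  have hii : IntervalIntegrable (fun s => ∫ y in S, q s (y, v y)) volume 0 t := by
    apply ContinuousOn.intervalIntegrable
    rw [uIcc_of_le ht.1.le]
    exact hcont.mono (Icc_subset_Icc_right ht1.le)
  have hconst : t * ∫ y in S, q 0 (y, v y) = ∫ s in (0 : ℝ)..t, ∫ y in S, q 0 (y, v y) := by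
    simp
  rw [hconst, ← intervalIntegral.integral_sub hii (by simp)]
  have hb : ∀ s ∈ uIoc 0 t,
      ‖(∫ y in S, q s (y, v y)) - ∫ y in S, q 0 (y, v y)‖ ≤ ε := by
    intro s hs
    rw [uIoc_of_le ht.1.le] at hs
    rw [← integral_sub (hint s) (hint 0)]
    refine (norm_setIntegral_le_of_norm_le_const (C := ε / (m + 1)) hfin fun y hy => ?_).trans ?_
    · rw [← dist_eq_norm]
      refine (h (s, y, v y) ⟨⟨hs.1.le, hs.2.trans ht1.le⟩, hSK hy, hvab y⟩ (0, y, v y)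
        ⟨⟨le_rfl, zero_le_one⟩, hSK hy, hvab y⟩ ?_).le
      rw [Prod.dist_eq, dist_self, Real.dist_eq, sub_zero, abs_of_pos hs.1]
      exact max_lt (hs.2.trans_lt htρ) hρ
    · rw [div_mul_eq_mul_div, div_le_iff₀ (by positivity)]
      nlinarith
  have := intervalIntegral.norm_integral_le_of_norm_le_const hb
  rwa [sub_zero, abs_of_pos ht.1] at this

/-- The kinetic function between `a` and `b` is the indicator of a subgraph. -/
theorem chi_sub_sub {l v : ℝ} (hl : l ∈ Ioo a b) :
    chi (l - a) (v - a) = if l ≤ v then 1 else 0 := by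
  have h1 : 0 ≤ l - a := by linarith [hl.1]
  by_cases h : l ≤ v
  · rw [chi, if_pos ⟨h1, by linarith⟩, if_pos h]
  · rw [chi, if_neg (fun h' => h (by linarith [h'.2])), if_neg h,
      if_neg (fun h' => by linarith [h'.2, hl.1])]

theorem chi_sub_sub_eq_zero {l v : ℝ} (hv : v ∈ Icc a b) (hl : l < a ∨ b < l) :
    chi (l - a) (v - a) = 0 := by
  rw [chi, if_neg, if_neg]
  · rintro ⟨h1, h2⟩; rcases hl with h | h <;> linarith [hv.1, hv.2]
  · rintro ⟨h1, h2⟩; rcases hl with h | h <;> linarith [hv.1, hv.2]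

variable {f : ℝ → (𝔼 d) → ℝ → (𝔼 d)} {F' : ℝ → (𝔼 d) × ℝ → (𝔼 d) × ℝ →L[ℝ] (𝔼 d) × ℝ} {t : ℝ}

/-- The subgraph of `v` transported by the characteristic flow, as a function. -/
noncomputable def transportedIndicator (f : ℝ → (𝔼 d) → ℝ → (𝔼 d)) (t : ℝ) (v : (𝔼 d) → ℝ)
    (z : (𝔼 d) × ℝ) : ℝ :=
  if (foot f t z.1 z.2).2 ≤ v (foot f t z.1 z.2).1 then 1 else 0

/-- The set `{u ≠ v} × ℝ` is null, and so is its preimage under the foot map; this permits replacing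
`u` by `v`. For `λ` outside `[a, b]` the foot stays outside and the kinetic function vanishes; the
values `a` and `b` form a null set. -/
theorem transportCollapse_ae_eq (hF : IsC1Field (phaseField f) F') (ht : 0 ≤ t)
    (hfa : ∀ t : ℝ, 0 ≤ t → ∀ x : 𝔼 d, f t x a = 0)
    (hfb : ∀ t : ℝ, 0 ≤ t → ∀ x : 𝔼 d, f t x b = 0) {u v : (𝔼 d) → ℝ} (huv : u =ᵐ[volume] v)
    (hv : ∀ y, v y ∈ Icc a b) :
    ∀ᵐ x, transportCollapse f a t u x
      = a + ∫ lam in Ioo a b, transportedIndicator f t v (x, lam) := by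
  have hN : volume ({y | u y ≠ v y} ×ˢ (univ : Set ℝ)) = 0 := by
    rw [Measure.volume_eq_prod, Measure.prod_prod, ae_iff.1 huv, zero_mul]
  have h0 := measure_preimage_foot_eq_zero hF ht hN
  have h1 : ∀ᵐ z : (𝔼 d) × ℝ ∂(volume : Measure (𝔼 d)).prod volume,
      u (foot f t z.1 z.2).1 = v (foot f t z.1 z.2).1 := by
    rw [ae_iff]
    refine measure_mono_null (fun z hz => ?_) h0
    exact ⟨hz, mem_univ _⟩
  filter_upwards [Measure.ae_ae_of_ae_prod h1] with x hx
  rw [transportCollapse, ← integral_indicator measurableSet_Ioo]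
  congr 1
  refine integral_congr_ae ?_
  have hne : ∀ c : ℝ, ∀ᵐ lam : ℝ, lam ≠ c := fun c => compl_mem_ae_iff.2 (measure_singleton c)
  filter_upwards [hx, hne a, hne b] with lam h2 h3 h3'
  rw [h2]
  by_cases hlam : lam ∈ Ioo a b
  · rw [indicator_of_mem hlam, chi_sub_sub
      ⟨lt_foot_snd hF ht hfa hlam.1, foot_snd_lt hF ht hfb hlam.2⟩, transportedIndicator]
  · rw [indicator_of_notMem hlam]
    refine chi_sub_sub_eq_zero (hv _) ?_
    rcases lt_or_ge a lam with h4 | h4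
    · rcases lt_or_ge lam b with h5 | h5
      · exact absurd ⟨h4, h5⟩ hlam
      · exact Or.inr (lt_foot_snd hF ht hfb (lt_of_le_of_ne h5 h3'.symm))
    · exact Or.inl (foot_snd_lt hF ht hfa (lt_of_le_of_ne h4 h3))

/-- The density of the entropy flux term. -/
noncomputable def fluxTerm (f : ℝ → (𝔼 d) → ℝ → (𝔼 d)) (V : ℝ → ℝ) (φ : (𝔼 d) → ℝ) (a s : ℝ)
    (z : (𝔼 d) × ℝ) : ℝ :=
  ∫ l in a..z.2, deriv V l * fderiv ℝ φ z.1 (phaseField f s (z.1, l)).1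

/-- The density of the entropy source term, after integration by parts. -/
noncomputable def sourceTerm (f : ℝ → (𝔼 d) → ℝ → (𝔼 d)) (V : ℝ → ℝ) (φ : (𝔼 d) → ℝ) (a s : ℝ)
    (z : (𝔼 d) × ℝ) : ℝ :=
  φ z.1 * (deriv V z.2 * (phaseField f s z).2
    - ∫ l in a..z.2, deriv V l * (phaseDeriv f s (z.1, l) (0, 1)).2)

variable {V : ℝ → ℝ} {φ : (𝔼 d) → ℝ}

theorem continuous_fluxTerm (hF : IsC1Field (phaseField f) (phaseDeriv f))
    (hp : Continuous (deriv V)) (hφ : ContDiff ℝ ∞ φ) :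
    Continuous fun p : ℝ × (𝔼 d) × ℝ => fluxTerm f V φ a p.1 p.2 := by
  have hφ' : Continuous (fderiv ℝ φ) := hφ.continuous_fderiv (by simp)
  refine intervalIntegral.continuous_parametric_intervalIntegral_of_continuous
    (f := fun (p : ℝ × (𝔼 d) × ℝ) l => deriv V l * fderiv ℝ φ p.2.1 (phaseField f p.1 (p.2.1, l)).1)
    ?_ (continuous_snd.comp continuous_snd)
  have h1 : Continuous fun q : (ℝ × (𝔼 d) × ℝ) × ℝ => phaseField f q.1.1 (q.1.2.1, q.2) :=
    hF.cont.comp (by fun_prop : Continuous fun q : (ℝ × (𝔼 d) × ℝ) × ℝ => (q.1.1, (q.1.2.1, q.2)))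
  have h2 : Continuous fun q : (ℝ × (𝔼 d) × ℝ) × ℝ => fderiv ℝ φ q.1.2.1 :=
    hφ'.comp (by fun_prop)
  exact (hp.comp continuous_snd).mul (h2.clm_apply (continuous_fst.comp h1))

theorem continuous_sourceTerm (hF : IsC1Field (phaseField f) (phaseDeriv f))
    (hp : Continuous (deriv V)) (hφ : ContDiff ℝ ∞ φ) :
    Continuous fun p : ℝ × (𝔼 d) × ℝ => sourceTerm f V φ a p.1 p.2 := by
  have h1 : Continuous fun q : (ℝ × (𝔼 d) × ℝ) × ℝ => phaseDeriv f q.1.1 (q.1.2.1, q.2) :=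
    hF.cont'.comp (by fun_prop : Continuous fun q : (ℝ × (𝔼 d) × ℝ) × ℝ => (q.1.1, (q.1.2.1, q.2)))
  have h2 := intervalIntegral.continuous_parametric_intervalIntegral_of_continuous (a₀ := a)
    (μ := volume)
    (f := fun (p : ℝ × (𝔼 d) × ℝ) l => deriv V l * (phaseDeriv f p.1 (p.2.1, l) (0, 1)).2)
    ((hp.comp continuous_snd).mul (continuous_snd.comp (h1.clm_apply continuous_const)))
    (continuous_snd.comp continuous_snd)
  have h3 : Continuous fun p : ℝ × (𝔼 d) × ℝ => (phaseField f p.1 p.2).2 :=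
    continuous_snd.comp hF.cont
  exact (hφ.continuous.comp (by fun_prop)).mul
    (((hp.comp (by fun_prop)).mul h3).sub h2)

theorem inner_entropyFlux_gradient (hF : IsC1Field (phaseField f) (phaseDeriv f))
    (hp : Continuous (deriv V)) {s : ℝ} (hs : 0 ≤ s) (x : 𝔼 d) (v : ℝ) :
    inner ℝ (entropyFlux f V a s x v) (gradient φ x) = fluxTerm f V φ a s (x, v) := by
  have h1 : ∀ y, inner ℝ y (gradient φ x) = fderiv ℝ φ x y := by
    intro y
    rw [real_inner_comm, ← toDual_gradient, InnerProductSpace.toDual_apply_apply]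
  have h2 : ∀ l, fluxDeriv f s x l = (phaseField f s (x, l)).1 := fun l => by
    rw [phaseField, max_eq_left hs]
  have h3 : Continuous fun l : ℝ => (phaseField f s (x, l)).1 :=
    continuous_fst.comp (hF.cont.comp (by fun_prop : Continuous fun l : ℝ => (s, (x, l))))
  rw [h1, entropyFlux, fluxTerm]
  simp only [h2]
  have h4 : IntervalIntegrable (fun l => deriv V l • (phaseField f s (x, l)).1) volume a v :=
    (hp.smul h3).intervalIntegrable _ _
  rw [← ContinuousLinearMap.intervalIntegral_comp_comm (fderiv ℝ φ x) h4]
  simp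

/-- Integration by parts against `V''`; there is no boundary term at `a`, since `f = 0` on that
plane forces `div_x f = 0` there. -/
theorem setIntegral_fluxDiv_mul (hF : IsC1Field (phaseField f) (phaseDeriv f))
    (hfa : ∀ t : ℝ, 0 ≤ t → ∀ x : 𝔼 d, f t x a = 0) (hV : ConvexOn ℝ univ V)
    (hVd : Differentiable ℝ V) {s : ℝ} (hs : 0 ≤ s) (x : 𝔼 d) {v : ℝ} (hv : a ≤ v) :
    (∫ lam in Ioc a v, fluxDiv f s x lam ∂(secondDeriv V hV)) * φ x
      = -sourceTerm f V φ a s (x, v) := by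
  have h2 : ∀ l, fluxDiv f s x l = -(phaseField f s (x, l)).2 := fun l => by
    rw [phaseField, max_eq_left hs, neg_neg]
  have h3 : ∀ l, HasDerivAt (fun l : ℝ => (phaseField f s (x, l)).2)
      (phaseDeriv f s (x, l) (0, 1)).2 l := by
    intro l
    have h4 := ((hF.hasFDerivAt s (x, l)).comp l (hasFDerivAt_prodMk_right x l)).hasDerivAt
    have h5 := h4.hasFDerivAt.snd.hasDerivAt
    simpa using h5
  have h6 : Continuous fun l : ℝ => (phaseDeriv f s (x, l) (0, 1)).2 :=
    continuous_snd.comp ((hF.cont'.comp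
      (by fun_prop : Continuous fun l : ℝ => (s, (x, l)))).clm_apply continuous_const)
  simp only [h2]
  rw [integral_neg, setIntegral_secondDeriv_eq hV hVd hv h3 h6 (phaseField_snd_eq_zero hfa s x),
    sourceTerm]
  ring

end Space

/-! ### The characteristic flow on boxes. -/

section Flow

local notation "𝔼" n => EuclideanSpace ℝ (Fin n)

/-- The compact box in which the relevant characteristics stay. -/
def largeBox (d : ℕ) (R a b : ℝ) : Set ((𝔼 d) × ℝ) :=
  Metric.closedBall 0 (R + 2) ×ˢ Icc (a - 1) (b + 1)

/-- Used with radius `R + 1` for starting points; the extra unit on each side of `largeBox` allows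
for a displacement of one. -/
def closedBox (d : ℕ) (R a b : ℝ) : Set ((𝔼 d) × ℝ) := Metric.closedBall 0 R ×ˢ Icc a b

def openBox (d : ℕ) (R a b : ℝ) : Set ((𝔼 d) × ℝ) := Metric.ball 0 R ×ˢ Ioo a b

variable {d : ℕ} {R a b : ℝ}

theorem isCompact_largeBox : IsCompact (largeBox d R a b) :=
  (isCompact_closedBall _ _).prod isCompact_Icc

theorem convex_largeBox : Convex ℝ (largeBox d R a b) :=
  (convex_closedBall _ _).prod (convex_Icc _ _)

theorem isOpen_openBox : IsOpen (openBox d R a b) := Metric.isOpen_ball.prod isOpen_Ioo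

theorem openBox_subset_closedBox : openBox d R a b ⊆ closedBox d R a b :=
  prod_mono Metric.ball_subset_closedBall Ioo_subset_Icc_self

theorem volume_openBox_ne_top : volume (openBox d R a b) ≠ ⊤ :=
  ((measure_mono openBox_subset_closedBox).trans_lt
    ((isCompact_closedBall (0 : 𝔼 d) R).prod (isCompact_Icc (a := a) (b := b))).measure_lt_top).ne

theorem closedBall_subset_largeBox {z : (𝔼 d) × ℝ} (hz : z ∈ closedBox d (R + 1) a b) :
    Metric.closedBall z 1 ⊆ largeBox d R a b := by
  intro w hw
  rw [Metric.mem_closedBall, Prod.dist_eq, max_le_iff] at hw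
  obtain ⟨h1, h2⟩ := hz
  rw [Metric.mem_closedBall] at h1
  rw [Real.dist_eq, abs_le] at hw
  refine ⟨?_, ?_, ?_⟩
  · rw [Metric.mem_closedBall]
    linarith [dist_triangle w.1 z.1 0, hw.1]
  · linarith [h2.1, hw.2.1]
  · linarith [h2.2, hw.2.2]

theorem closedBox_subset_largeBox : closedBox d (R + 1) a b ⊆ largeBox d R a b := fun _ hz =>
  closedBall_subset_largeBox hz (Metric.mem_closedBall_self zero_le_one)

/-- The characteristic flow on `[0, t]`, starting from the points of a box. -/
structure IsFlowOn (f : ℝ → (𝔼 d) → ℝ → (𝔼 d)) (R a b t : ℝ)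
    (Γ : (𝔼 d) × ℝ → ℝ → (𝔼 d) × ℝ) : Prop where
  start : ∀ w ∈ closedBox d (R + 1) a b, Γ w 0 = w
  curve : ∀ w ∈ closedBox d (R + 1) a b, IsIntegralCurveOn (Γ w) (phaseField f) (Icc 0 t)
  mem : ∀ w ∈ closedBox d (R + 1) a b, ∀ s ∈ Icc 0 t, Γ w s ∈ largeBox d R a b

variable {f : ℝ → (𝔼 d) → ℝ → (𝔼 d)} {F' : ℝ → (𝔼 d) × ℝ → (𝔼 d) × ℝ →L[ℝ] (𝔼 d) × ℝ}

theorem exists_isFlowOn (hF : IsC1Field (phaseField f) F') (R a b : ℝ) :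
    ∃ δ > 0, ∀ t ∈ Ioo 0 δ, ∃ Γ, IsFlowOn f R a b t Γ := by
  obtain ⟨δ, hδ, h⟩ := hF.exists_integralCurve (isCompact_largeBox (d := d) (R := R) (a := a)
    (b := b))
  refine ⟨δ, hδ, fun t ht => ?_⟩
  have h1 : ∀ w, ∃ γ : ℝ → (𝔼 d) × ℝ, w ∈ closedBox d (R + 1) a b → γ 0 = w ∧
      IsIntegralCurveOn γ (phaseField f) (Icc 0 t) ∧ ∀ s, γ s ∈ Metric.closedBall w 1 := by
    intro w
    by_cases hw : w ∈ closedBox d (R + 1) a b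
    · obtain ⟨γ, hγ⟩ := h t ht w (closedBall_subset_largeBox hw) 0 ⟨le_rfl, ht.1.le⟩
      exact ⟨γ, fun _ => hγ⟩
    · exact ⟨fun _ => w, fun h => absurd h hw⟩
  choose Γ hΓ using h1
  exact ⟨Γ, fun w hw => (hΓ w hw).1, fun w hw => (hΓ w hw).2.1,
    fun w hw s _ => closedBall_subset_largeBox hw ((hΓ w hw).2.2 s)⟩

/-- For small times, characteristics ending in a box start from a slightly larger box. -/
theorem exists_backward_curve (hF : IsC1Field (phaseField f) F')
    (hfa : ∀ t : ℝ, 0 ≤ t → ∀ x : 𝔼 d, f t x a = 0)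
    (hfb : ∀ t : ℝ, 0 ≤ t → ∀ x : 𝔼 d, f t x b = 0) (R : ℝ) :
    ∃ δ > 0, ∀ t ∈ Ioo 0 δ, ∀ z ∈ openBox d R a b, ∃ γ : ℝ → (𝔼 d) × ℝ, γ t = z ∧
      IsIntegralCurveOn γ (phaseField f) (Icc 0 t) ∧ γ 0 ∈ openBox d (R + 1) a b ∧
      ∀ s, γ s ∈ largeBox d R a b := by
  obtain ⟨δ, hδ, h⟩ := hF.exists_integralCurve (isCompact_largeBox (d := d) (R := R) (a := a)
    (b := b))
  refine ⟨δ, hδ, fun t ht z hz => ?_⟩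
  have hz' : z ∈ closedBox d (R + 1) a b := by
    have := openBox_subset_closedBox hz
    exact ⟨Metric.closedBall_subset_closedBall (by linarith) this.1, this.2⟩
  obtain ⟨γ, hγt, hγ, hγ1⟩ := h t ht z (closedBall_subset_largeBox hz') t ⟨ht.1.le, le_rfl⟩
  refine ⟨γ, hγt, hγ, ⟨?_, ?_, ?_⟩, fun s => closedBall_subset_largeBox hz' (hγ1 s)⟩
  · have h1 := hγ1 0
    rw [Metric.mem_closedBall, Prod.dist_eq, max_le_iff] at h1
    have h2 := hz.1
    rw [Metric.mem_ball] at h2 ⊢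
    linarith [dist_triangle (γ 0).1 z.1 0, h1.1]
  · exact lt_snd_of_isIntegralCurveOn hF hfa hγ ⟨ht.1.le, le_rfl⟩ (by rw [hγt]; exact hz.2.1) 0
      ⟨le_rfl, ht.1.le⟩
  · exact snd_lt_of_isIntegralCurveOn hF hfb hγ ⟨ht.1.le, le_rfl⟩ (by rw [hγt]; exact hz.2.2) 0
      ⟨le_rfl, ht.1.le⟩

namespace IsFlowOn

variable {t : ℝ} {Γ : (𝔼 d) × ℝ → ℝ → (𝔼 d) × ℝ}

theorem foot_eq (h : IsFlowOn f R a b t Γ) (hF : IsC1Field (phaseField f) F') (ht : 0 ≤ t)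
    {w : (𝔼 d) × ℝ} (hw : w ∈ closedBox d (R + 1) a b) :
    foot f t (Γ w t).1 (Γ w t).2 = w := by
  rw [foot_eq_of_isIntegralCurveOn hF ht (h.curve w hw), h.start w hw]

theorem injOn (h : IsFlowOn f R a b t Γ) (hF : IsC1Field (phaseField f) F') (ht : 0 ≤ t) :
    InjOn (fun w => Γ w t) (closedBox d (R + 1) a b) := by
  intro w hw w' hw' heq
  have heq' : Γ w t = Γ w' t := heq
  rw [← h.foot_eq hF ht hw, heq', h.foot_eq hF ht hw']

theorem exists_lipschitzOnWith (h : IsFlowOn f R a b t Γ) (hF : IsC1Field (phaseField f) F')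
    (ht : 0 ≤ t) : ∃ K, LipschitzOnWith K (fun w => Γ w t) (closedBox d (R + 1) a b) := by
  obtain ⟨K, hK⟩ := hF.exists_lipschitzOnWith (isCompact_largeBox (d := d) (R := R) (a := a)
    (b := b)) convex_largeBox t
  refine ⟨⟨Real.exp (K * t), (Real.exp_pos _).le⟩, LipschitzOnWith.of_dist_le_mul ?_⟩
  intro w hw w' hw'
  have := dist_le_of_integralCurves hK (h.curve w hw) (h.curve w' hw') (h.mem w hw) (h.mem w' hw')
    ⟨ht, le_rfl⟩
  rw [h.start w hw, h.start w' hw', mul_comm] at this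
  exact this

theorem snd_mem_Icc (h : IsFlowOn f R a b t Γ) (hF : IsC1Field (phaseField f) F') (ht : 0 ≤ t)
    (hfa : ∀ t : ℝ, 0 ≤ t → ∀ x : 𝔼 d, f t x a = 0)
    (hfb : ∀ t : ℝ, 0 ≤ t → ∀ x : 𝔼 d, f t x b = 0) {w : (𝔼 d) × ℝ}
    (hw : w ∈ closedBox d (R + 1) a b) : (Γ w t).2 ∈ Icc a b := by
  have h0 : (0 : ℝ) ∈ Icc 0 t := ⟨le_rfl, ht⟩
  have h1 : t ∈ Icc 0 t := ⟨ht, le_rfl⟩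
  have hs := h.start w hw
  constructor
  · by_contra hlt
    have := snd_lt_of_isIntegralCurveOn hF hfa (h.curve w hw) h1 (not_le.1 hlt) 0 h0
    rw [hs] at this
    exact absurd hw.2.1 (not_le.2 this)
  · by_contra hlt
    have := lt_snd_of_isIntegralCurveOn hF hfb (h.curve w hw) h1 (not_le.1 hlt) 0 h0
    rw [hs] at this
    exact absurd hw.2.2 (not_le.2 this)

theorem snd_mem_Ioo (h : IsFlowOn f R a b t Γ) (hF : IsC1Field (phaseField f) F') (ht : 0 ≤ t)
    (hfa : ∀ t : ℝ, 0 ≤ t → ∀ x : 𝔼 d, f t x a = 0)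
    (hfb : ∀ t : ℝ, 0 ≤ t → ∀ x : 𝔼 d, f t x b = 0) {w : (𝔼 d) × ℝ}
    (hw : w ∈ openBox d (R + 1) a b) : (Γ w t).2 ∈ Ioo a b := by
  have h0 : (0 : ℝ) ∈ Icc 0 t := ⟨le_rfl, ht⟩
  have h1 : t ∈ Icc 0 t := ⟨ht, le_rfl⟩
  have hw' := openBox_subset_closedBox hw
  have hs := h.start w hw'
  exact ⟨lt_snd_of_isIntegralCurveOn hF hfa (h.curve w hw') h0 (by rw [hs]; exact hw.2.1) t h1,
    snd_lt_of_isIntegralCurveOn hF hfb (h.curve w hw') h0 (by rw [hs]; exact hw.2.2) t h1⟩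

/-- The characteristic ending at a given point starts in the larger box, and forward uniqueness
identifies it with the flow curve of its foot. -/
theorem openBox_subset_image {δ : ℝ} (h : IsFlowOn f R a b t Γ) (hF : IsC1Field (phaseField f) F')
    (ht : t ∈ Ioo 0 δ)
    (hback : ∀ t ∈ Ioo 0 δ, ∀ z ∈ openBox d R a b, ∃ γ : ℝ → (𝔼 d) × ℝ, γ t = z ∧
      IsIntegralCurveOn γ (phaseField f) (Icc 0 t) ∧ γ 0 ∈ openBox d (R + 1) a b ∧
      ∀ s, γ s ∈ largeBox d R a b) :
    openBox d R a b ⊆ (fun w => Γ w t) '' openBox d (R + 1) a b := by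
  intro z hz
  obtain ⟨γ, h1, h2, h3, -⟩ := hback t ht z hz
  have h4 := openBox_subset_closedBox h3
  refine ⟨γ 0, h3, ?_⟩
  have := hF.eqOn_of_eq_left (h.curve _ h4) h2 (h.start _ h4) ⟨ht.1.le, le_rfl⟩
  exact this.trans h1

end IsFlowOn

/-- The characteristic flow preserves volume up to `o(t)`. -/
theorem exists_integral_image_flow_sub_le
    (hf : ContDiffOn ℝ 2 (fun p : ℝ × (𝔼 d) × ℝ => f p.1 p.2.1 p.2.2) {p | 0 ≤ p.1})
    (R a b : ℝ) {ε : ℝ} (hε : 0 < ε) :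
    ∃ δ > 0, ∀ t ∈ Ioo 0 δ, ∀ Γ, IsFlowOn f R a b t Γ → ∀ (k : (𝔼 d) × ℝ → ℝ) (B : ℝ), 0 ≤ B →
      (∀ w ∈ openBox d (R + 1) a b, |k (Γ w t)| ≤ B) →
      AEStronglyMeasurable (fun w => k (Γ w t)) (volume.restrict (openBox d (R + 1) a b)) →
      |(∫ z in (fun w => Γ w t) '' openBox d (R + 1) a b, k z)
        - ∫ w in openBox d (R + 1) a b, k (Γ w t)| ≤ ε * t * B := by
  have hF := isC1Field_phaseField hf
  obtain ⟨C, hC0, hC⟩ := hF.exists_bound' (isCompact_largeBox (d := d) (R := R) (a := a)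
    (b := b)) 1
  set m := volume.real (openBox d (R + 1) a b) with hm
  have hm0 : 0 ≤ m := measureReal_nonneg
  obtain ⟨δ₁, hδ₁, h1⟩ := exists_integral_image_sub_le (volume : Measure ((𝔼 d) × ℝ)) (C := C)
    (ε := ε / (m + 1)) (by positivity)
  -- The tolerance `δ₁` demanded by the change of variables is the accuracy requested from the
  -- expansion of the flow.
  obtain ⟨δ₂, hδ₂, ρ, hρ, h2⟩ := hF.expansion_one (isCompact_largeBox (d := d) (R := R) (a := a)
    (b := b)) convex_largeBox hδ₁
  refine ⟨min δ₁ δ₂, by positivity, fun t ht Γ hΓ k B hB hk hkm => ?_⟩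
  have ht1 : t ∈ Ioo 0 δ₁ := ⟨ht.1, ht.2.trans_le (min_le_left _ _)⟩
  have ht2 : t ∈ Ioo 0 δ₂ := ⟨ht.1, ht.2.trans_le (min_le_right _ _)⟩
  obtain ⟨K, hK⟩ := hΓ.exists_lipschitzOnWith hF ht.1.le
  refine (h1 t ht1 _ (fun w => Γ w t) K (phaseDeriv f 0) isOpen_openBox volume_openBox_ne_top
    (hK.mono openBox_subset_closedBox) ((hΓ.injOn hF ht.1.le).mono openBox_subset_closedBox)
    (fun z hz => ⟨trace_phaseDeriv hf le_rfl z, hC 0 ⟨le_rfl, zero_le_one⟩ z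
      (closedBox_subset_largeBox (openBox_subset_closedBox hz)), ?_⟩) k B hk hkm).trans ?_
  · filter_upwards [isOpen_openBox.mem_nhds hz, Metric.ball_mem_nhds z hρ] with z' hz' hz'ρ
    have hw := openBox_subset_closedBox hz
    have hw' := openBox_subset_closedBox hz'
    have := h2 t ht2 (Γ z) (Γ z') (hΓ.curve z hw) (hΓ.curve z' hw') (hΓ.mem z hw) (hΓ.mem z' hw')
    rw [hΓ.start z hw, hΓ.start z' hw'] at this
    exact this (by rwa [Metric.mem_ball, dist_eq_norm] at hz'ρ)
  · have := ht.1
    calc ε / (m + 1) * t * B * m = ε * t * B * (m / (m + 1)) := by ring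
      _ ≤ ε * t * B * 1 := by
          gcongr
          rw [div_le_one (by positivity)]
          linarith
      _ = ε * t * B := mul_one _

end Flow

/-! ### Expansion of `V' φ` along the flow, on vertical segments. -/

section Expansion

local notation "𝔼" n => EuclideanSpace ℝ (Fin n)

variable {d : ℕ} {R a b : ℝ} {f : ℝ → (𝔼 d) → ℝ → (𝔼 d)} {V : ℝ → ℝ} {φ : (𝔼 d) → ℝ}

set_option maxHeartbeats 1600000 in
/-- First-order expansion, along the characteristic flow, of integrals over vertical segments. -/
theorem exists_abs_integral_flow_sub_le
    (hf : ContDiffOn ℝ 2 (fun p : ℝ × (𝔼 d) × ℝ => f p.1 p.2.1 p.2.2) {p | 0 ≤ p.1})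
    (hab : a < b) (hfa : ∀ t : ℝ, 0 ≤ t → ∀ x : 𝔼 d, f t x a = 0)
    (hfb : ∀ t : ℝ, 0 ≤ t → ∀ x : 𝔼 d, f t x b = 0)
    (hV : ConvexOn ℝ univ V) (hVd : Differentiable ℝ V) (hφ : ContDiff ℝ ∞ φ) (R : ℝ)
    {ε : ℝ} (hε : 0 < ε) :
    ∃ δ > 0, ∀ t ∈ Ioo 0 δ, ∀ Γ, IsFlowOn f R a b t Γ →
      ∀ y ∈ Metric.closedBall (0 : 𝔼 d) (R + 1), ∀ v ∈ Icc a b,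
        |(∫ l in a..v, (deriv V (Γ (y, l) t).2 * φ (Γ (y, l) t).1 - deriv V l * φ y))
          - t * (fluxTerm f V φ a 0 (y, v) + sourceTerm f V φ a 0 (y, v))| ≤ ε * t := by
  have hF := isC1Field_phaseField hf
  set D := largeBox d R a b with hD
  have hDc : IsCompact D := isCompact_largeBox
  set p := deriv V with hp
  have hpc : Continuous p := continuous_deriv hV hVd
  have hφ' : Continuous (fderiv ℝ φ) := hφ.continuous_fderiv (by simp)
  have hφd : ∀ y, HasFDerivAt φ (fderiv ℝ φ y) y := fun y =>
    (hφ.differentiable (by simp) y).hasFDerivAt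
  have hball : IsCompact (Metric.closedBall (0 : 𝔼 d) (R + 2)) := isCompact_closedBall _ _
  obtain ⟨M, hM0, hM⟩ := hF.exists_bound hDc 1
  obtain ⟨C, hC0, hC⟩ := hF.exists_bound' hDc 1
  obtain ⟨P, hP⟩ := (isCompact_Icc (a := a) (b := b)).exists_bound_of_continuousOn
    hpc.continuousOn
  obtain ⟨B, hB⟩ := hball.exists_bound_of_continuousOn hφ.continuous.continuousOn
  obtain ⟨G, hG⟩ := hball.exists_bound_of_continuousOn hφ'.continuousOn
  have hP0 : 0 ≤ P := (norm_nonneg _).trans (hP a ⟨le_rfl, hab.le⟩)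
  by_cases hR : 0 ≤ R + 1
  swap
  -- For `R + 1 < 0` there is no base point; excluding this case makes the bounds `B` and `G`
  -- nonnegative.
  · refine ⟨1, one_pos, fun t _ Γ _ y hy => absurd hy ?_⟩
    rw [Metric.closedBall_eq_empty.2 (not_le.1 hR)]
    exact fun h => h
  have h0mem : (0 : 𝔼 d) ∈ Metric.closedBall (0 : 𝔼 d) (R + 2) :=
    Metric.mem_closedBall_self (by linarith)
  have hB0 : 0 ≤ B := (norm_nonneg _).trans (hB 0 h0mem)
  have hG0 : 0 ≤ G := (norm_nonneg _).trans (hG 0 h0mem)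
  have hba : 0 ≤ b - a := by linarith
  -- `e N t` is exactly the sum of all errors below once every elementary expansion has accuracy
  -- `e`.
  set N := (b - a) * (P * M + P * G + G * M) + B * ((C + P) * (b - a) + M + P) with hN
  have hN0 : 0 ≤ N := by positivity
  set e := ε / (N + 1) with he
  have he0 : 0 < e := by positivity
  obtain ⟨δ₀, hδ₀, h0⟩ := hF.expansion_zero hDc he0
  obtain ⟨δ₁, hδ₁, ρ₁, hρ₁, h1⟩ := hF.expansion_one hDc convex_largeBox he0
  obtain ⟨ρ₂, hρ₂, h2⟩ := exists_abs_sub_sub_le hφd hφ' hball (convex_closedBall _ _) he0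
  have hVf : ∀ x, HasFDerivAt V (ContinuousLinearMap.toSpanSingleton ℝ (p x)) x := fun x =>
    (hVd x).hasDerivAt.hasFDerivAt
  obtain ⟨ρ₃, hρ₃, h3⟩ := exists_abs_sub_sub_le hVf
    ((ContinuousLinearMap.toSpanSingletonCLE (𝕜 := ℝ) (E := ℝ)).continuous.comp hpc)
    (isCompact_Icc (a := a) (b := b)) (convex_Icc _ _) he0
  obtain ⟨ρ₄, hρ₄, h4⟩ := Metric.uniformContinuousOn_iff.1
    ((isCompact_Icc (a := a) (b := b)).uniformContinuousOn_of_continuous hpc.continuousOn) e he0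
  set ρ := min ρ₂ (min ρ₃ ρ₄) with hρ
  have hρ0 : 0 < ρ := by positivity
  refine ⟨min (min 1 (ρ / M)) (min δ₀ δ₁), by positivity, fun t ht Γ hΓ y hy v hv => ?_⟩
  have ht0 := ht.1
  have ht1 : t < 1 := ht.2.trans_le ((min_le_left _ _).trans (min_le_left _ _))
  have htM : M * t < ρ := by
    have := ht.2.trans_le ((min_le_left _ _).trans (min_le_right _ _))
    rw [lt_div_iff₀ hM0] at this
    linarith
  have htδ₀ : t ∈ Ioo 0 δ₀ := ⟨ht.1, ht.2.trans_le ((min_le_right _ _).trans (min_le_left _ _))⟩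
  have htδ₁ : t ∈ Ioo 0 δ₁ := ⟨ht.1, ht.2.trans_le ((min_le_right _ _).trans (min_le_right _ _))⟩
  have htt : t ∈ Icc 0 t := ⟨ht.1.le, le_rfl⟩
  have hw : ∀ l ∈ Icc a b, (y, l) ∈ closedBox d (R + 1) a b := fun l hl => ⟨hy, hl⟩
  have hy2 : y ∈ Metric.closedBall (0 : 𝔼 d) (R + 2) :=
    Metric.closedBall_subset_closedBall (by linarith) hy
  set X : ℝ → 𝔼 d := fun l => (Γ (y, l) t).1 with hX
  set Λ : ℝ → ℝ := fun l => (Γ (y, l) t).2 with hΛ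
  have hΛmem : ∀ l ∈ Icc a b, Λ l ∈ Icc a b := fun l hl =>
    hΓ.snd_mem_Icc hF ht.1.le hfa hfb (hw l hl)
  have hXmem : ∀ l ∈ Icc a b, X l ∈ Metric.closedBall (0 : 𝔼 d) (R + 2) := fun l hl =>
    (hΓ.mem _ (hw l hl) t htt).1
  have hdisp : ∀ l ∈ Icc a b, ‖Γ (y, l) t - (y, l)‖ ≤ M * t := by
    intro l hl
    have := IsC1Field.norm_sub_le_of_integralCurve
      (fun s hs => hM s ⟨hs.1, hs.2.trans ht1.le⟩) (hΓ.curve _ (hw l hl)) (hΓ.mem _ (hw l hl)) htt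
    rwa [hΓ.start _ (hw l hl)] at this
  have hXd : ∀ l ∈ Icc a b, ‖X l - y‖ ≤ M * t := fun l hl =>
    (norm_fst_le (Γ (y, l) t - (y, l))).trans (hdisp l hl)
  have hΛd : ∀ l ∈ Icc a b, |Λ l - l| ≤ M * t := fun l hl =>
    (norm_snd_le (Γ (y, l) t - (y, l))).trans (hdisp l hl)
  have hexp0 : ∀ l ∈ Icc a b, ‖Γ (y, l) t - (y, l) - t • phaseField f 0 (y, l)‖ ≤ e * t := by
    intro l hl
    have := h0 t htδ₀ _ (hΓ.curve _ (hw l hl)) (hΓ.mem _ (hw l hl))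
    rwa [hΓ.start _ (hw l hl)] at this
  have hΓc : ContinuousOn (fun l => Γ (y, l) t) (Icc a b) := by
    obtain ⟨K, hK⟩ := hΓ.exists_lipschitzOnWith hF ht.1.le
    exact hK.continuousOn.comp (by fun_prop : Continuous fun l : ℝ => (y, l)).continuousOn hw
  have hXc : ContinuousOn X (Icc a b) := continuous_fst.comp_continuousOn hΓc
  have hΛc : ContinuousOn Λ (Icc a b) := continuous_snd.comp_continuousOn hΓc
  have hpΛ : ∀ l ∈ Icc a b, |p (Λ l) - p l| ≤ e := by
    intro l hl
    rw [← Real.dist_eq]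
    refine (h4 _ (hΛmem l hl) l hl ?_).le
    rw [Real.dist_eq]
    exact (hΛd l hl).trans_lt (htM.trans_le ((min_le_right _ _).trans (min_le_right _ _)))
  have hmemD : ∀ l ∈ Icc a b, (y, l) ∈ D := fun l hl => closedBox_subset_largeBox (hw l hl)
  have hFM : ∀ l ∈ Icc a b, ‖phaseField f 0 (y, l)‖ ≤ M := fun l hl =>
    hM 0 ⟨le_rfl, zero_le_one⟩ _ (hmemD l hl)
  have hFc : Continuous fun l : ℝ => phaseField f 0 (y, l) :=
    hF.cont.comp (by fun_prop : Continuous fun l : ℝ => ((0 : ℝ), (y, l)))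
  have hsub : Icc a v ⊆ Icc a b := Icc_subset_Icc_right hv.2
  have hsub' : uIcc a v ⊆ Icc a b := by rwa [uIcc_of_le hv.1]
  have hflux : |(∫ l in a..v, p (Λ l) * (φ (X l) - φ y)) - t * fluxTerm f V φ a 0 (y, v)|
      ≤ (P * (e * M + G * e) + e * (G * M)) * t * (b - a) := by
    have i1 : IntervalIntegrable (fun l => p (Λ l) * (φ (X l) - φ y)) volume a v :=
      (((hpc.comp_continuousOn hΛc).mul ((hφ.continuous.comp_continuousOn hXc).sub
        continuousOn_const)).mono hsub').intervalIntegrable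
    have i2 : IntervalIntegrable (fun l => t * (p l * fderiv ℝ φ y (phaseField f 0 (y, l)).1))
        volume a v := by
      refine Continuous.intervalIntegrable ?_ _ _
      exact continuous_const.mul (hpc.mul ((fderiv ℝ φ y).continuous.comp
        (continuous_fst.comp hFc)))
    rw [fluxTerm, ← intervalIntegral.integral_const_mul, ← intervalIntegral.integral_sub i1 i2]
    have hbound : ∀ l ∈ uIoc a v, ‖p (Λ l) * (φ (X l) - φ y)
        - t * (p l * fderiv ℝ φ y (phaseField f 0 (y, l)).1)‖
        ≤ (P * (e * M + G * e) + e * (G * M)) * t := by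
      intro l hl
      rw [uIoc_of_le hv.1] at hl
      have hl' : l ∈ Icc a b := hsub (Ioc_subset_Icc_self hl)
      have e1 : |φ (X l) - φ y - fderiv ℝ φ y (X l - y)| ≤ e * (M * t) :=
        (h2 y hy2 (X l) (hXmem l hl') ((hXd l hl').trans_lt (htM.trans_le (min_le_left _ _)))).trans
          (mul_le_mul_of_nonneg_left (hXd l hl') he0.le)
      have e2 : |fderiv ℝ φ y (X l - y - t • (phaseField f 0 (y, l)).1)| ≤ G * (e * t) :=
        ((fderiv ℝ φ y).le_opNorm _).trans (mul_le_mul (hG y hy2)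
          ((norm_fst_le (Γ (y, l) t - (y, l) - t • phaseField f 0 (y, l))).trans (hexp0 l hl'))
          (norm_nonneg _) hG0)
      have e3 : |fderiv ℝ φ y (phaseField f 0 (y, l)).1| ≤ G * M :=
        ((fderiv ℝ φ y).le_opNorm _).trans (mul_le_mul (hG y hy2)
          ((norm_fst_le _).trans (hFM l hl')) (norm_nonneg _) hG0)
      have hsplit : p (Λ l) * (φ (X l) - φ y)
          - t * (p l * fderiv ℝ φ y (phaseField f 0 (y, l)).1)
          = p (Λ l) * ((φ (X l) - φ y - fderiv ℝ φ y (X l - y))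
            + fderiv ℝ φ y (X l - y - t • (phaseField f 0 (y, l)).1))
            + t * ((p (Λ l) - p l) * fderiv ℝ φ y (phaseField f 0 (y, l)).1) := by
        rw [map_sub (fderiv ℝ φ y) (X l - y), map_smul, smul_eq_mul]
        ring
      rw [hsplit]
      refine (norm_add_le _ _).trans ?_
      rw [norm_mul, norm_mul, norm_mul, Real.norm_eq_abs t, abs_of_pos ht0]
      have e4 := (norm_add_le (φ (X l) - φ y - fderiv ℝ φ y (X l - y))
        (fderiv ℝ φ y (X l - y - t • (phaseField f 0 (y, l)).1))).trans (add_le_add e1 e2)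
      have e5 := mul_le_mul (hP _ (hΛmem l hl')) e4 (norm_nonneg _) hP0
      have e6 := mul_le_mul (hpΛ l hl') e3 (abs_nonneg _) he0.le
      have e7 := mul_le_mul_of_nonneg_left e6 ht0.le
      simp only [Real.norm_eq_abs] at e5 ⊢
      linarith
    refine (intervalIntegral.norm_integral_le_of_norm_le_const hbound).trans ?_
    rw [abs_of_nonneg (by linarith [hv.1])]
    have : v - a ≤ b - a := by linarith [hv.2]
    gcongr
  -- No derivative of `V'` is used: `abs_integral_comp_sub_le` with `c = ∂_λ div_x f` reduces the
  -- claim to `V (Λ v) - V v`, which is expanded through `V'(v)` and the vertical velocity.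
  have hsource : |(∫ l in a..v, (p (Λ l) - p l)) - t * (p v * (phaseField f 0 (y, v)).2
      - ∫ l in a..v, p l * (phaseDeriv f 0 (y, l) (0, 1)).2)|
      ≤ ((C * e + P * e) * (b - a) + (e * M + P * e)) * t := by
    have hΛa : Λ a = a := by
      have ha : a ∈ Icc a b := ⟨le_rfl, hab.le⟩
      exact snd_eq_of_isIntegralCurveOn hF hfa (hΓ.curve _ (hw a ha)) (s₀ := 0)
        ⟨le_rfl, ht.1.le⟩ (by rw [hΓ.start _ (hw a ha)]) t htt
    have hcc : Continuous fun l : ℝ => -(phaseDeriv f 0 (y, l) (0, 1)).2 :=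
      (continuous_snd.comp ((hF.cont'.comp
        (by fun_prop : Continuous fun l : ℝ => ((0 : ℝ), (y, l)))).clm_apply
        continuous_const)).neg
    have hk := abs_integral_comp_sub_le (V := V) (p := p) (Λ := Λ)
      (c := fun l : ℝ => -(phaseDeriv f 0 (y, l) (0, 1)).2) (C := C) (P := P) (ε₁ := e) (ε₂ := e)
      (fun x => (hVd x).hasDerivAt) hpc hΛc hcc ht0 he0.le hΛa hpΛ
      (fun l hl => hP _ (hΛmem l hl)) (fun l hl => ?_) (fun l hl => ?_) v hv
    · have e1 : |V (Λ v) - V v - p v * (Λ v - v)| ≤ e * (M * t) := by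
        have := h3 v hv (Λ v) (hΛmem v hv) ((hΛd v hv).trans_lt
          (htM.trans_le ((min_le_right _ _).trans (min_le_left _ _))))
        rw [ContinuousLinearMap.toSpanSingleton_apply, smul_eq_mul, mul_comm (Λ v - v)] at this
        exact this.trans (mul_le_mul_of_nonneg_left (hΛd v hv) he0.le)
      have e2 : |p v * (Λ v - v - t * (phaseField f 0 (y, v)).2)| ≤ P * (e * t) := by
        rw [abs_mul]
        exact mul_le_mul (hP v hv)
          ((norm_snd_le (Γ (y, v) t - (y, v) - t • phaseField f 0 (y, v))).trans (hexp0 v hv))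
          (abs_nonneg _) hP0
      have hneg : ∫ l in a..v, p l * -(phaseDeriv f 0 (y, l) (0, 1)).2
          = -∫ l in a..v, p l * (phaseDeriv f 0 (y, l) (0, 1)).2 := by
        rw [← intervalIntegral.integral_neg]
        simp
      rw [hneg] at hk
      have hk' : (C * e + P * e) * t * (v - a) ≤ (C * e + P * e) * t * (b - a) := by
        have : v - a ≤ b - a := by linarith [hv.2]
        gcongr
      rw [abs_le] at hk e1 e2 ⊢
      constructor <;> nlinarith [hk.1, hk.2, e1.1, e1.2, e2.1, e2.2]
    · rw [abs_neg]
      refine (norm_snd_le (phaseDeriv f 0 (y, l) (0, 1))).trans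
        ((ContinuousLinearMap.le_opNorm _ _).trans ?_)
      have : ‖((0 : 𝔼 d), (1 : ℝ))‖ = 1 := by simp [Prod.norm_def]
      rw [this, mul_one]
      exact hC 0 ⟨le_rfl, zero_le_one⟩ _ (hmemD l hl)
    -- The right slopes of `Λ` come from the expansion of the difference of two characteristics
    -- starting on the same vertical line.
    · have hl' := Ico_subset_Icc_self hl
      have hlt : l < min b (l + ρ₁) := lt_min hl.2 (by linarith)
      filter_upwards [Ioo_mem_nhdsGT hlt] with z hz
      have hz' : z ∈ Icc a b := ⟨hl.1.trans hz.1.le, hz.2.le.trans (min_le_left _ _)⟩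
      have hzl : 0 < z - l := sub_pos.2 hz.1
      have hnorm : ‖((y, z) : (𝔼 d) × ℝ) - (y, l)‖ = z - l := by
        rw [Prod.norm_def]
        simp [abs_of_pos hzl, hzl.le]
      have := h1 t htδ₁ _ _ (hΓ.curve _ (hw l hl')) (hΓ.curve _ (hw z hz'))
        (hΓ.mem _ (hw l hl')) (hΓ.mem _ (hw z hz'))
      rw [hΓ.start _ (hw l hl'), hΓ.start _ (hw z hz'), hnorm] at this
      have h5 := (norm_snd_le _).trans (this (by
        have := hz.2.trans_le (min_le_right _ _)
        linarith))
      have h6 : ((y, z) : (𝔼 d) × ℝ) - (y, l) = (z - l) • ((0 : 𝔼 d), (1 : ℝ)) := by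
        simp
      rw [h6, map_smul] at h5
      refine (le_of_eq ?_).trans h5
      rw [Real.norm_eq_abs]
      congr 1
      simp only [Prod.snd_sub, Prod.smul_snd, smul_eq_mul, hΛ]
      ring
  have hsplit : (∫ l in a..v, (deriv V (Γ (y, l) t).2 * φ (Γ (y, l) t).1 - deriv V l * φ y))
      = (∫ l in a..v, p (Λ l) * (φ (X l) - φ y)) + φ y * ∫ l in a..v, (p (Λ l) - p l) := by
    have i1 : IntervalIntegrable (fun l => p (Λ l) * (φ (X l) - φ y)) volume a v :=
      (((hpc.comp_continuousOn hΛc).mul ((hφ.continuous.comp_continuousOn hXc).sub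
        continuousOn_const)).mono hsub').intervalIntegrable
    have i2 : IntervalIntegrable (fun l => φ y * (p (Λ l) - p l)) volume a v :=
      ((continuousOn_const.mul ((hpc.comp_continuousOn hΛc).sub hpc.continuousOn)).mono
        hsub').intervalIntegrable
    rw [← intervalIntegral.integral_const_mul, ← intervalIntegral.integral_add i1 i2]
    refine intervalIntegral.integral_congr fun l _ => ?_
    simp only [hX, hΛ, hp]
    ring
  rw [hsplit, sourceTerm]
  have hfin : (P * (e * M + G * e) + e * (G * M)) * t * (b - a)
      + B * (((C * e + P * e) * (b - a) + (e * M + P * e)) * t) ≤ ε * t := by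
    have h5 : (P * (e * M + G * e) + e * (G * M)) * t * (b - a)
      + B * (((C * e + P * e) * (b - a) + (e * M + P * e)) * t) = e * N * t := by
      rw [hN]; ring
    rw [h5]
    have : e * N ≤ ε := by
      rw [he, div_mul_eq_mul_div, div_le_iff₀ (by positivity)]
      nlinarith
    gcongr
  have hmul := mul_le_mul (hB y hy2) hsource (abs_nonneg _) hB0
  rw [Real.norm_eq_abs, ← abs_mul] at hmul
  refine le_trans ?_ hfin
  refine le_trans (le_of_eq ?_) ((abs_add_le _ _).trans (add_le_add hflux hmul))
  congr 1
  ring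

end Expansion

/-! ### Transported subgraphs and the collapse inequality in phase space. -/

section Subgraph

local notation "𝔼" n => EuclideanSpace ℝ (Fin n)

variable {d : ℕ} {R a b t : ℝ} {f : ℝ → (𝔼 d) → ℝ → (𝔼 d)} {V : ℝ → ℝ} {φ : (𝔼 d) → ℝ}
  {F' : ℝ → (𝔼 d) × ℝ → (𝔼 d) × ℝ →L[ℝ] (𝔼 d) × ℝ} {v : (𝔼 d) → ℝ}

/-- The indicator function of the subgraph of `v`. -/
noncomputable def subgraphIndicator (v : (𝔼 d) → ℝ) (z : (𝔼 d) × ℝ) : ℝ :=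
  if z.2 ≤ v z.1 then 1 else 0

theorem transportedIndicator_eq (f : ℝ → (𝔼 d) → ℝ → (𝔼 d)) (t : ℝ) (v : (𝔼 d) → ℝ)
    (z : (𝔼 d) × ℝ) :
    transportedIndicator f t v z = subgraphIndicator v (foot f t z.1 z.2) := rfl

theorem subgraphIndicator_mem_Icc (v : (𝔼 d) → ℝ) (z : (𝔼 d) × ℝ) :
    subgraphIndicator v z ∈ Icc (0 : ℝ) 1 := by
  unfold subgraphIndicator
  split_ifs <;> simp

theorem measurable_subgraphIndicator (hv : Measurable v) : Measurable (subgraphIndicator v) :=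
  Measurable.ite (measurableSet_le measurable_snd (hv.comp measurable_fst)) measurable_const
    measurable_const

theorem setIntegral_mul_subgraphIndicator (hv : ∀ y, v y ∈ Icc a b) (g : (𝔼 d) × ℝ → ℝ) (y : 𝔼 d) :
    ∫ l in Ioo a b, g (y, l) * subgraphIndicator v (y, l) = ∫ l in a..v y, g (y, l) := by
  have h : (fun l => g (y, l) * subgraphIndicator v (y, l))
      = (Iic (v y)).indicator fun l => g (y, l) := by
    funext l
    by_cases hl : l ≤ v y
    · rw [indicator_of_mem (mem_Iic.2 hl), subgraphIndicator, if_pos hl, mul_one]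
    · rw [indicator_of_notMem (fun h => hl (mem_Iic.1 h)), subgraphIndicator, if_neg hl, mul_zero]
  rw [h, ← integral_Ioc_eq_integral_Ioo, setIntegral_indicator measurableSet_Iic, Ioc_inter_Iic,
    min_eq_right (hv y).2, intervalIntegral.integral_of_le (hv y).1]

theorem setIntegral_openBox {g : (𝔼 d) × ℝ → ℝ} (hg : IntegrableOn g (openBox d R a b)) :
    ∫ z in openBox d R a b, g z = ∫ y in Metric.ball (0 : 𝔼 d) R, ∫ l in Ioo a b, g (y, l) := by
  rw [openBox, Measure.volume_eq_prod] at *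
  exact setIntegral_prod g hg

/-- `foot` is defined by choice, but on a box all of whose points have characteristics in one
compact set it is Lipschitz, by backward Grönwall. -/
theorem aestronglyMeasurable_transportedIndicator (hF : IsC1Field (phaseField f) F') (ht : 0 ≤ t)
    (hback : ∀ z ∈ openBox d R a b, ∃ γ : ℝ → (𝔼 d) × ℝ, γ t = z ∧
      IsIntegralCurveOn γ (phaseField f) (Icc 0 t) ∧ γ 0 ∈ openBox d (R + 1) a b ∧
      ∀ s, γ s ∈ largeBox d R a b) (hv : Measurable v) :
    AEStronglyMeasurable (transportedIndicator f t v) (volume.restrict (openBox d R a b)) := by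
  obtain ⟨K, hK⟩ := hF.exists_lipschitzOnWith (isCompact_largeBox (d := d) (R := R) (a := a)
    (b := b)) convex_largeBox t
  have hlip : LipschitzOnWith ⟨Real.exp (K * t), (Real.exp_pos _).le⟩
      (fun z : (𝔼 d) × ℝ => foot f t z.1 z.2) (openBox d R a b) := by
    refine LipschitzOnWith.of_dist_le_mul fun z hz z' hz' => ?_
    obtain ⟨γ, h1, h2, -, h3⟩ := hback z hz
    obtain ⟨γ', h1', h2', -, h3'⟩ := hback z' hz'
    have h4 := dist_le_of_integralCurves_backward hK h2 h2' (fun s _ => h3 s) (fun s _ => h3' s)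
      ⟨le_rfl, ht⟩
    have h5 := foot_eq_of_isIntegralCurveOn hF ht h2
    have h5' := foot_eq_of_isIntegralCurveOn hF ht h2'
    rw [h1] at h5
    rw [h1'] at h5'
    rw [h5, h5']
    rw [h1, h1', sub_zero, mul_comm] at h4
    exact h4
  exact ((measurable_subgraphIndicator hv).comp_aemeasurable
    (hlip.continuousOn.aemeasurable isOpen_openBox.measurableSet)).aestronglyMeasurable

theorem integrableOn_mul_of_mem_Icc {h g : (𝔼 d) × ℝ → ℝ} {R : ℝ}
    (hh : ContinuousOn h (closedBox d R a b))
    (hg : AEStronglyMeasurable g (volume.restrict (openBox d R a b)))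
    (hg1 : ∀ z, g z ∈ Icc (0 : ℝ) 1) :
    IntegrableOn (fun z => h z * g z) (openBox d R a b) := by
  have hK : IsCompact (closedBox d R a b) := (isCompact_closedBall _ _).prod isCompact_Icc
  have h1 : IntegrableOn h (openBox d R a b) :=
    (hh.integrableOn_compact hK).mono_set openBox_subset_closedBox
  refine Integrable.mul_bdd (c := 1) h1 hg (ae_of_all _ fun z => ?_)
  rw [Real.norm_eq_abs, abs_of_nonneg (hg1 z).1]
  exact (hg1 z).2

/-- The kinetic form of the variation of an entropy under the transport-collapse operator. -/
theorem integrable_and_integral_le_of_kinetic (hF : IsC1Field (phaseField f) F') (ht : 0 ≤ t)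
    (hab : a < b) (hfa : ∀ t : ℝ, 0 ≤ t → ∀ x : 𝔼 d, f t x a = 0)
    (hfb : ∀ t : ℝ, 0 ≤ t → ∀ x : 𝔼 d, f t x b = 0)
    (hV : ConvexOn ℝ univ V) (hVd : Differentiable ℝ V) (hφ : Continuous φ)
    (hφ0 : ∀ x, 0 ≤ φ x) (hφR : ∀ x ∉ Metric.ball (0 : 𝔼 d) R, φ x = 0)
    {u : (𝔼 d) → ℝ} (huv : u =ᵐ[volume] v) (hvm : Measurable v) (hv : ∀ y, v y ∈ Icc a b)
    (hg : AEStronglyMeasurable (transportedIndicator f t v)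
      (volume.restrict (openBox d R a b))) :
    Integrable (fun x => (V (transportCollapse f a t u x) - V (u x)) * φ x) ∧
    ∫ x, (V (transportCollapse f a t u x) - V (u x)) * φ x
      ≤ (∫ z in openBox d R a b, deriv V z.2 * φ z.1 * transportedIndicator f t v z)
        - ∫ z in openBox d R a b, deriv V z.2 * φ z.1 * subgraphIndicator v z := by
  have hpc := continuous_deriv hV hVd
  have hh : Continuous fun z : (𝔼 d) × ℝ => deriv V z.2 * φ z.1 := by fun_prop
  set g := transportedIndicator f t v with hgdef
  have hg1 : ∀ z, g z ∈ Icc (0 : ℝ) 1 := fun z => subgraphIndicator_mem_Icc _ _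
  set S : (𝔼 d) → ℝ := fun x => a + ∫ l in Ioo a b, g (x, l) with hS
  set j : (𝔼 d) → ℝ := fun x => (V (S x) - V (v x)) * φ x with hj
  have hae : (fun x => (V (transportCollapse f a t u x) - V (u x)) * φ x) =ᵐ[volume] j := by
    filter_upwards [transportCollapse_ae_eq hF ht hfa hfb huv hv, huv] with x h1 h2
    rw [h1, h2]
  have hg' : AEStronglyMeasurable g ((volume.restrict (Metric.ball (0 : 𝔼 d) R)).prod
      (volume.restrict (Ioo a b))) := by
    rw [Measure.prod_restrict, ← Measure.volume_eq_prod]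
    exact hg
  have hSmem : ∀ x, S x ∈ Icc a b := by
    intro x
    constructor
    · exact le_add_of_nonneg_right (integral_nonneg fun l => (hg1 _).1)
    · have h1 : ‖∫ l in Ioo a b, g (x, l)‖ ≤ 1 * volume.real (Ioo a b) :=
        norm_setIntegral_le_of_norm_le_const measure_Ioo_lt_top fun l _ => by
          rw [Real.norm_eq_abs, abs_of_nonneg (hg1 _).1]
          exact (hg1 _).2
      rw [Real.volume_real_Ioo_of_le hab.le, one_mul] at h1
      have := (le_abs_self _).trans h1
      simp only [hS]
      linarith
  have hVc : Continuous V := hVd.continuous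
  obtain ⟨B, hB⟩ := (isCompact_Icc (a := a) (b := b)).exists_bound_of_continuousOn hVc.continuousOn
  obtain ⟨Q, hQ⟩ := (isCompact_closedBall (0 : 𝔼 d) R).exists_bound_of_continuousOn
    hφ.continuousOn
  have hjm : AEStronglyMeasurable j (volume.restrict (Metric.ball (0 : 𝔼 d) R)) := by
    have hSm : AEStronglyMeasurable S (volume.restrict (Metric.ball (0 : 𝔼 d) R)) :=
      aestronglyMeasurable_const.add hg'.integral_prod_right'
    exact ((hVc.comp_aestronglyMeasurable hSm).sub
      (hVc.comp_aestronglyMeasurable hvm.aestronglyMeasurable)).mul hφ.aestronglyMeasurable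
  have hjon : IntegrableOn j (Metric.ball (0 : 𝔼 d) R) := by
    have : IsFiniteMeasure (volume.restrict (Metric.ball (0 : 𝔼 d) R)) :=
      isFiniteMeasure_restrict.2 measure_ball_lt_top.ne
    refine Integrable.of_bound hjm ((B + B) * Q) ?_
    rw [ae_restrict_iff' measurableSet_ball]
    refine ae_of_all _ fun x hx => ?_
    rw [hj, norm_mul]
    have h1 := (norm_sub_le (V (S x)) (V (v x))).trans (add_le_add (hB _ (hSmem x)) (hB _ (hv x)))
    exact mul_le_mul h1 (hQ x (Metric.ball_subset_closedBall hx)) (norm_nonneg _)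
      ((norm_nonneg _).trans h1)
  have hj0 : ∀ x ∉ Metric.ball (0 : 𝔼 d) R, j x = 0 := fun x hx => by
    simp only [hj, hφR x hx, mul_zero]
  have hjint : Integrable j := by
    rwa [← integrableOn_iff_integrable_of_support_subset (s := Metric.ball (0 : 𝔼 d) R)]
    exact fun x hx => by_contra fun h => hx (hj0 x h)
  refine ⟨hjint.congr hae.symm, ?_⟩
  rw [integral_congr_ae hae, ← setIntegral_eq_integral_of_forall_compl_eq_zero hj0]
  have hk1 := integrableOn_mul_of_mem_Icc (R := R) (a := a) (b := b) hh.continuousOn hg hg1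
  have hk2 := integrableOn_mul_of_mem_Icc (R := R) (a := a) (b := b) hh.continuousOn
    (measurable_subgraphIndicator hvm).aestronglyMeasurable (subgraphIndicator_mem_Icc v)
  rw [setIntegral_openBox hk1, setIntegral_openBox hk2]
  have hi1 := (show Integrable _ ((volume.restrict (Metric.ball (0 : 𝔼 d) R)).prod
      (volume.restrict (Ioo a b))) by
    rw [Measure.prod_restrict, ← Measure.volume_eq_prod]; exact hk1).integral_prod_left
  have hi2 := (show Integrable _ ((volume.restrict (Metric.ball (0 : 𝔼 d) R)).prod
      (volume.restrict (Ioo a b))) by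
    rw [Measure.prod_restrict, ← Measure.volume_eq_prod]; exact hk2).integral_prod_left
  rw [← integral_sub hi1 hi2]
  refine integral_mono_ae hjon (hi1.sub hi2) ?_
  -- Collapse inequality on almost every vertical line, to be multiplied by `φ x ≥ 0`; the part
  -- belonging to `v` is an equality.
  filter_upwards [hg'.prodMk_left] with x hx
  have h1 := apply_add_integral_le hV hVd hab.le hx (fun l _ => (hg1 _).1) (fun l _ => (hg1 _).2)
  have h2 := integral_deriv_eq hV hVd a (v x)
  have h3 : ∫ l in Ioo a b, deriv V l * φ x * subgraphIndicator v (x, l)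
      = (V (v x) - V a) * φ x := by
    rw [setIntegral_mul_subgraphIndicator hv (fun z => deriv V z.2 * φ z.1)]
    dsimp only
    rw [intervalIntegral.integral_mul_const, h2]
  have h4 : ∫ l in Ioo a b, deriv V l * φ x * g (x, l)
      = (∫ l in Ioo a b, deriv V l * g (x, l)) * φ x := by
    rw [← integral_mul_const]
    exact integral_congr_ae (ae_of_all _ fun l => by ring)
  simp only [hj]
  rw [h3, h4, ← sub_mul]
  refine mul_le_mul_of_nonneg_right ?_ (hφ0 x)
  simp only [hS]
  linarith

end Subgraph

/-! ### First-order expansions of both sides, uniform in `u`. -/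

section Estimates

local notation "𝔼" n => EuclideanSpace ℝ (Fin n)

variable {d : ℕ} {R a b : ℝ} {f : ℝ → (𝔼 d) → ℝ → (𝔼 d)} {V : ℝ → ℝ} {φ : (𝔼 d) → ℝ}

/-- First-order expansion in time of the kinetic form of the entropy variation. -/
theorem exists_abs_kinetic_sub_le
    (hf : ContDiffOn ℝ 2 (fun p : ℝ × (𝔼 d) × ℝ => f p.1 p.2.1 p.2.2) {p | 0 ≤ p.1})
    (hab : a < b) (hfa : ∀ t : ℝ, 0 ≤ t → ∀ x : 𝔼 d, f t x a = 0)
    (hfb : ∀ t : ℝ, 0 ≤ t → ∀ x : 𝔼 d, f t x b = 0)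
    (hV : ConvexOn ℝ univ V) (hVd : Differentiable ℝ V) (hφ : ContDiff ℝ ∞ φ)
    (hφR : ∀ x ∉ Metric.ball (0 : 𝔼 d) R, φ x = 0) {ε : ℝ} (hε : 0 < ε) :
    ∃ δ > 0, ∀ t ∈ Ioo 0 δ, ∀ v : (𝔼 d) → ℝ, Measurable v → (∀ y, v y ∈ Icc a b) →
      |((∫ z in openBox d R a b, deriv V z.2 * φ z.1 * transportedIndicator f t v z)
          - ∫ z in openBox d R a b, deriv V z.2 * φ z.1 * subgraphIndicator v z)
        - t * ∫ y in Metric.ball (0 : 𝔼 d) (R + 1),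
            (fluxTerm f V φ a 0 (y, v y) + sourceTerm f V φ a 0 (y, v y))| ≤ ε * t := by
  have hF := isC1Field_phaseField hf
  have hpc := continuous_deriv hV hVd
  set h : (𝔼 d) × ℝ → ℝ := fun z => deriv V z.2 * φ z.1 with hh
  have hhc : Continuous h :=
    (hpc.comp continuous_snd).mul (hφ.continuous.comp continuous_fst)
  obtain ⟨B₀, hB₀⟩ := (isCompact_largeBox (d := d) (R := R) (a := a)
    (b := b)).exists_bound_of_continuousOn hhc.continuousOn
  set B := max B₀ 0 with hB
  have hB0 : 0 ≤ B := le_max_right _ _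
  set m := volume.real (Metric.ball (0 : 𝔼 d) (R + 1)) with hm
  have hm0 : 0 ≤ m := measureReal_nonneg
  obtain ⟨δ₁, hδ₁, h1⟩ := exists_isFlowOn (R := R) (a := a) (b := b) hF
  obtain ⟨δ₂, hδ₂, h2⟩ := exists_backward_curve hF hfa hfb R
  obtain ⟨δ₃, hδ₃, h3⟩ := exists_integral_image_flow_sub_le hf R a b
    (ε := ε / 2 / (B + 1)) (by positivity)
  obtain ⟨δ₄, hδ₄, h4⟩ := exists_abs_integral_flow_sub_le hf hab hfa hfb hV hVd hφ R
    (ε := ε / 2 / (m + 1)) (by positivity)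
  refine ⟨min (min δ₁ δ₂) (min δ₃ δ₄), by positivity, fun t ht v hvm hv => ?_⟩
  have ht0 := ht.1
  have ht1 : t ∈ Ioo 0 δ₁ := ⟨ht0, ht.2.trans_le ((min_le_left _ _).trans (min_le_left _ _))⟩
  have ht2 : t ∈ Ioo 0 δ₂ := ⟨ht0, ht.2.trans_le ((min_le_left _ _).trans (min_le_right _ _))⟩
  have ht3 : t ∈ Ioo 0 δ₃ := ⟨ht0, ht.2.trans_le ((min_le_right _ _).trans (min_le_left _ _))⟩
  have ht4 : t ∈ Ioo 0 δ₄ := ⟨ht0, ht.2.trans_le ((min_le_right _ _).trans (min_le_right _ _))⟩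
  obtain ⟨Γ, hΓ⟩ := h1 t ht1
  obtain ⟨K, hK⟩ := hΓ.exists_lipschitzOnWith hF ht0.le
  set W := openBox d (R + 1) a b with hW
  have hWm : MeasurableSet W := isOpen_openBox.measurableSet
  have hWC : W ⊆ closedBox d (R + 1) a b := openBox_subset_closedBox
  have hUW : openBox d R a b ⊆ W :=
    prod_mono (Metric.ball_subset_ball (by linarith)) subset_rfl
  set k : (𝔼 d) × ℝ → ℝ := fun z => h z * transportedIndicator f t v z with hk
  have hkΓ : ∀ w ∈ W, k (Γ w t) = h (Γ w t) * subgraphIndicator v w := by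
    intro w hw
    rw [hk]
    dsimp only
    rw [transportedIndicator_eq, hΓ.foot_eq hF ht0.le (hWC hw)]
  have hhΓ : ContinuousOn (fun w => h (Γ w t)) (closedBox d (R + 1) a b) :=
    hhc.comp_continuousOn hK.continuousOn
  have hsm := (measurable_subgraphIndicator hvm).aestronglyMeasurable
    (μ := volume.restrict W)
  have i1 := integrableOn_mul_of_mem_Icc hhΓ hsm (subgraphIndicator_mem_Icc v)
  have i2 := integrableOn_mul_of_mem_Icc hhc.continuousOn hsm (subgraphIndicator_mem_Icc v)
  have i3 := integrableOn_mul_of_mem_Icc (hhΓ.sub hhc.continuousOn) hsm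
    (subgraphIndicator_mem_Icc v)
  -- Since `φ` vanishes outside the ball of radius `R`, the integrals over the box of radius `R + 1`
  -- and over its image under the flow both reduce to the box of radius `R`.
  have hcut : ∀ g : (𝔼 d) × ℝ → ℝ, ∀ z, z.2 ∈ Ioo a b → z ∉ openBox d R a b → h z * g z = 0 := by
    intro g z hz hzU
    have : φ z.1 = 0 := hφR _ fun h' => hzU ⟨h', hz⟩
    simp [hh, this]
  -- Along the flow the transported indicator becomes the indicator of the original subgraph,
  -- because the foot of `Γ w t` is `w`.
  have e1 := h3 t ht3 Γ hΓ k B hB0 (fun w hw => by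
      rw [hkΓ w hw, abs_mul, abs_of_nonneg (subgraphIndicator_mem_Icc v w).1]
      have := (hB₀ _ (hΓ.mem w (hWC hw) t ⟨ht0.le, le_rfl⟩)).trans (le_max_left B₀ 0)
      exact (mul_le_mul this (subgraphIndicator_mem_Icc v w).2
        (subgraphIndicator_mem_Icc v w).1 hB0).trans_eq (mul_one _))
    (i1.aestronglyMeasurable.congr
      ((ae_restrict_iff' hWm).2 (ae_of_all _ fun w hw => (hkΓ w hw).symm)))
  have e2 : ∫ z in (fun w => Γ w t) '' W, k z = ∫ z in openBox d R a b, k z := by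
    refine setIntegral_eq_of_subset_of_forall_sdiff_eq_zero
      (hWm.image_of_continuousOn_injOn (hK.continuousOn.mono hWC)
        ((hΓ.injOn hF ht0.le).mono hWC)) (hΓ.openBox_subset_image hF ht2 h2) ?_
    rintro _ ⟨⟨w, hw, rfl⟩, hzU⟩
    exact hcut _ _ (hΓ.snd_mem_Ioo hF ht0.le hfa hfb hw) hzU
  have e3 : ∫ w in W, k (Γ w t) = ∫ w in W, h (Γ w t) * subgraphIndicator v w :=
    setIntegral_congr_fun hWm hkΓ
  have e4 : ∫ z in W, h z * subgraphIndicator v z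
      = ∫ z in openBox d R a b, h z * subgraphIndicator v z :=
    setIntegral_eq_of_subset_of_forall_sdiff_eq_zero hWm hUW
      fun z hz => hcut _ z hz.1.2 hz.2
  -- After the change of variables the same indicator multiplies both integrands, and Fubini leaves
  -- vertical segments from `a` to `v y`.
  have e5 : (∫ w in W, h (Γ w t) * subgraphIndicator v w)
      - ∫ w in W, h w * subgraphIndicator v w
      = ∫ y in Metric.ball (0 : 𝔼 d) (R + 1), ∫ l in a..v y, (h (Γ (y, l) t) - h (y, l)) := by
    rw [← integral_sub i1 i2]
    have : ∀ y, ∫ l in a..v y, (h (Γ (y, l) t) - h (y, l))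
        = ∫ l in Ioo a b, (h (Γ (y, l) t) - h (y, l)) * subgraphIndicator v (y, l) := fun y =>
      (setIntegral_mul_subgraphIndicator hv (fun z => h (Γ z t) - h z) y).symm
    simp_rw [this]
    rw [← setIntegral_openBox (g := fun z => (h (Γ z t) - h z) * subgraphIndicator v z) i3]
    exact integral_congr_ae (ae_of_all _ fun z => (sub_mul _ _ _).symm)
  have i4 : IntegrableOn (fun y => ∫ l in a..v y, (h (Γ (y, l) t) - h (y, l)))
      (Metric.ball (0 : 𝔼 d) (R + 1)) := by
    have := (show Integrable (fun z => (h (Γ z t) - h z) * subgraphIndicator v z)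
        ((volume.restrict (Metric.ball (0 : 𝔼 d) (R + 1))).prod (volume.restrict (Ioo a b))) by
      rw [Measure.prod_restrict, ← Measure.volume_eq_prod]; exact i3).integral_prod_left
    refine this.congr (ae_of_all _ fun y => ?_)
    exact setIntegral_mul_subgraphIndicator hv (fun z => h (Γ z t) - h z) y
  have hq : Continuous fun z : (𝔼 d) × ℝ =>
      fluxTerm f V φ a 0 z + sourceTerm f V φ a 0 z :=
    ((continuous_fluxTerm hF hpc hφ).add (continuous_sourceTerm hF hpc hφ)).comp
      (by fun_prop : Continuous fun z : (𝔼 d) × ℝ => ((0 : ℝ), z))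
  have i5 := integrableOn_comp_of_continuous hq (measurableSet_ball (x := (0 : 𝔼 d)) (ε := R + 1))
    (isCompact_closedBall (0 : 𝔼 d) (R + 1)) Metric.ball_subset_closedBall hvm hv
  have e6 : |(∫ y in Metric.ball (0 : 𝔼 d) (R + 1), ∫ l in a..v y, (h (Γ (y, l) t) - h (y, l)))
      - t * ∫ y in Metric.ball (0 : 𝔼 d) (R + 1),
          (fluxTerm f V φ a 0 (y, v y) + sourceTerm f V φ a 0 (y, v y))|
      ≤ ε / 2 / (m + 1) * t * m := by
    rw [← integral_const_mul, ← integral_sub i4 (i5.const_mul t), ← Real.norm_eq_abs]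
    exact norm_setIntegral_le_of_norm_le_const measure_ball_lt_top fun y hy =>
      h4 t ht4 Γ hΓ y (Metric.ball_subset_closedBall hy) (v y) (hv y)
  rw [e2, e3] at e1
  rw [← e5, e4] at e6
  have e7 : ε / 2 / (B + 1) * t * B ≤ ε / 2 * t := by
    have : ε / 2 / (B + 1) * t * B = ε / 2 * t * (B / (B + 1)) := by ring
    rw [this]
    exact mul_le_of_le_one_right (by positivity) ((div_le_one (by positivity)).2 (by linarith))
  have e8 : ε / 2 / (m + 1) * t * m ≤ ε / 2 * t := by
    have : ε / 2 / (m + 1) * t * m = ε / 2 * t * (m / (m + 1)) := by ring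
    rw [this]
    exact mul_le_of_le_one_right (by positivity) ((div_le_one (by positivity)).2 (by linarith))
  rw [abs_le] at e1 e6 ⊢
  constructor <;> linarith [e1.1, e1.2, e6.1, e6.2]

/-- First-order expansion in time of the entropy flux and entropy source terms. -/
theorem exists_abs_entropy_sub_le (hF : IsC1Field (phaseField f) (phaseDeriv f))
    (hfa : ∀ t : ℝ, 0 ≤ t → ∀ x : 𝔼 d, f t x a = 0)
    (hV : ConvexOn ℝ univ V) (hVd : Differentiable ℝ V) (hφ : ContDiff ℝ ∞ φ)
    (hφR : ∀ x ∉ Metric.ball (0 : 𝔼 d) R, φ x = 0)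
    (hφR' : ∀ x ∉ Metric.ball (0 : 𝔼 d) R, fderiv ℝ φ x = 0) {ε : ℝ} (hε : 0 < ε) :
    ∃ δ > 0, ∀ t ∈ Ioo 0 δ, ∀ u v : (𝔼 d) → ℝ, u =ᵐ[volume] v → Measurable v →
      (∀ y, v y ∈ Icc a b) →
      |((∫ s in (0 : ℝ)..t, ∫ x, inner ℝ (entropyFlux f V a s x (u x)) (gradient φ x))
          - ∫ s in (0 : ℝ)..t, ∫ x, (∫ lam in Ioc a (u x), fluxDiv f s x lam
              ∂(secondDeriv V hV)) * φ x)
        - t * ∫ y in Metric.ball (0 : 𝔼 d) R,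
            (fluxTerm f V φ a 0 (y, v y) + sourceTerm f V φ a 0 (y, v y))| ≤ ε * t := by
  have hpc := continuous_deriv hV hVd
  have hc1 := continuous_fluxTerm (a := a) hF hpc hφ
  have hc2 := continuous_sourceTerm (a := a) hF hpc hφ
  have hSm : MeasurableSet (Metric.ball (0 : 𝔼 d) R) := measurableSet_ball
  have hSK : Metric.ball (0 : 𝔼 d) R ⊆ Metric.closedBall 0 R := Metric.ball_subset_closedBall
  have hK : IsCompact (Metric.closedBall (0 : 𝔼 d) R) := isCompact_closedBall _ _
  obtain ⟨δ₁, hδ₁, h1⟩ := exists_abs_integral_sub_le (a := a) (b := b) hc1 hSm hK hSK (half_pos hε)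
  obtain ⟨δ₂, hδ₂, h2⟩ := exists_abs_integral_sub_le (a := a) (b := b) hc2 hSm hK hSK (half_pos hε)
  refine ⟨min δ₁ δ₂, by positivity, fun t ht u v huv hvm hv => ?_⟩
  have e1 := h1 t ⟨ht.1, ht.2.trans_le (min_le_left _ _)⟩ v hvm hv
  have e2 := h2 t ⟨ht.1, ht.2.trans_le (min_le_right _ _)⟩ v hvm hv
  have e3 : (∫ s in (0 : ℝ)..t, ∫ x, inner ℝ (entropyFlux f V a s x (u x)) (gradient φ x))
      = ∫ s in (0 : ℝ)..t, ∫ y in Metric.ball (0 : 𝔼 d) R, fluxTerm f V φ a s (y, v y) := by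
    refine intervalIntegral.integral_congr fun s hs => ?_
    rw [uIcc_of_le ht.1.le] at hs
    rw [setIntegral_eq_integral_of_forall_compl_eq_zero
      (fun x hx => by simp [fluxTerm, hφR' x hx])]
    refine integral_congr_ae ?_
    filter_upwards [huv] with x hx
    rw [hx, inner_entropyFlux_gradient hF hpc hs.1]
  have e4 : (∫ s in (0 : ℝ)..t, ∫ x, (∫ lam in Ioc a (u x), fluxDiv f s x lam
        ∂(secondDeriv V hV)) * φ x)
      = -∫ s in (0 : ℝ)..t, ∫ y in Metric.ball (0 : 𝔼 d) R, sourceTerm f V φ a s (y, v y) := by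
    rw [← intervalIntegral.integral_neg]
    refine intervalIntegral.integral_congr fun s hs => ?_
    rw [uIcc_of_le ht.1.le] at hs
    rw [← integral_neg, setIntegral_eq_integral_of_forall_compl_eq_zero
      (fun x hx => by simp [sourceTerm, hφR x hx])]
    refine integral_congr_ae ?_
    filter_upwards [huv] with x hx
    rw [hx, setIntegral_fluxDiv_mul hF hfa hV hVd hs.1 x (hv x).1]
  have hs0 : Continuous fun z : (𝔼 d) × ℝ => ((0 : ℝ), z) := by fun_prop
  have i1 := integrableOn_comp_of_continuous (hc1.comp hs0) hSm hK hSK hvm hv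
  have i2 := integrableOn_comp_of_continuous (hc2.comp hs0) hSm hK hSK hvm hv
  have e5 : ∫ y in Metric.ball (0 : 𝔼 d) R,
      (fluxTerm f V φ a 0 (y, v y) + sourceTerm f V φ a 0 (y, v y))
      = (∫ y in Metric.ball (0 : 𝔼 d) R, fluxTerm f V φ a 0 (y, v y))
        + ∫ y in Metric.ball (0 : 𝔼 d) R, sourceTerm f V φ a 0 (y, v y) := integral_add i1 i2
  rw [e3, e4, e5]
  rw [abs_le] at e1 e2 ⊢
  constructor <;> linarith [e1.1, e1.2, e2.1, e2.2]

/-- Truncation of a measurable representative: bounds at every point allow the compactness estimates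
to be applied pointwise. -/
theorem exists_measurable_mem_Icc {u : (𝔼 d) → ℝ} (hab : a < b)
    (hu : AEStronglyMeasurable u volume) (huab : ∀ᵐ x, a ≤ u x ∧ u x ≤ b) :
    ∃ v : (𝔼 d) → ℝ, u =ᵐ[volume] v ∧ Measurable v ∧ ∀ y, v y ∈ Icc a b := by
  refine ⟨fun x => max a (min b (hu.mk u x)), ?_,
    measurable_const.max (measurable_const.min hu.stronglyMeasurable_mk.measurable), fun y =>
      ⟨le_max_left _ _, max_le hab.le (min_le_left _ _)⟩⟩
  filter_upwards [hu.ae_eq_mk, huab] with x h1 h2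
  rw [← h1, min_eq_right h2.2, max_eq_right h2.1]

end Estimates

end TransportCollapse

/-! ### Conclusion: comparison of the two expansions. -/

theorem mainTheorem6 (d : ℕ)
    (f : ℝ → EuclideanSpace ℝ (Fin d) → ℝ → EuclideanSpace ℝ (Fin d))
    (hf : ContDiffOn ℝ 2
      (fun p : ℝ × EuclideanSpace ℝ (Fin d) × ℝ => f p.1 p.2.1 p.2.2) {p | 0 ≤ p.1})
    (a b : ℝ) (hab : a < b)
    (hfa : ∀ t : ℝ, 0 ≤ t → ∀ x : EuclideanSpace ℝ (Fin d), f t x a = 0)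
    (hfb : ∀ t : ℝ, 0 ≤ t → ∀ x : EuclideanSpace ℝ (Fin d), f t x b = 0)
    (V : ℝ → ℝ) (hV : ConvexOn ℝ Set.univ V) (hVL : ∃ K, LipschitzWith K V)
    (hVd : Differentiable ℝ V)
    (φ : EuclideanSpace ℝ (Fin d) → ℝ) (hφ : ContDiff ℝ ∞ φ) (hφc : HasCompactSupport φ)
    (hφ0 : ∀ x, 0 ≤ φ x) :
    ∃ r : ℝ → ℝ, (r =o[𝓝[>] (0 : ℝ)] fun t : ℝ => t) ∧
      ∃ δ : ℝ, 0 < δ ∧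
        ∀ u : EuclideanSpace ℝ (Fin d) → ℝ, Integrable u →
          (∀ᵐ x, a ≤ u x ∧ u x ≤ b) →
          ∀ t ∈ Set.Ioo 0 δ,
            Integrable (fun x : EuclideanSpace ℝ (Fin d) =>
              (V (TransportCollapse.transportCollapse f a t u x) - V (u x)) * φ x) ∧
            ∫ x : EuclideanSpace ℝ (Fin d),
                (V (TransportCollapse.transportCollapse f a t u x) - V (u x)) * φ x
              ≤ (∫ s in (0 : ℝ)..t, ∫ x : EuclideanSpace ℝ (Fin d),
                    inner ℝ (TransportCollapse.entropyFlux f V a s x (u x)) (gradient φ x))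
                - (∫ s in (0 : ℝ)..t, ∫ x : EuclideanSpace ℝ (Fin d),
                    (∫ lam in Set.Ioc a (u x), TransportCollapse.fluxDiv f s x lam
                      ∂(TransportCollapse.secondDeriv V hV)) * φ x)
                + r t := by
  have hF := TransportCollapse.isC1Field_phaseField hf
  obtain ⟨R, hR⟩ := hφc.isCompact.isBounded.subset_ball (0 : EuclideanSpace ℝ (Fin d))
  have hφR : ∀ x ∉ Metric.ball (0 : EuclideanSpace ℝ (Fin d)) R, φ x = 0 := fun x hx =>
    image_eq_zero_of_notMem_tsupport fun h => hx (hR h)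
  -- The radius `R + 1` is chosen so that the leading term of the entropy side is an integral over
  -- the same ball as that of the kinetic side.
  have hφR' : ∀ x ∉ Metric.ball (0 : EuclideanSpace ℝ (Fin d)) (R + 1), fderiv ℝ φ x = 0 :=
    fun x hx => image_eq_zero_of_notMem_tsupport fun h =>
      hx (Metric.ball_subset_ball (by linarith) (hR (tsupport_fderiv_subset ℝ h)))
  have hφR1 : ∀ x ∉ Metric.ball (0 : EuclideanSpace ℝ (Fin d)) (R + 1), φ x = 0 := fun x hx =>
    hφR x fun h => hx (Metric.ball_subset_ball (by linarith) h)
  obtain ⟨δ₀, hδ₀, h0⟩ := TransportCollapse.exists_backward_curve hF hfa hfb R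
  have hkin : ∀ t ∈ Ioo 0 δ₀, ∀ u v : EuclideanSpace ℝ (Fin d) → ℝ, u =ᵐ[volume] v →
      Measurable v → (∀ y, v y ∈ Icc a b) → _ := fun t ht u v huv hvm hv =>
    TransportCollapse.integrable_and_integral_le_of_kinetic (R := R) hF ht.1.le hab hfa hfb hV hVd
      hφ.continuous hφ0 hφR huv hvm hv
      (TransportCollapse.aestronglyMeasurable_transportedIndicator hF ht.1.le (h0 t ht) hvm)
  -- The family is indexed by all admissible `u`, so the remainder depends on `u` only through `a`
  -- and `b`. The leading terms of the two expansions are the same multiple of `t` and cancel,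
  -- leaving two errors of `ε t / 2`.
  obtain ⟨r, hr, δ₁, hδ₁, h1⟩ := TransportCollapse.exists_isLittleO_of_forall_exists
    (ι := {u : EuclideanSpace ℝ (Fin d) → ℝ // Integrable u ∧ ∀ᵐ x, a ≤ u x ∧ u x ≤ b})
    (G := fun u t => (∫ x : EuclideanSpace ℝ (Fin d),
        (V (TransportCollapse.transportCollapse f a t u.1 x) - V (u.1 x)) * φ x)
      - ((∫ s in (0 : ℝ)..t, ∫ x : EuclideanSpace ℝ (Fin d),
            inner ℝ (TransportCollapse.entropyFlux f V a s x (u.1 x)) (gradient φ x))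
        - (∫ s in (0 : ℝ)..t, ∫ x : EuclideanSpace ℝ (Fin d),
            (∫ lam in Set.Ioc a (u.1 x), TransportCollapse.fluxDiv f s x lam
              ∂(TransportCollapse.secondDeriv V hV)) * φ x))) (by
    intro ε hε
    obtain ⟨δ₁, hδ₁, h1⟩ := TransportCollapse.exists_abs_kinetic_sub_le hf hab hfa hfb hV hVd hφ
      hφR (half_pos hε)
    obtain ⟨δ₂, hδ₂, h2⟩ := TransportCollapse.exists_abs_entropy_sub_le (b := b) hF hfa hV hVd hφ
      hφR1 hφR' (half_pos hε)
    refine ⟨min δ₀ (min δ₁ δ₂), by positivity, fun t ht u => ?_⟩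
    obtain ⟨v, huv, hvm, hv⟩ := TransportCollapse.exists_measurable_mem_Icc hab
      u.2.1.aestronglyMeasurable u.2.2
    have ht0 : t ∈ Ioo 0 δ₀ := ⟨ht.1, ht.2.trans_le (min_le_left _ _)⟩
    have ht1 : t ∈ Ioo 0 δ₁ :=
      ⟨ht.1, ht.2.trans_le ((min_le_right _ _).trans (min_le_left _ _))⟩
    have ht2 : t ∈ Ioo 0 δ₂ :=
      ⟨ht.1, ht.2.trans_le ((min_le_right _ _).trans (min_le_right _ _))⟩
    have e0 := (hkin t ht0 u.1 v huv hvm hv).2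
    have e1 := (abs_le.1 (h1 t ht1 v hvm hv)).2
    have e2 := (abs_le.1 (h2 t ht2 u.1 v huv hvm hv)).1
    linarith)
  refine ⟨r, hr, min δ₀ δ₁, by positivity, fun u hu huab t ht => ?_⟩
  have ht0 : t ∈ Ioo 0 δ₀ := ⟨ht.1, ht.2.trans_le (min_le_left _ _)⟩
  obtain ⟨v, huv, hvm, hv⟩ := TransportCollapse.exists_measurable_mem_Icc hab
    hu.aestronglyMeasurable huab
  have e1 := h1 t ⟨ht.1, ht.2.trans_le (min_le_right _ _)⟩ ⟨u, hu, huab⟩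
  exact ⟨(hkin t ht0 u v huv hvm hv).1, by linarith⟩
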